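/- \textbf{Definitions.} \emph{Algorithms} are randomized, and time is counted in steps of a random access machine whose only arithmetic operations are addition and truncated subtraction (polynomially equivalent to Turing machines). $\log$ is to base $2$. \emph{Random $K$-XOR.} A $K$-tuple on $n$ variables is a map $C:\{\pm1\}^n\to\{\pm1\}^K$ of the form $C(\psi)_i=\sigma_i\psi_{v_i}$ with signs $\sigma_i\in\{\pm1\}$ and distinct $v_1,\dots,v_K\in[n]$. A $K$-formula with $m$ constraints is a sequence $J=(C_1,\dots,C_m)$ of $K$-tuples, and its value is $\mathrm{VAL}(J)=\max_{\psi\in\{\pm1\}^n}\frac1m\left|\{j:\prod_{i=1}^K C_j(\psi)_i=1\}\right|$. For $K=K(n)$, $m=m(n)$ and $0<\eta<\frac12$, the problem $\mathrm{CSP}^{\mathrm{rand},1-\eta}_m(\mathrm{XOR}_K)$ is \emph{easy} if there is a randomized algorithm $\mathcal A$, running in time polynomial in $n$, $K$ and $m$ on $K$-formulas $J$ with $n$ variables and $m$ constraints, such that $\Pr_{\text{coins}}(\mathcal A(J)=\text{``non-random''})\ge\frac34$ whenever $\mathrm{VAL}(J)\ge1-\eta$, and such that, if the constraints of $J$ are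 chosen uniformly and independently, then with probability $1-o_n(1)$ over $J$ one has $\Pr_{\text{coins}}(\mathcal A(J)=\text{``random''})\ge\frac34$. Otherwise it is \emph{hard}. \emph{Assumption 1.} There are constants $c>0$ and $0<\eta<\frac12$ such that for every integer $K\ge1$ and $m=\lfloor n^{c\log(K)\sqrt K}\rfloor$ the problem $\mathrm{CSP}^{\mathrm{rand},1-\eta}_m(\mathrm{XOR}_K)$ is hard. \emph{Assumption 2.} There are constants $c>0$ and $0<\eta<\frac12$ such that for every integer $s\ge1$, $K=\lceil\log^s n\rceil$ and $m=\lfloor n^{cK}\rfloor$ the problem $\mathrm{CSP}^{\mathrm{rand},1-\eta}_m(\mathrm{XOR}_K)$ is hard. \emph{Learning.} For a distribution $\mathcal D$ on $\{\pm1\}^n\times\{\pm1\}$ and $h:\{\pm1\}^n\to\{\pm1\}$ let $\mathrm{Err}_{\mathcal D}(h)=\Pr_{(x,y)\sim\mathcal D}(h(x)\ne y)$. For $w\in\mathbb R^n$ let $h_w(x)=\mathrm{sign}\langle w,x\rangle$ (with $\mathrm{sign}(0)=1$). $\mathcal D$ is \emph{$\eta$-almost realizable} if $\min_{w\in\mathbb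 R^n}\mathrm{Err}_{\mathcal D}(h_w)\le\eta$. A \emph{$\mathrm{poly}(n)$-time learning algorithm} gets $n$ and access to independent examples from $\mathcal D$, runs in time polynomial in $n$, and returns a description of some hypothesis $h:\{\pm1\}^n\to\{\pm1\}$ (not necessarily a halfspace) that can be evaluated from the description in time polynomial in $n$. It has \emph{non-trivial performance} on a family of distributions if there are constants $c>0$ and $\delta>0$ such that, for all large enough $n$ and all $\mathcal D$ on $\{\pm1\}^n\times\{\pm1\}$ in the family, with probability at least $\delta$ its hypothesis has $\mathrm{Err}_{\mathcal D}(h)\le\frac12-\frac1{n^c}$. \textbf{Theorem 1.} (i) Under Assumption 1, for every $\eta>0$ there is no $\mathrm{poly}(n)$-time learning algorithm with non-trivial performance on the $\eta$-almost-realizable distributions on $\{\pm1\}^n\times\{\pm1\}$. (ii) Under Assumption 2, for every $\nu>0$ there is no $\mathrm{poly}(n)$-time learning algorithm with non-trivial performance on the $2^{-\log^{1-\nu}(n)}$-almost-realizable distributions on $\{\pm1\}^n\times\{\pm1\}$. -/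

import Mathlib

noncomputable section

namespace HalfspaceHardness

open Filter Topology

/-! ### Randomized algorithms

A random access machine with structured control flow. The memory consists of arrays of natural
numbers (array `a`, index `i`), the output is a write-only list. The only arithmetic operations are
addition and truncated subtraction, so the bit length of the numbers grows by at most a constant
per step, and the number of steps is polynomially related to time on a Turing machine. Coins are
fair, and the instruction `sample` draws a fresh example from an oracle. -/

/-- Expressions: constants, array look-up, addition and truncated subtraction. -/
inductive Expr : Type
  | const (k : ℕ)
  | get (a : ℕ) (i : Expr)
  | add (e₁ e₂ : Expr)
  | sub (e₁ e₂ : Expr)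

/-- Programs. -/
inductive Prog : Type
  | skip
  /-- store the value of `e` in array `a` at index `i` -/
  | set (a : ℕ) (i e : Expr)
  /-- store a fair coin (0 or 1) in array `a` at index `i` -/
  | flip (a : ℕ) (i : Expr)
  /-- draw a fresh example from the oracle and store it at the beginning of array `a` -/
  | sample (a : ℕ)
  /-- append the value of `e` to the output -/
  | emit (e : Expr)
  | seq (P Q : Prog)
  /-- run `P` if `e` is nonzero, and `Q` otherwise -/
  | ite (e : Expr) (P Q : Prog)
  /-- run `P` as long as `e` is nonzero -/
  | loop (e : Expr) (P : Prog)

/-- The content of the memory: `s a i` is the entry of array `a` at index `i`. -/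
abbrev Memory : Type := ℕ → ℕ → ℕ

/-- The value of an expression. -/
def Expr.eval (s : Memory) : Expr → ℕ
  | const k => k
  | get a i => s a (i.eval s)
  | add e₁ e₂ => e₁.eval s + e₂.eval s
  | sub e₁ e₂ => e₁.eval s - e₂.eval s

/-- The array that holds the list `l` (and 0 beyond the end of `l`). -/
def arrayOf (l : List ℕ) : ℕ → ℕ := fun i => l.getD i 0

/-- Storing the value `v` in array `a` at index `i`. -/
def Memory.store (s : Memory) (a i v : ℕ) : Memory :=
  Function.update s a (Function.update (s a) i v)

/-- A configuration: what is still to be executed, the memory and the output so far. -/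
structure Config : Type where
  todo : List Prog
  mem : Memory
  out : List ℕ

/-- One step of the machine, where `O` is the distribution of the examples. A configuration with
nothing left to execute has halted, and does not change any more. -/
def step (O : PMF (List ℕ)) : Config → PMF Config
  | ⟨[], s, o⟩ => PMF.pure ⟨[], s, o⟩
  | ⟨.skip :: k, s, o⟩ => PMF.pure ⟨k, s, o⟩
  | ⟨.set a i e :: k, s, o⟩ => PMF.pure ⟨k, s.store a (i.eval s) (e.eval s), o⟩
  | ⟨.flip a i :: k, s, o⟩ =>
      (PMF.uniformOfFintype Bool).map fun b => ⟨k, s.store a (i.eval s) b.toNat, o⟩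
  | ⟨.sample a :: k, s, o⟩ =>
      O.map fun l => ⟨k, Function.update s a fun i => l.getD i (s a i), o⟩
  | ⟨.emit e :: k, s, o⟩ => PMF.pure ⟨k, s, o ++ [e.eval s]⟩
  | ⟨.seq P Q :: k, s, o⟩ => PMF.pure ⟨P :: Q :: k, s, o⟩
  | ⟨.ite e P Q :: k, s, o⟩ => PMF.pure ⟨(if e.eval s ≠ 0 then P else Q) :: k, s, o⟩
  | ⟨.loop e P :: k, s, o⟩ =>
      PMF.pure ⟨if e.eval s ≠ 0 then P :: .loop e P :: k else k, s, o⟩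

/-- The initial configuration: the input is in array 0, everything else is 0. -/
def initial (P : Prog) (input : List ℕ) : Config :=
  ⟨[P], Function.update 0 0 (arrayOf input), []⟩

/-- The distribution of the configuration after `t` steps. -/
def run (O : PMF (List ℕ)) (P : Prog) (input : List ℕ) : ℕ → PMF Config
  | 0 => PMF.pure (initial P input)
  | t + 1 => (run O P input t).bind (step O)

/-- `P` always (whatever the coins and the examples) halts after at most `t` steps. -/
def HaltsWithin (O : PMF (List ℕ)) (P : Prog) (input : List ℕ) (t : ℕ) : Prop :=
  ∀ c ∈ (run O P input t).support, c.todo = []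

/-- The distribution of the output of `P` after `t` steps. -/
def output (O : PMF (List ℕ)) (P : Prog) (input : List ℕ) (t : ℕ) : PMF (List ℕ) :=
  (run O P input t).map Config.out

/-- The oracle of an algorithm that has no access to examples. -/
def noExamples : PMF (List ℕ) := PMF.pure []

/-- The bit that represents an element of `{±1}`: 1 for `1`, and 0 for `-1`. -/
def bit (u : ℤˣ) : ℕ := if u = 1 then 1 else 0

/-! ### Random `K`-XOR -/

/-- `K`-tuples: `K` literals on different variables. The pair `(v, σ)` stands for the map
`{±1}^n → {±1}^K` whose `i`-th coordinate is `ψ ↦ σ i * ψ (v i)`. -/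
abbrev KTuple (n K : ℕ) : Type := (Fin K ↪ Fin n) × (Fin K → ℤˣ)

/-- The map `{±1}^n → {±1}^K` given by a `K`-tuple. -/
def KTuple.apply {n K : ℕ} (C : KTuple n K) (ψ : Fin n → ℤˣ) : Fin K → ℤˣ :=
  fun i => C.2 i * ψ (C.1 i)

/-- `XOR_K` on `{±1}^K`. -/
def xor {K : ℕ} (z : Fin K → ℤˣ) : ℤˣ := ∏ i, z i

/-- `K`-formulas with `n` variables and `m` constraints. -/
abbrev KFormula (n K m : ℕ) : Type := Fin m → KTuple n K

/-- The fraction of the constraints of `J` that are satisfied by the assignment `ψ`. -/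
def valAt {n K m : ℕ} (J : KFormula n K m) (ψ : Fin n → ℤˣ) : ℝ :=
  (Set.ncard {j : Fin m | xor ((J j).apply ψ) = 1} : ℝ) / m

/-- The value of a formula: the maximum of `valAt J ψ` over all assignments. -/
def val {n K m : ℕ} (J : KFormula n K m) : ℝ := ⨆ ψ : Fin n → ℤˣ, valAt J ψ

/-- The formula as an input: the numbers `n`, `K`, `m`, and then, for each constraint and each of
its literals, the variable and the bit of the sign. -/
def encodeFormula {n K m : ℕ} (J : KFormula n K m) : List ℕ :=
  n :: K :: m :: (List.ofFn fun j : Fin m =>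
    (List.ofFn fun i : Fin K => [((J j).1 i : ℕ), bit ((J j).2 i)]).flatten).flatten

/-- The problem `CSP^{rand,1-η}_m(XOR_K)` is easy: there is a randomized algorithm, running in
time polynomial in `n`, `K` and `m`, that outputs `[1]` ("non-random") with probability at least
3/4 on every formula of value at least `1 - η`, and that, for all but an `o(1)`-fraction of all
formulas, outputs `[0]` ("random") with probability at least 3/4. -/
def CSPEasy (K m : ℕ → ℕ) (η : ℕ → ℝ) : Prop :=
  ∃ (A : Prog) (T : Polynomial ℕ),
    (∀ (n : ℕ) (J : KFormula n (K n) (m n)),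
      HaltsWithin noExamples A (encodeFormula J) (T.eval (n + K n + m n))) ∧
    (∀ (n : ℕ) (J : KFormula n (K n) (m n)), 1 - η n ≤ val J →
      3 / 4 ≤ output noExamples A (encodeFormula J) (T.eval (n + K n + m n)) [1]) ∧
    Tendsto (fun n : ℕ =>
      (Set.ncard {J : KFormula n (K n) (m n) |
        3 / 4 ≤ output noExamples A (encodeFormula J) (T.eval (n + K n + m n)) [0]} : ℝ)
        / Nat.card (KFormula n (K n) (m n))) atTop (𝓝 1)

/-- The problem `CSP^{rand,1-η}_m(XOR_K)` is hard. -/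
def CSPHard (K m : ℕ → ℕ) (η : ℕ → ℝ) : Prop := ¬ CSPEasy K m η

/-- The random `K`-XOR assumption for constant `K`: there are constants `c > 0` and `0 < η < 1/2`
such that for every `K` and `m = n^{c log(K) √K}`, the problem is hard. -/
def XorAssumption : Prop :=
  ∃ c > (0 : ℝ), ∃ η > (0 : ℝ), η < 1 / 2 ∧ ∀ K : ℕ, 1 ≤ K →
    CSPHard (fun _ => K) (fun n => ⌊(n : ℝ) ^ (c * Real.logb 2 K * √(K : ℝ))⌋₊) (fun _ => η)

/-- `log^s(n)`, rounded up. -/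
def polylog (s n : ℕ) : ℕ := ⌈Real.logb 2 n ^ s⌉₊

/-- The random `K`-XOR assumption for polylogarithmic `K`: there are constants `c > 0` and
`0 < η < 1/2` such that for every `s`, `K = log^s(n)` and `m = n^{cK}`, the problem is hard. -/
def StrongXorAssumption : Prop :=
  ∃ c > (0 : ℝ), ∃ η > (0 : ℝ), η < 1 / 2 ∧ ∀ s : ℕ, 1 ≤ s →
    CSPHard (polylog s) (fun n => ⌊(n : ℝ) ^ (c * (polylog s n : ℝ))⌋₊) (fun _ => η)

/-! ### Learning halfspaces -/

/-- The Boolean cube `{±1}^n`. -/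
abbrev Cube (n : ℕ) : Type := Fin n → ℤˣ

/-- The halfspace classifier `h_w(x) = sign ⟨w, x⟩`, with `sign 0 = 1`. -/
def halfspace {n : ℕ} (w : Fin n → ℝ) (x : Cube n) : ℤˣ :=
  if 0 ≤ ∑ i, w i * ((x i : ℤ) : ℝ) then 1 else -1

/-- The error `Pr_{(x,y) ∼ D} (h(x) ≠ y)` of a classifier. -/
def err {n : ℕ} (D : PMF (Cube n × ℤˣ)) (h : Cube n → ℤˣ) : ℝ :=
  (D.toOuterMeasure {p | h p.1 ≠ p.2}).toReal

/-- The least error of a halfspace classifier. -/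
def errHalf {n : ℕ} (D : PMF (Cube n × ℤˣ)) : ℝ := ⨅ w : Fin n → ℝ, err D (halfspace w)

/-- The distribution `D` is `η`-almost realizable. -/
def AlmostRealizable {n : ℕ} (η : ℝ) (D : PMF (Cube n × ℤˣ)) : Prop := errHalf D ≤ η

/-- The oracle that produces examples from `D`: the `n` bits of `x`, then the bit of `y`. -/
def examples {n : ℕ} (D : PMF (Cube n × ℤˣ)) : PMF (List ℕ) :=
  D.map fun p => (List.ofFn fun i => bit (p.1 i)) ++ [bit p.2]

/-- The input for the evaluation at `x` of the classifier with description `z`. -/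
def encodeQuery {n : ℕ} (x : Cube n) (z : List ℕ) : List ℕ :=
  n :: ((List.ofFn fun i => bit (x i)) ++ z.length :: z)

/-- With the evaluation program `E`, the list `z` is a description of the classifier `h`, which is
evaluated within time `t` at every point. -/
def Describes {n : ℕ} (E : Prog) (t : ℕ) (z : List ℕ) (h : Cube n → ℤˣ) : Prop :=
  ∀ x : Cube n, ∀ c ∈ (run noExamples E (encodeQuery x z) t).support,
    c.todo = [] ∧ c.out = [bit (h x)]

/-- The distribution of the description that `L` returns in dimension `n`, with examples from
`D`. -/
def learned {n : ℕ} (L : Prog) (t : ℕ) (D : PMF (Cube n × ℤˣ)) : PMF (List ℕ) :=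
  output (examples D) L [n] t

/-- The learning algorithm `L`, whose hypotheses are evaluated by `E`, is efficient with time bound
`T`: it halts within time `T n`, and always returns a description of a classifier that can be
evaluated in time `T n`. -/
def EfficientLearner (L E : Prog) (T : Polynomial ℕ) : Prop :=
  ∀ (n : ℕ) (D : PMF (Cube n × ℤˣ)),
    HaltsWithin (examples D) L [n] (T.eval n) ∧
    ∀ z ∈ (learned L (T.eval n) D).support, ∃ h : Cube n → ℤˣ, Describes E (T.eval n) z h

/-- The learning algorithm has non-trivial performance on the `η`-almost-realizable distributions
on `{±1}^n × {±1}`: for some `c > 0`, with constant probability, its hypothesis has error at most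
`1/2 - 1/n^c` (for all large enough `n`). -/
def NontrivialPerformance (L E : Prog) (T : Polynomial ℕ) (η : ℕ → ℝ) : Prop :=
  ∃ c > (0 : ℝ), ∃ δ > (0 : ENNReal), ∀ᶠ n : ℕ in atTop, ∀ D : PMF (Cube n × ℤˣ),
    AlmostRealizable (η n) D →
      δ ≤ (learned L (T.eval n) D).toOuterMeasure
        {z | ∃ h : Cube n → ℤˣ, Describes E (T.eval n) z h ∧
          err D h ≤ 1 / 2 - 1 / (n : ℝ) ^ c}

/-- There is a `poly(n)`-time learning algorithm with non-trivial performance on the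
`η`-almost-realizable distributions on `{±1}^n × {±1}`. -/
def ExistsNontrivialLearner (η : ℕ → ℝ) : Prop :=
  ∃ (L E : Prog) (T : Polynomial ℕ), EfficientLearner L E T ∧ NontrivialPerformance L E T η

end HalfspaceHardness

end

noncomputable section

namespace HalfspaceHardness

open Filter Topology

/-! ### Program logic -/

/-- The distribution of the configuration after `t` steps from `c`. -/
def stepsFrom (O : PMF (List ℕ)) (c : Config) : ℕ → PMF Config
  | 0 => PMF.pure c
  | t + 1 => (stepsFrom O c t).bind (step O)

lemma run_eq_stepsFrom (O : PMF (List ℕ)) (P : Prog) (l : List ℕ) (t : ℕ) :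
    run O P l t = stepsFrom O (initial P l) t := by
  induction t with
  | zero => rfl
  | succ t ih => simp [run, stepsFrom, ih]

lemma stepsFrom_succ (O : PMF (List ℕ)) (c : Config) (t : ℕ) :
    stepsFrom O c (t + 1) = (step O c).bind fun c' => stepsFrom O c' t := by
  induction t with
  | zero => simp [stepsFrom]
  | succ t ih =>
    rw [stepsFrom, ih, PMF.bind_bind]
    rfl

lemma step_halted (O : PMF (List ℕ)) {c : Config} (h : c.todo = []) :
    step O c = PMF.pure c := by
  obtain ⟨k, s, o⟩ := c
  simp only at h
  subst h
  rfl

lemma stepsFrom_halted (O : PMF (List ℕ)) {c : Config} (h : c.todo = []) (t : ℕ) :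
    stepsFrom O c t = PMF.pure c := by
  induction t with
  | zero => rfl
  | succ t ih => simp [stepsFrom, ih, step_halted O h]

lemma pmf_bind_congr {α β : Type*} (p : PMF α) {f g : α → PMF β}
    (h : ∀ a ∈ p.support, f a = g a) : p.bind f = p.bind g := by
  ext b
  simp only [PMF.bind_apply]
  refine tsum_congr fun a => ?_
  by_cases ha : a ∈ p.support
  · rw [h a ha]
  · rw [PMF.mem_support_iff, not_not] at ha
    simp [ha]

lemma map_bind' {α β γ : Type*} (p : PMF α) (q : α → PMF β) (f : β → γ) :
    (p.bind q).map f = p.bind fun a => (q a).map f := PMF.map_bind p q f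

lemma bind_map' {α β γ : Type*} (p : PMF α) (f : α → β) (q : β → PMF γ) :
    (p.map f).bind q = p.bind fun a => q (f a) := PMF.bind_map p f q

/-- From the configuration `c`, the machine halts within `T` steps, and the law of its output is
`ν`. -/
def Final (c : Config) (T : ℕ) (ν : PMF (List ℕ)) : Prop :=
  ∀ t ≥ T, (∀ c' ∈ (stepsFrom noExamples c t).support, c'.todo = []) ∧
    (stepsFrom noExamples c t).map Config.out = ν

lemma Final.mono {c : Config} {T T' : ℕ} {ν : PMF (List ℕ)} (h : Final c T ν) (hT : T ≤ T') :
    Final c T' ν := fun t ht => h t (hT.trans ht)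

lemma final_halted (s : Memory) (o : List ℕ) : Final ⟨[], s, o⟩ 0 (PMF.pure o) := by
  intro t _
  rw [stepsFrom_halted noExamples rfl]
  simp [PMF.pure_map]

lemma final_step {A : Type} {c : Config} {ρ : PMF A} {g : A → Config}
    (hstep : step noExamples c = ρ.map g) {T : ℕ} {ν : A → PMF (List ℕ)}
    (h : ∀ a ∈ ρ.support, Final (g a) T (ν a)) : Final c (T + 1) (ρ.bind ν) := by
  intro t ht
  obtain ⟨t, rfl⟩ : ∃ t', t = t' + 1 := ⟨t - 1, by omega⟩
  rw [stepsFrom_succ, hstep, bind_map', map_bind']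
  constructor
  · intro c' hc'
    rw [PMF.mem_support_bind_iff] at hc'
    obtain ⟨a, ha, hc'⟩ := hc'
    exact (h a ha t (by omega)).1 c' hc'
  · exact pmf_bind_congr _ fun a ha => (h a ha t (by omega)).2

lemma final_step_pure {c c' : Config} (hstep : step noExamples c = PMF.pure c') {T : ℕ}
    {ν : PMF (List ℕ)} (h : Final c' T ν) : Final c (T + 1) ν := by
  have := final_step (c := c) (ρ := PMF.pure ()) (g := fun _ => c') (T := T) (ν := fun _ => ν)
    (by rw [hstep, PMF.pure_map]) (fun _ _ => h)
  simpa using this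

/-- Specification of a program that does not write to the output: started in memory `s`, it
halts within `t` steps, in a memory related by `R` to a random element with law `ρ`. -/
def Sim (P : Prog) (s : Memory) (t : ℕ) {A : Type} (ρ : PMF A) (R : A → Memory → Prop) : Prop :=
  ∀ (k : List Prog) (o : List ℕ) (T : ℕ) (ν : A → PMF (List ℕ)),
    (∀ a ∈ ρ.support, ∀ s', R a s' → Final ⟨k, s', o⟩ T (ν a)) →
      Final ⟨P :: k, s, o⟩ (t + T) (ρ.bind ν)

/-- Specification of a deterministic program. -/
def Det (P : Prog) (s : Memory) (t : ℕ) (R : Memory → Prop) : Prop :=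
  Sim P s t (PMF.pure ()) fun _ => R

section Rules

variable {P Q : Prog} {s : Memory} {t t₁ t₂ : ℕ} {A B : Type} {ρ : PMF A}
  {R : A → Memory → Prop} {R' : B → Memory → Prop} {κ : A → PMF B} {I J : Memory → Prop}

lemma Sim.mono (h : Sim P s t₁ ρ R) (ht : t₁ ≤ t₂) : Sim P s t₂ ρ R :=
  fun k o T ν hν => (h k o T ν hν).mono (by omega)

lemma Sim.conseq {R₂ : A → Memory → Prop} (h : Sim P s t ρ R)
    (hR : ∀ a ∈ ρ.support, ∀ s', R a s' → R₂ a s') : Sim P s t ρ R₂ :=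
  fun k o T ν hν => h k o T ν fun a ha s' hs' => hν a ha s' (hR a ha s' hs')

lemma Sim.map {f : A → B} (h : Sim P s t ρ R)
    (hR : ∀ a ∈ ρ.support, ∀ s', R a s' → R' (f a) s') : Sim P s t (ρ.map f) R' := by
  intro k o T ν hν
  rw [bind_map']
  refine h k o T _ fun a ha s' hs' => hν (f a) ?_ s' (hR a ha s' hs')
  rw [PMF.mem_support_map_iff]
  exact ⟨a, ha, rfl⟩

lemma Sim.seq (h₁ : Sim P s t₁ ρ R)
    (h₂ : ∀ a ∈ ρ.support, ∀ s', R a s' → Sim Q s' t₂ (κ a) R') :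
    Sim (.seq P Q) s (t₁ + t₂ + 1) (ρ.bind κ) R' := by
  intro k o T ν hν
  have := h₁ (Q :: k) o (t₂ + T) (fun a => (κ a).bind ν) fun a ha s' hs' =>
    h₂ a ha s' hs' k o T ν fun b hb s'' hs'' => hν b
      ((PMF.mem_support_bind_iff _ _ _).2 ⟨a, ha, hb⟩) s'' hs''
  rw [PMF.bind_bind]
  refine (final_step_pure (c' := ⟨P :: Q :: k, s, o⟩) rfl this).mono (by omega)

lemma Det.seq_sim (h₁ : Det P s t₁ I) (h₂ : ∀ s', I s' → Sim Q s' t₂ ρ R) :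
    Sim (.seq P Q) s (t₁ + t₂ + 1) ρ R := by
  have := Sim.seq (κ := fun _ => ρ) h₁ (fun _ _ s' hs' => h₂ s' hs')
  simpa using this

lemma Sim.seq_det (h₁ : Sim P s t₁ ρ R) {R₂ : A → Memory → Prop}
    (h₂ : ∀ a ∈ ρ.support, ∀ s', R a s' → Det Q s' t₂ (R₂ a)) :
    Sim (.seq P Q) s (t₁ + t₂ + 1) ρ R₂ := by
  have := Sim.seq (κ := fun a => PMF.pure a) (R' := R₂) (Q := Q) (t₂ := t₂) h₁
    (fun a ha s' hs' => ?_)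
  · simpa using this
  · have := (h₂ a ha s' hs').map (f := fun _ => a) (R' := R₂) (fun _ _ _ h => h)
    simpa [PMF.pure_map] using this

lemma Det.conseq (h : Det P s t I) (hI : ∀ s', I s' → J s') : Det P s t J :=
  Sim.conseq h fun _ _ => hI

lemma Det.seq (h₁ : Det P s t₁ I) (h₂ : ∀ s', I s' → Det Q s' t₂ J) :
    Det (.seq P Q) s (t₁ + t₂ + 1) J := Det.seq_sim h₁ h₂

lemma Det.skip (h : I s) : Det .skip s 1 I := by
  intro k o T ν hν
  simp only [PMF.pure_bind]
  exact (final_step_pure (c' := ⟨k, s, o⟩) rfl (hν () (by simp) s h)).mono (by omega)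

lemma Det.set {a : ℕ} {i e : Expr} (h : I (s.store a (i.eval s) (e.eval s))) :
    Det (.set a i e) s 1 I := by
  intro k o T ν hν
  simp only [PMF.pure_bind]
  exact (final_step_pure (c' := ⟨k, _, o⟩) rfl (hν () (by simp) _ h)).mono (by omega)

lemma Sim.set_seq {a : ℕ} {i e : Expr}
    (h : Sim Q (s.store a (i.eval s) (e.eval s)) t ρ R) :
    Sim (.seq (.set a i e) Q) s (t + 2) ρ R :=
  (Det.seq_sim (I := fun s' => s' = s.store a (i.eval s) (e.eval s)) (Det.set rfl)
    (fun s' hs' => hs' ▸ h)).mono (by omega)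

/-- A fair coin. -/
def coin : PMF Bool := PMF.uniformOfFintype Bool

lemma Sim.flip {a : ℕ} {i : Expr} {R : Bool → Memory → Prop}
    (h : ∀ b, R b (s.store a (i.eval s) b.toNat)) : Sim (.flip a i) s 1 coin R := by
  intro k o T ν hν
  exact (final_step (ρ := coin) (g := fun b => ⟨k, s.store a (i.eval s) b.toNat, o⟩) rfl
    (fun b hb => hν b hb _ (h b))).mono (by omega)

lemma Sim.ite {e : Expr} (h₁ : e.eval s ≠ 0 → Sim P s t ρ R) (h₂ : e.eval s = 0 → Sim Q s t ρ R) :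
    Sim (.ite e P Q) s (t + 1) ρ R := by
  intro k o T ν hν
  by_cases he : e.eval s = 0
  · exact (final_step_pure (c' := ⟨Q :: k, s, o⟩) (by simp [step, he]) (h₂ he k o T ν hν)).mono
      (by omega)
  · exact (final_step_pure (c' := ⟨P :: k, s, o⟩) (by simp [step, he]) (h₁ he k o T ν hν)).mono
      (by omega)

lemma Sim.loop_exit {e : Expr} {a : A} (he : e.eval s = 0) (h : R a s) :
    Sim (.loop e P) s 1 (PMF.pure a) R := by
  intro k o T ν hν
  simp only [PMF.pure_bind]
  exact (final_step_pure (c' := ⟨k, s, o⟩) (by simp [step, he]) (hν a (by simp) _ h)).mono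
      (by omega)

lemma Sim.loop_enter {e : Expr} {P : Prog} (he : e.eval s ≠ 0)
    (h₁ : Sim P s t₁ ρ R)
    (h₂ : ∀ a ∈ ρ.support, ∀ s', R a s' → Sim (.loop e P) s' t₂ (κ a) R') :
    Sim (.loop e P) s (t₁ + t₂ + 1) (ρ.bind κ) R' := by
  intro k o T ν hν
  have := h₁ (.loop e P :: k) o (t₂ + T) (fun a => (κ a).bind ν) fun a ha s' hs' =>
    h₂ a ha s' hs' k o T ν fun b hb s'' hs'' => hν b
      ((PMF.mem_support_bind_iff _ _ _).2 ⟨a, ha, hb⟩) s'' hs''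
  rw [PMF.bind_bind]
  refine (final_step_pure (c' := ⟨P :: .loop e P :: k, s, o⟩) (by simp [step, he]) this).mono
    (by omega)

end Rules

/-- Iterating a Markov kernel. -/
def iter {A : Type} (κ : A → PMF A) : ℕ → A → PMF A
  | 0, a => PMF.pure a
  | n + 1, a => (iter κ n a).bind κ

lemma iter_succ' {A : Type} (κ : A → PMF A) (n : ℕ) (a : A) :
    iter κ (n + 1) a = (κ a).bind (iter κ n) := by
  induction n generalizing a with
  | zero => simp [iter]
  | succ n ih =>
    rw [iter, ih, PMF.bind_bind]
    rfl

/-- The variable stored in cell 0 of array `x`. -/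
abbrev V (x : ℕ) : Expr := .get x (.const 0)

/-- Assignment to a variable. -/
abbrev asg (x : ℕ) (e : Expr) : Prog := .set x (.const 0) e

/-- `for x = 0, …, e - 1 do P`. -/
def forTo (x : ℕ) (e : Expr) (P : Prog) : Prog :=
  .seq (asg x (.const 0)) (.loop (.sub e (V x)) (.seq P (asg x (.add (V x) (.const 1)))))

lemma Sim.forTo {x : ℕ} {e : Expr} {P : Prog} {s : Memory} {t n N : ℕ} {A : Type}
    {κ : A → PMF A} (R : ℕ → A → Memory → Prop) {a : A} (hN : n ≤ N)
    (h0 : R 0 a (s.store x 0 0))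
    (hR : ∀ i ≤ n, ∀ a s, R i a s → s x 0 = i ∧ e.eval s = n)
    (hP : ∀ i < n, ∀ a s, R i a s → Sim P s t (κ a)
      fun a' s' => s' x 0 = i ∧ R (i + 1) a' (s'.store x 0 (i + 1))) :
    Sim (forTo x e P) s (N * (t + 3) + 3) (iter κ n a) (R n) := by
  have key : ∀ r i, i + r = n → ∀ a s, R i a s →
      Sim (.loop (.sub e (V x)) (.seq P (asg x (.add (V x) (.const 1))))) s (r * (t + 3) + 1)
        (iter κ r a) (R n) := by
    intro r
    induction r with
    | zero =>
      intro i hi a s h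
      obtain rfl : i = n := by omega
      obtain ⟨h1, h2⟩ := hR i (by omega) a s h
      exact (Sim.loop_exit (by simp [Expr.eval, h1, h2]) h).mono (by omega)
    | succ r ih =>
      intro i hi a s h
      obtain ⟨h1, h2⟩ := hR i (by omega) a s h
      rw [iter_succ']
      refine (Sim.loop_enter (by simp [Expr.eval, h1, h2]; omega)
        (Sim.seq_det (hP i (by omega) a s h) (t₂ := 1) (R₂ := R (i + 1)) ?_)
        (fun a' _ s' hs' => ih (i + 1) (by omega) a' s' hs')).mono ?_
      · rintro a' - s' ⟨h3, h4⟩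
        refine Det.set ?_
        simpa [Expr.eval, h3] using h4
      · ring_nf; omega
  refine (Sim.set_seq (key n 0 (by omega) a _ (by simpa [Expr.eval] using h0))).mono ?_
  have := Nat.mul_le_mul_right (t + 3) hN
  omega

lemma iter_pure_unit (n : ℕ) : iter (fun _ : Unit => PMF.pure ()) n () = PMF.pure () := by
  induction n with
  | zero => rfl
  | succ n ih => simp [iter, ih]

lemma Det.forTo {x : ℕ} {e : Expr} {P : Prog} {s : Memory} {t n N : ℕ}
    (R : ℕ → Memory → Prop) (hN : n ≤ N)
    (h0 : R 0 (s.store x 0 0))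
    (hR : ∀ i ≤ n, ∀ s, R i s → s x 0 = i ∧ e.eval s = n)
    (hP : ∀ i < n, ∀ s, R i s → Det P s t
      fun s' => s' x 0 = i ∧ R (i + 1) (s'.store x 0 (i + 1))) :
    Det (forTo x e P) s (N * (t + 3) + 3) (R n) := by
  have := Sim.forTo (x := x) (e := e) (P := P) (κ := fun _ : Unit => PMF.pure ()) (a := ())
    (fun i _ s => R i s) hN h0 (fun i hi _ s h => hR i hi s h) (fun i hi _ s h => hP i hi s h)
  rwa [iter_pure_unit] at this

@[simp] lemma store_same (s : Memory) (a i v : ℕ) :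
    s.store a i v a = Function.update (s a) i v := by simp [Memory.store]

@[simp] lemma store_ne (s : Memory) {a b : ℕ} (i v : ℕ) (h : b ≠ a) : s.store a i v b = s b := by
  simp [Memory.store, h]

/-! ### Running a program inside another one

The arrays of the inner program are shifted by 50, and all indices are shifted by the content of
register 48, so that a new base gives the inner program a fresh memory. Register 49 bounds the
indices in use. The output is collected in a buffer. -/

/-- Translation of expressions. -/
def Expr.tr : Expr → Expr
  | const k => const k
  | get a i => get (a + 50) (.add (V 48) i.tr)
  | add e₁ e₂ => add e₁.tr e₂.tr
  | sub e₁ e₂ => sub e₁.tr e₂.tr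

/-- Translation of programs; `S` replaces the sampling instruction, the output goes to array `u`,
and its length to register `v`. -/
def Prog.tr (S : ℕ → Prog) (u v : ℕ) : Prog → Prog
  | skip => skip
  | set a i e => seq (asg 49 (.add (V 49) (.add i.tr (.const 1))))
      (set (a + 50) (.add (V 48) i.tr) e.tr)
  | flip a i => seq (asg 49 (.add (V 49) (.add i.tr (.const 1))))
      (flip (a + 50) (.add (V 48) i.tr))
  | sample a => S a
  | emit e => seq (set u (V v) e.tr) (asg v (.add (V v) (.const 1)))
  | seq P Q => seq (P.tr S u v) (Q.tr S u v)
  | ite e P Q => ite e.tr (P.tr S u v) (Q.tr S u v)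
  | loop e P => loop e.tr (P.tr S u v)

/-- The memory `s` represents the memory `mem` and the output `out` of an inner program, and agrees
with `s₀` on `F`. -/
structure Represents (u v : ℕ) (F : Set ℕ) (s₀ : Memory) (mem : Memory) (out : List ℕ)
    (s : Memory) : Prop where
  mem_eq : ∀ a i, s (a + 50) (s₀ 48 0 + i) = mem a i
  zero : ∀ a i, s 49 0 ≤ i → mem a i = 0
  base : s 48 0 = s₀ 48 0
  out_eq : ∀ i < out.length, s u i = out.getD i 0
  len : s v 0 = out.length
  frame : ∀ b ∈ F, s b = s₀ b

section Translation

variable {S : ℕ → Prog} {u v : ℕ} {F : Set ℕ} {s₀ : Memory} {O : PMF (List ℕ)} {τ : ℕ}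

lemma Represents.eval {mem s : Memory} {out : List ℕ} (h : Represents u v F s₀ mem out s)
    (e : Expr) : e.tr.eval s = e.eval mem := by
  induction e with
  | const k => rfl
  | get a i ih => simp [Expr.tr, Expr.eval, ih, h.base, h.mem_eq]
  | add e₁ e₂ h₁ h₂ => simp [Expr.tr, Expr.eval, h₁, h₂]
  | sub e₁ e₂ h₁ h₂ => simp [Expr.tr, Expr.eval, h₁, h₂]

lemma Represents.top {mem s : Memory} {out : List ℕ} (h : Represents u v F s₀ mem out s)
    (hu : u < 48) (hv : v < 48) (hF : ∀ b ∈ F, b < 48) {x : ℕ} (hx : s 49 0 ≤ x) :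
    Represents u v F s₀ mem out (s.store 49 0 x) where
  mem_eq a i := by rw [store_ne _ _ _ (by omega), h.mem_eq]
  zero a i hi := h.zero a i (hx.trans (by simpa using hi))
  base := by rw [store_ne _ _ _ (by omega), h.base]
  out_eq := by rw [store_ne _ _ _ (by omega)]; exact h.out_eq
  len := by rw [store_ne _ _ _ (by omega), h.len]
  frame b hb := by rw [store_ne _ _ _ (by have := hF b hb; omega), h.frame b hb]

lemma Represents.store {mem s : Memory} {out : List ℕ} (h : Represents u v F s₀ mem out s)
    (hu : u < 48) (hv : v < 48) (hF : ∀ b ∈ F, b < 48) {a i x : ℕ} (hi : i < s 49 0) :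
    Represents u v F s₀ (mem.store a i x) out (s.store (a + 50) (s₀ 48 0 + i) x) where
  mem_eq b j := by
    by_cases hab : b = a
    · subst hab
      by_cases hij : j = i <;> simp [hij, h.mem_eq]
    · rw [store_ne _ _ _ (by omega), store_ne _ _ _ hab, h.mem_eq]
  zero b j hj := by
    rw [store_ne _ _ _ (by omega)] at hj
    by_cases hab : b = a
    · subst hab
      rw [store_same, Function.update_apply, if_neg (by omega), h.zero _ _ hj]
    · rw [store_ne _ _ _ hab, h.zero _ _ hj]
  base := by rw [store_ne _ _ _ (by omega), h.base]
  out_eq := by rw [store_ne _ _ _ (by omega)]; exact h.out_eq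
  len := by rw [store_ne _ _ _ (by omega), h.len]
  frame b hb := by rw [store_ne _ _ _ (by have := hF b hb; omega), h.frame b hb]

/-- The program `S a` stores a sample from `O` in array `a` of the inner program. -/
def Samples (S : ℕ → Prog) (u v : ℕ) (F : Set ℕ) (s₀ : Memory) (O : PMF (List ℕ)) (τ : ℕ) : Prop :=
  ∀ a s, (∀ b ∈ F, s b = s₀ b) → s 48 0 = s₀ 48 0 → Sim (S a) s τ O fun l s' =>
    (∀ i, s' (a + 50) (s₀ 48 0 + i) = l.getD i (s (a + 50) (s₀ 48 0 + i))) ∧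
    (∀ b, 50 ≤ b → b ≠ a + 50 → s' b = s b) ∧ s' 48 0 = s₀ 48 0 ∧
    s 49 0 ≤ s' 49 0 ∧ l.length ≤ s' 49 0 ∧ s' u = s u ∧ s' v = s v ∧ ∀ b ∈ F, s' b = s b

lemma final_tr_step (hS : Samples S u v F s₀ O τ) (hu : u < 48) (hv : v < 48) (huv : u ≠ v)
    (hF : ∀ b ∈ F, b < 48 ∧ b ≠ u ∧ b ≠ v) (P : Prog) (ks : List Prog) (mem : Memory)
    (out : List ℕ) (s : Memory) (hs : Represents u v F s₀ mem out s) (k : List Prog) (o : List ℕ)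
    (T : ℕ) (ν : Config → PMF (List ℕ))
    (h : ∀ c' ∈ (step O ⟨P :: ks, mem, out⟩).support, ∀ s',
      Represents u v F s₀ c'.mem c'.out s' →
        Final ⟨c'.todo.map (Prog.tr S u v) ++ k, s', o⟩ T (ν c')) :
    Final ⟨(P :: ks).map (Prog.tr S u v) ++ k, s, o⟩ (τ + 4 + T)
      ((step O ⟨P :: ks, mem, out⟩).bind ν) := by
  have hF' : ∀ b ∈ F, b < 48 := fun b hb => (hF b hb).1
  simp only [List.map_cons, List.cons_append]
  set k' := List.map (Prog.tr S u v) ks ++ k with hk'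
  cases P with
  | skip =>
    simp only [step, PMF.pure_bind, Prog.tr, PMF.mem_support_pure_iff, forall_eq] at h ⊢
    exact (final_step_pure (c' := ⟨k', s, o⟩) rfl (h s hs)).mono (by omega)
  | set a i e =>
    simp only [step, PMF.pure_bind, Prog.tr, PMF.mem_support_pure_iff, forall_eq] at h ⊢
    have := (Sim.set_seq (a := 49) (i := .const 0) (e := .add (V 49) (.add i.tr (.const 1)))
      (s := s) (Det.set (a := a + 50) (i := .add (V 48) i.tr) (e := e.tr)
        (I := Represents u v F s₀ (mem.store a (i.eval mem) (e.eval mem)) out) ?_))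
    · have := this k' o T (fun _ => ν ⟨ks, mem.store a (i.eval mem) (e.eval mem), out⟩)
        fun _ _ s' hs' => h s' hs'
      rw [PMF.pure_bind] at this
      exact this.mono (by omega)
    · have h1 := hs.top hu hv hF' (x := s 49 0 + (i.eval mem + 1)) (by omega)
      have h2 := h1.store hu hv hF' (a := a) (i := i.eval mem) (x := e.eval mem) (by simp; omega)
      simp only [Expr.eval, hs.eval]
      rw [h1.eval, h1.eval, h1.base]
      exact h2
  | flip a i =>
    have hst : step O ⟨.flip a i :: ks, mem, out⟩ =
      coin.map fun b => ⟨ks, mem.store a (i.eval mem) b.toNat, out⟩ := rfl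
    rw [hst] at h ⊢
    rw [bind_map']
    have := (Sim.set_seq (a := 49) (i := .const 0) (e := .add (V 49) (.add i.tr (.const 1)))
      (s := s) (Sim.flip (a := a + 50) (i := .add (V 48) i.tr)
        (R := fun b => Represents u v F s₀ (mem.store a (i.eval mem) b.toNat) out) ?_))
    · have := this k' o T (fun b => ν ⟨ks, mem.store a (i.eval mem) b.toNat, out⟩)
        fun b hb s' hs' => h _ (by rw [PMF.mem_support_map_iff]; exact ⟨b, hb, rfl⟩) s' hs'
      exact this.mono (by omega)
    · intro b
      have h1 := hs.top hu hv hF' (x := s 49 0 + (i.eval mem + 1)) (by omega)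
      have h2 := h1.store hu hv hF' (a := a) (i := i.eval mem) (x := b.toNat) (by simp; omega)
      simp only [Expr.eval, hs.eval]
      rw [h1.eval, h1.base]
      exact h2
  | sample a =>
    have hst : step O ⟨.sample a :: ks, mem, out⟩ =
      O.map fun l => ⟨ks, Function.update mem a fun i => l.getD i (mem a i), out⟩ := rfl
    rw [hst] at h ⊢
    rw [bind_map']
    refine (hS a s hs.frame hs.base k' o T _ fun l hl s' hs' => ?_).mono (by omega)
    refine h _ (by rw [PMF.mem_support_map_iff]; exact ⟨l, hl, rfl⟩) s' ?_
    obtain ⟨h1, h2, h3, h4, h5, h6, h7, h8⟩ := hs'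
    refine ⟨fun b i => ?_, fun b i hi => ?_, h3, ?_, ?_, fun b hb => by rw [h8 b hb, hs.frame b hb]⟩
    · by_cases hab : b = a
      · subst hab
        simp [h1, hs.mem_eq]
      · rw [h2 _ (by omega) (by omega), hs.mem_eq]
        simp [hab]
    · by_cases hab : b = a
      · subst hab
        simp only [Function.update_self]
        rw [List.getD_eq_default _ _ (by omega), hs.zero _ _ (by omega)]
      · simp [hab, hs.zero b i (by omega)]
    · rw [h6]; exact hs.out_eq
    · rw [h7]; exact hs.len
  | emit e =>
    simp only [step, PMF.pure_bind, Prog.tr, PMF.mem_support_pure_iff, forall_eq] at h ⊢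
    have := (Sim.set_seq (a := u) (i := V v) (e := e.tr)
      (s := s) (Det.set (a := v) (i := .const 0) (e := .add (V v) (.const 1))
        (I := Represents u v F s₀ mem (out ++ [e.eval mem])) ?_))
    · have := this k' o T (fun _ => ν ⟨ks, mem, out ++ [e.eval mem]⟩)
        fun _ _ s' hs' => h s' hs'
      rw [PMF.pure_bind] at this
      exact this.mono (by omega)
    · simp only [Expr.eval, hs.eval, hs.len]
      refine ⟨fun b i => ?_, fun b i hi => ?_, ?_, fun i hi => ?_, ?_, fun b hb => ?_⟩
      · rw [store_ne _ _ _ (by omega), store_ne _ _ _ (by omega), hs.mem_eq]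
      · rw [store_ne _ _ _ (by omega), store_ne _ _ _ (by omega)] at hi
        exact hs.zero b i hi
      · rw [store_ne _ _ _ (by omega), store_ne _ _ _ (by omega), hs.base]
      · rw [store_ne _ _ _ huv, store_same, Function.update_apply]
        by_cases hi' : i = out.length
        · subst hi'
          simp
        · simp only [List.length_append, List.length_singleton] at hi
          rw [if_neg hi', hs.out_eq i (by omega), List.getD_append _ _ _ _ (by omega)]
      · rw [store_ne s _ _ huv.symm]; simp [hs.len]
      · have := hF b hb
        rw [store_ne _ _ _ this.2.2, store_ne _ _ _ this.2.1, hs.frame b hb]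
  | seq P Q =>
    simp only [step, PMF.pure_bind, Prog.tr, PMF.mem_support_pure_iff, forall_eq] at h ⊢
    exact (final_step_pure (c' := ⟨P.tr S u v :: Q.tr S u v :: k', s, o⟩) rfl
      (by simpa using h s hs)).mono (by omega)
  | ite e P Q =>
    simp only [step, PMF.pure_bind, Prog.tr, PMF.mem_support_pure_iff, forall_eq] at h ⊢
    refine (final_step_pure (c' := ⟨(if e.eval mem ≠ 0 then P else Q).tr S u v :: k', s, o⟩) ?_
      (h s hs)).mono (by omega)
    simp only [step, hs.eval]
    split_ifs <;> rfl
  | loop e P =>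
    simp only [step, PMF.pure_bind, Prog.tr, PMF.mem_support_pure_iff, forall_eq] at h ⊢
    refine (final_step_pure (c' := ⟨(if e.eval mem ≠ 0 then P :: .loop e P :: ks else ks).map
      (Prog.tr S u v) ++ k, s, o⟩) ?_ (h s hs)).mono (by omega)
    simp only [step, hs.eval]
    split_ifs <;> rfl

lemma final_tr (hS : Samples S u v F s₀ O τ) (hu : u < 48) (hv : v < 48) (huv : u ≠ v)
    (hF : ∀ b ∈ F, b < 48 ∧ b ≠ u ∧ b ≠ v) (k : List Prog) (o : List ℕ)
    (T : ℕ) (ν : List ℕ → PMF (List ℕ)) (t : ℕ) (c : Config) (s : Memory)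
    (hs : Represents u v F s₀ c.mem c.out s)
    (hc : ∀ c' ∈ (stepsFrom O c t).support, c'.todo = [])
    (h : ∀ c' ∈ (stepsFrom O c t).support, ∀ s',
      Represents u v F s₀ c'.mem c'.out s' → Final ⟨k, s', o⟩ T (ν c'.out)) :
    Final ⟨c.todo.map (Prog.tr S u v) ++ k, s, o⟩ (t * (τ + 4) + T)
      (((stepsFrom O c t).map Config.out).bind ν) := by
  rw [bind_map']
  induction t generalizing c s with
  | zero =>
    simp only [stepsFrom, PMF.mem_support_pure_iff, forall_eq, PMF.pure_bind] at hc h ⊢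
    rw [hc]
    simpa using h s hs
  | succ t ih =>
    obtain ⟨todo, mem, out⟩ := c
    cases todo with
    | nil =>
      rw [stepsFrom_halted O rfl] at h ⊢
      simp only [PMF.mem_support_pure_iff, forall_eq, PMF.pure_bind] at h ⊢
      exact (h s hs).mono (by omega)
    | cons P ks =>
      rw [stepsFrom_succ] at h hc ⊢
      rw [PMF.bind_bind]
      refine (final_tr_step hS hu hv huv hF P ks mem out s hs k o (t * (τ + 4) + T) _
        fun c' hc' s' hs' => ih c' s' hs' (fun c'' hc'' => hc c'' ?_)
          fun c'' hc'' => h c'' ?_).mono (by ring_nf; omega)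
      all_goals exact (PMF.mem_support_bind_iff _ _ _).2 ⟨c', hc', hc''⟩

/-- The translated program simulates the run of the inner program. -/
lemma Sim.tr (hS : Samples S u v F s₀ O τ) (hu : u < 48) (hv : v < 48) (huv : u ≠ v)
    (hF : ∀ b ∈ F, b < 48 ∧ b ≠ u ∧ b ≠ v) {P : Prog} {l : List ℕ} {t : ℕ}
    (h : HaltsWithin O P l t) {s : Memory}
    (hs : Represents u v F s₀ (Function.update 0 0 (arrayOf l)) [] s) :
    Sim (P.tr S u v) s (t * (τ + 4)) (output O P l t) fun z s' =>
      ∃ mem, Represents u v F s₀ mem z s' := by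
  intro k o T ν hν
  have h' := h
  simp only [HaltsWithin, output, run_eq_stepsFrom] at h hν ⊢
  refine final_tr hS hu hv huv hF k o T ν t _ s hs h fun c hc s' hs' =>
    hν _ ?_ s' ⟨_, hs'⟩
  rw [PMF.mem_support_map_iff]
  exact ⟨c, hc, rfl⟩

end Translation

/-! ### The sampling program -/

lemma getD_flatten_ofFn {α : Type} {m c : ℕ} (f : Fin m → List α) (hf : ∀ j, (f j).length = c)
    (x : α) (j : Fin m) {r : ℕ} (hr : r < c) :
    ((List.ofFn f).flatten).getD (j * c + r) x = (f j).getD r x := by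
  induction m with
  | zero => exact j.elim0
  | succ m ih =>
    rw [List.ofFn_succ, List.flatten_cons]
    refine Fin.cases ?_ (fun j => ?_) j
    · rw [List.getD_append _ _ _ _ (by rw [hf]; simpa using hr)]
      simp
    · rw [List.getD_append_right _ _ _ _ (by rw [hf, Fin.val_succ]; nlinarith), hf, Fin.val_succ]
      rw [← ih (fun j => f j.succ) (fun j => hf j.succ) j]
      congr 1
      rw [Nat.succ_mul]
      omega

section Encoding

variable {n K m : ℕ} (J : KFormula n K m)

lemma encode_zero : arrayOf (encodeFormula J) 0 = n := rfl
lemma encode_one : arrayOf (encodeFormula J) 1 = K := rfl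
lemma encode_two : arrayOf (encodeFormula J) 2 = m := rfl

lemma encode_lit (j : Fin m) (i : Fin K) {r : ℕ} (hr : r < 2) :
    arrayOf (encodeFormula J) (3 + j * (K + K) + (i + i) + r) =
      [((J j).1 i : ℕ), bit ((J j).2 i)].getD r 0 := by
  have h : 3 + (j : ℕ) * (K + K) + (i + i) + r = (j * (K + K) + (i * 2 + r)) + 1 + 1 + 1 := by ring
  rw [h]
  simp only [arrayOf, encodeFormula, List.getD_cons_succ]
  rw [getD_flatten_ofFn (c := K + K) _ _ _ j (by omega), getD_flatten_ofFn (c := 2) _ _ _ i hr]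
  · simp
  · intro j
    simp [List.length_flatten, List.map_ofFn, Function.comp_def]
    omega

lemma encode_var (j : Fin m) (i : Fin K) :
    arrayOf (encodeFormula J) (3 + j * (K + K) + (i + i)) = (J j).1 i :=
  encode_lit J j i (r := 0) (by omega)

lemma encode_sign (j : Fin m) (i : Fin K) :
    arrayOf (encodeFormula J) (3 + j * (K + K) + (i + i) + 1) = bit ((J j).2 i) :=
  encode_lit J j i (r := 1) (by omega)

end Encoding

/-- Multiplying the sign of the first literal by `u`. -/
def KTuple.flip {n K : ℕ} (C : KTuple n K) (u : ℤˣ) : KTuple n K :=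
  (C.1, fun i => if (i : ℕ) = 0 then u * C.2 i else C.2 i)

/-- The indicator of the literals that occur in `C`. -/
def litBit {n K : ℕ} (C : KTuple n K) (p : ℕ) : ℕ :=
  if ∃ i, p = C.1 i + C.1 i + bit (C.2 i) then 1 else 0

/-- The indicator vector of the literals that occur in `C`. -/
def litVec {n K : ℕ} (C : KTuple n K) : List ℕ := (List.range (n + n)).map (litBit C)

/-- The product of signs, in terms of bits. -/
def xnor (a b : ℕ) : ℕ := 1 - ((a - b) + (b - a))

/-- The `d`-th tensor power of the vector `1 :: S`, in terms of bits. -/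
def tens (S : List ℕ) : ℕ → List ℕ
  | 0 => [1]
  | d + 1 => tens S d ++ S.flatMap fun b => (tens S d).map fun a => xnor a b

lemma length_tens (S : List ℕ) (d : ℕ) : (tens S d).length = (S.length + 1) ^ d := by
  induction d with
  | zero => rfl
  | succ d ih =>
    simp only [tens, List.length_append, List.length_flatMap, List.length_map, ih]
    simp
    ring

/-- The sign that a coin stands for. -/
def sgn (b : Bool) : ℤˣ := if b then 1 else -1

lemma bit_sgn (b : Bool) : bit (sgn b) = b.toNat := by cases b <;> simp [bit, sgn]

/-- Independent samples. -/
def iid {α : Type} (p : PMF α) (k : ℕ) : PMF (List α) :=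
  iter (fun l => p.map fun a => l ++ [a]) k []

/-- The law of the index computed from `m` coins. -/
def idxLaw (m : ℕ) [NeZero m] : PMF (Fin m) :=
  iter (fun r => coin.map fun c => Fin.ofNat m (r + r + c.toNat)) m 0

/-- The part of an example that comes from one constraint. -/
def block {n K : ℕ} (d : ℕ) (u : ℤˣ) (C : KTuple n K) : List ℕ := tens (litVec (C.flip u)) d

lemma length_block {n K : ℕ} (d : ℕ) (u : ℤˣ) (C : KTuple n K) :
    (block d u C).length = (n + n + 1) ^ d := by
  simp [block, length_tens, litVec]

/-- The law of the examples. -/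
def exampleLaw {n K m : ℕ} [NeZero m] (J : KFormula n K m) (d q : ℕ) : PMF (List ℕ) :=
  coin.bind fun y => (iid (idxLaw m) q).map fun l =>
    l.flatMap (fun j => block d (sgn y) (J j)) ++ [y.toNat]

/-- Replacing the entries of `f` from `w` on by the list `L`. -/
def overwrite (f : ℕ → ℕ) (w : ℕ) (L : List ℕ) : ℕ → ℕ :=
  fun i => if i < w then f i else L.getD (i - w) (f i)

lemma overwrite_nil (f : ℕ → ℕ) (w : ℕ) : overwrite f w [] = f := by
  ext i; simp [overwrite]

lemma overwrite_append (f : ℕ → ℕ) (w : ℕ) (L L' : List ℕ) :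
    overwrite (overwrite f w L) (w + L.length) L' = overwrite f w (L ++ L') := by
  ext i
  simp only [overwrite]
  by_cases h1 : i < w
  · simp [h1, show i < w + L.length by omega]
  · by_cases h2 : i < w + L.length
    · rw [if_pos h2, if_neg h1, if_neg h1, List.getD_append _ _ _ _ (by omega)]
    · rw [if_neg h2, if_neg h1, if_neg h1, List.getD_append_right _ _ _ _ (by omega),
        List.getD_eq_default L _ (by omega)]
      congr 1
      omega

lemma overwrite_single (f : ℕ → ℕ) (w x : ℕ) :
    Function.update f w x = overwrite f w [x] := by
  ext i
  simp only [overwrite, Function.update_apply]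
  rcases lt_trichotomy i w with h | h | h
  · simp [h, h.ne]
  · simp [h]
  · rw [if_neg h.ne', if_neg (by omega), List.getD_eq_default _ _ (by simp; omega)]

lemma update_overwrite (f : ℕ → ℕ) (w x : ℕ) (L : List ℕ) :
    Function.update (overwrite f w L) (w + L.length) x = overwrite f w (L ++ [x]) := by
  rw [overwrite_single, overwrite_append]

lemma overwrite_get (f : ℕ → ℕ) (w : ℕ) (L : List ℕ) {i : ℕ} (hi : i < L.length) (x : ℕ) :
    overwrite f w L (w + i) = L.getD i x := by
  simp only [overwrite, Nat.not_lt.2 (Nat.le_add_right w i), if_false, Nat.add_sub_cancel_left]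
  rw [List.getD_eq_getElem _ _ hi, List.getD_eq_getElem _ _ hi]

/-- The number of variables. -/
abbrev nE : Expr := .get 0 (.const 0)
/-- The arity. -/
abbrev kE : Expr := .get 0 (.const 1)
/-- The number of constraints. -/
abbrev mE : Expr := .get 0 (.const 2)

/-- Draw a random index. -/
def idxProg : Prog :=
  .seq (asg 12 (.const 0)) (forTo 13 mE (.seq (.flip 14 (.const 0))
    (.seq (asg 12 (.add (.add (V 12) (V 12)) (V 14)))
      (.ite (.sub (.add (V 12) (.const 1)) mE) (asg 12 (.sub (V 12) mE)) .skip))))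

lemma sim_idxProg {n K m B : ℕ} [NeZero m] {J : KFormula n K m} {s : Memory}
    (hs : s 0 = arrayOf (encodeFormula J)) (hB : m ≤ B) :
    Sim idxProg s (B * 12 + 5) (idxLaw m) fun r s' => s' 12 0 = r ∧
      ∀ b, b ≠ 12 → b ≠ 13 → b ≠ 14 → s' b = s b := by
  have hm : 0 < m := Nat.pos_of_ne_zero (NeZero.ne m)
  refine (Sim.set_seq (Sim.conseq (Sim.forTo (t := 9) (fun i (r : Fin m) s' => s' 12 0 = r ∧
      s' 13 0 = i ∧ ∀ b, b ≠ 12 → b ≠ 13 → b ≠ 14 → s' b = s b) hB ?_ ?_ ?_) ?_)).mono (by omega)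
  · refine ⟨by simp [Expr.eval], by simp, fun b h1 h2 h3 => by simp [h1, h2]⟩
  · rintro i - r s' ⟨h1, h2, h3⟩
    refine ⟨h2, ?_⟩
    simp [Expr.eval, h3 0, hs, encode_two]
  · rintro i - r s' ⟨h1, h2, h3⟩
    have h0 : ∀ (c : Bool), (s'.store 14 0 c.toNat) 0 = s 0 := fun c => by simp [h3 0]
    have hm' : s 0 2 = m := by rw [hs, encode_two]
    refine (Sim.map (f := fun c : Bool => Fin.ofNat m (r + r + c.toNat)) (Sim.seq_det
      (t₂ := 5) (Sim.flip (R := fun c s'' => s'' = s'.store 14 0 c.toNat) fun c => rfl)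
      (R₂ := fun c s'' => s'' 12 0 = Fin.ofNat m (r + r + c.toNat) ∧ s'' 13 0 = i ∧
        ∀ b, b ≠ 12 → b ≠ 13 → b ≠ 14 → s'' b = s b) ?_)
      ?_).mono (by omega)
    · rintro c - s'' rfl
      have hc : c.toNat ≤ 1 := Bool.toNat_le c
      have hr := r.isLt
      refine (Sim.set_seq (Sim.ite (t := 1) (fun he => Det.set ?_) (fun he => Det.skip ?_))).mono
        (by omega)
      · simp [Expr.eval, h1, h3 0, hm'] at he ⊢
        refine ⟨?_, h2, fun b g1 g2 g3 => by simp [g1, g3, h3 b g1 g2 g3]⟩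
        rw [Nat.mod_eq_sub_mod (by omega), Nat.mod_eq_of_lt (by omega)]
      · simp [Expr.eval, h1, h3 0, hm'] at he ⊢
        refine ⟨?_, h2, fun b g1 g2 g3 => by simp [g1, g3, h3 b g1 g2 g3]⟩
        rw [Nat.mod_eq_of_lt (by omega)]
    · rintro c - s'' ⟨g1, g2, g3⟩
      exact ⟨g2, by simpa using g1, by simp, fun b k1 k2 k3 => by simp [k2, g3 b k1 k2 k3]⟩
  · rintro r - s' ⟨h1, h2, h3⟩
    exact ⟨h1, h3⟩

/-- Compute the position of the constraint with index in register 12. -/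
def ptrProg (x y : ℕ) (e : Expr) : Prog :=
  .seq (asg x (.const 3)) (forTo y e (asg x (.add (V x) (.add kE kE))))

lemma det_ptrProg {n K m B : ℕ} {J : KFormula n K m} {s : Memory}
    (hs : s 0 = arrayOf (encodeFormula J)) {x y z r : ℕ} (hx : x ≠ 0) (hy : y ≠ 0) (hxy : x ≠ y)
    (hxz : z ≠ x) (hyz : z ≠ y) (hz : s z 0 = r) (hr : r ≤ B) :
    Det (ptrProg x y (V z)) s (B * 4 + 5) fun s' => s' x 0 = 3 + r * (K + K) ∧
      ∀ b, b ≠ x → b ≠ y → s' b = s b := by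
  refine (Sim.set_seq (Det.conseq (Det.forTo (t := 1) (fun i s' => s' x 0 = 3 + i * (K + K) ∧
      s' y 0 = i ∧ ∀ b, b ≠ x → b ≠ y → s' b = s b) hr ?_ ?_ ?_) ?_)).mono (by omega)
  · refine ⟨by simp [Expr.eval, hxy], by simp, fun b h1 h2 => by simp [h1, h2]⟩
  · rintro i - s' ⟨h1, h2, h3⟩
    refine ⟨h2, ?_⟩
    simp [Expr.eval, h3 z hxz hyz, hz]
  · rintro i - s' ⟨h1, h2, h3⟩
    refine Det.set ?_
    have hk : s 0 1 = K := by rw [hs, encode_one]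
    simp only [Expr.eval, h3 0 hx.symm hy.symm, hk, h1]
    refine ⟨by simp [hxy.symm, h2], by simp [hxy]; ring, by simp, fun b g1 g2 => ?_⟩
    simp [g1, g2, h3 b g1 g2]
  · rintro s' ⟨h1, h2, h3⟩
    exact ⟨h1, h3⟩

/-- Compute the literal vector of the constraint at the position in register 15, where the first
sign is multiplied by the sign in register 10. -/
def litProg : Prog :=
  .seq (forTo 17 (.add nE nE) (.set 16 (V 17) (.const 0)))
    (forTo 17 kE
      (.seq (asg 18 (.get 0 (.add (V 15) (.add (V 17) (V 17)))))
      (.seq (asg 19 (.get 0 (.add (.add (V 15) (.add (V 17) (V 17))) (.const 1))))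
      (.seq (.ite (V 17) .skip (.ite (V 10) .skip (asg 19 (.sub (.const 1) (V 19)))))
        (.set 16 (.add (.add (V 18) (V 18)) (V 19)) (.const 1))))))

lemma bit_neg_mul (u : ℤˣ) : bit (-1 * u) = 1 - bit u := by
  rcases Int.units_eq_one_or u with rfl | rfl <;> simp [bit]

lemma det_litProg {n K m B : ℕ} {J : KFormula n K m} {s : Memory}
    (hs : s 0 = arrayOf (encodeFormula J)) (hn : n + n ≤ B) (hK : K ≤ B) {j : Fin m}
    (h15 : s 15 0 = 3 + j * (K + K)) {y : Bool} (h10 : s 10 0 = y.toNat) :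
    Det litProg s (B * 18 + 7) fun s' =>
      (∀ p < n + n, s' 16 p = litBit ((J j).flip (sgn y)) p) ∧
      ∀ b, b ≠ 16 → b ≠ 17 → b ≠ 18 → b ≠ 19 → s' b = s b := by
  set C := (J j).flip (sgn y) with hC
  have hn' : s 0 0 = n := by rw [hs, encode_zero]
  have hk' : s 0 1 = K := by rw [hs, encode_one]
  refine (Det.seq (t₁ := B * (1 + 3) + 3) (t₂ := B * (11 + 3) + 3) (Det.forTo (t := 1) (n := n + n)
    (fun i s' => s' 17 0 = i ∧
      (∀ p < i, s' 16 p = 0) ∧ ∀ b, b ≠ 16 → b ≠ 17 → s' b = s b) hn ?_ ?_ ?_) ?_).mono (by omega)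
  · exact ⟨by simp, by simp, fun b h1 h2 => by simp [h2]⟩
  · rintro i - s' ⟨h1, h2, h3⟩
    exact ⟨h1, by simp [Expr.eval, h3 0, hn']⟩
  · rintro i - s' ⟨h1, h2, h3⟩
    refine Det.set ?_
    simp only [Expr.eval, h1]
    refine ⟨by simp [h1], by simp, fun p hp => ?_, fun b g1 g2 => by simp [g1, g2, h3 b g1 g2]⟩
    rw [store_ne _ _ _ (by omega), store_same, Function.update_apply]
    split_ifs with h
    · rfl
    · exact h2 p (by omega)
  · rintro s₁ ⟨-, h2, h3⟩
    refine Det.conseq (Det.forTo (t := 11) (n := K) (fun i s' => s' 17 0 = i ∧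
      (∀ p < n + n, s' 16 p = if ∃ i' : Fin K, (i' : ℕ) < i ∧ p = C.1 i' + C.1 i' + bit (C.2 i')
        then 1 else 0) ∧
      ∀ b, b ≠ 16 → b ≠ 17 → b ≠ 18 → b ≠ 19 → s' b = s b) hK ?_ ?_ ?_) ?_
    · refine ⟨by simp, fun p hp => ?_, fun b h4 h5 h6 h7 => by simp [h5, h3 b h4 h5]⟩
      simp [h2 p hp]
    · rintro i - s' ⟨h4, h5, h6⟩
      exact ⟨h4, by simp [Expr.eval, h6 0, hk']⟩
    · rintro i hi s' ⟨h4, h5, h6⟩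
      have hv : s' 0 (3 + j * (K + K) + (i + i)) = (J j).1 ⟨i, hi⟩ := by
        rw [h6 0 (by simp) (by simp) (by simp) (by simp), hs]
        exact encode_var J j ⟨i, hi⟩
      have hb : s' 0 (3 + j * (K + K) + (i + i) + 1) = bit ((J j).2 ⟨i, hi⟩) := by
        rw [h6 0 (by simp) (by simp) (by simp) (by simp), hs]
        exact encode_sign J j ⟨i, hi⟩
      have h15' : s' 15 0 = 3 + j * (K + K) := by
        rw [h6 15 (by simp) (by simp) (by simp) (by simp), h15]
      have h10' : s' 10 0 = y.toNat := by
        rw [h6 10 (by simp) (by simp) (by simp) (by simp), h10]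
      refine (Sim.set_seq (Sim.set_seq (Det.seq (t₁ := 3) (t₂ := 1)
        (I := fun s'' => s'' 19 0 = bit (C.2 ⟨i, hi⟩) ∧ s'' 18 0 = C.1 ⟨i, hi⟩ ∧
          ∀ b, b ≠ 18 → b ≠ 19 → s'' b = s' b) ?_ ?_))).mono (by omega)
      · simp only [Expr.eval, h15', h4, hv, store_ne _ _ _ (show (15 : ℕ) ≠ 18 by simp),
          store_ne _ _ _ (show (17 : ℕ) ≠ 18 by simp), store_ne _ _ _ (show (0 : ℕ) ≠ 18 by simp),
          hb]
        refine Sim.ite (t := 2) (fun he => (Det.skip ?_).mono (by omega)) fun he =>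
          Sim.ite (t := 1) (fun he' => Det.skip ?_) fun he' => Det.set ?_
        · refine ⟨?_, by simp [hC, KTuple.flip], fun b g1 g2 => by simp [g1, g2]⟩
          simp [Expr.eval, h4] at he
          simp [hC, KTuple.flip, he]
        · refine ⟨?_, by simp [hC, KTuple.flip], fun b g1 g2 => by simp [g1, g2]⟩
          simp [Expr.eval, h10'] at he'
          simp [hC, KTuple.flip, he', sgn]
        · refine ⟨?_, by simp [hC, KTuple.flip], fun b g1 g2 => by simp [g1, g2]⟩
          simp [Expr.eval, h10'] at he'
          simp [Expr.eval, h4] at he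
          simp only [Expr.eval, store_same, Function.update_self, hC, KTuple.flip, he, sgn, he',
            if_true]
          exact (bit_neg_mul _).symm
      · rintro s₂ ⟨g1, g2, g3⟩
        refine Det.set ?_
        simp only [Expr.eval, g1, g2]
        refine ⟨by simp [g3 17, h4], by simp, fun p hp => ?_, fun b k1 k2 k3 k4 => ?_⟩
        · rw [store_ne _ _ _ (by simp), store_same, Function.update_apply,
            g3 16 (by simp) (by simp), h5 p hp]
          by_cases hp' : p = C.1 ⟨i, hi⟩ + C.1 ⟨i, hi⟩ + bit (C.2 ⟨i, hi⟩)
          · rw [if_pos hp', if_pos ⟨⟨i, hi⟩, by simp, hp'⟩]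
          · rw [if_neg hp']
            congr 1
            refine propext (exists_congr fun i' => ?_)
            constructor
            · exact fun h => ⟨by omega, h.2⟩
            · rintro ⟨h, h'⟩
              refine ⟨?_, h'⟩
              rcases Nat.lt_or_ge i' i with h'' | h''
              · exact h''
              · obtain rfl : i' = ⟨i, hi⟩ := Fin.ext (by simp; omega)
                exact absurd h' hp'
        · simp [k1, k2, g3 b k3 k4, h6 b k1 k2 k3 k4]
    · rintro s' ⟨h4, h5, h6⟩
      refine ⟨fun p hp => ?_, h6⟩
      rw [h5 p hp, litBit]
      simp

/-- Write the `d`-th tensor power of the vector `1 :: S` to array `g`, where `d` is in register 1,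
and the entries of `S` in array 16. -/
def tensProg (g : ℕ) : Prog :=
  .seq (.set g (V 20) (.const 1)) (.seq (asg 21 (.const 1)) (.seq
    (forTo 24 (V 1) (.seq (asg 23 (V 21)) (forTo 22 (.add nE nE) (forTo 17 (V 23)
      (.seq (.set g (.add (V 20) (V 21)) (.sub (.const 1) (.add
          (.sub (.get g (.add (V 20) (V 17))) (.get 16 (V 22)))
          (.sub (.get 16 (V 22)) (.get g (.add (V 20) (V 17)))))))
        (asg 21 (.add (V 21) (.const 1))))))))
    (asg 20 (.add (V 20) (V 21)))))

lemma det_tensProg {n d B g : ℕ} {s : Memory} {S : List ℕ} (hg : 25 ≤ g) (h0 : s 0 0 = n)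
    (hS : S.length = n + n) (h16 : ∀ p < n + n, s 16 p = S.getD p 0) (h1 : s 1 0 = d)
    (hn : n + n ≤ B) (hd : d ≤ B) (hB : (n + n + 1) ^ d ≤ B) :
    Det (tensProg g) s (B * ((B * ((B * (4 + 3) + 3) + 3) + 3) + 2 + 3) + 9) fun s' =>
      s' g = overwrite (s g) (s 20 0) (tens S d) ∧
      s' 20 0 = s 20 0 + (tens S d).length ∧
      ∀ b, b ≠ g → b ≠ 17 → b ≠ 20 → b ≠ 21 → b ≠ 22 → b ≠ 23 → b ≠ 24 → s' b = s b := by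
  set w := s 20 0 with hw
  refine (Sim.set_seq (Sim.set_seq (Det.seq (t₁ := B * ((B * ((B * (4 + 3) + 3) + 3) + 3) + 2 + 3) + 3)
    (t₂ := 1) (Det.forTo (n := d)
    (t := (B * ((B * (4 + 3) + 3) + 3) + 3) + 2) (fun k s' => s' 24 0 = k ∧
      s' g = overwrite (s g) w (tens S k) ∧ s' 21 0 = (tens S k).length ∧
      ∀ b, b ≠ g → b ≠ 17 → b ≠ 21 → b ≠ 22 → b ≠ 23 → b ≠ 24 → s' b = s b) hd ?_ ?_ ?_)
      ?_))).mono (by omega)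
  · refine ⟨by simp, ?_, ?_, fun b k1 k2 k3 k4 k5 k6 => by simp [k1, k3, k6]⟩
    · rw [store_ne _ _ _ (by omega), store_ne _ _ _ (by omega), store_same]
      simp only [Expr.eval, tens]
      rw [overwrite_single]
    · simp [Expr.eval, tens]
  · rintro k - s' ⟨k1, k2, k3, k4⟩
    exact ⟨k1, by simp [Expr.eval, k4 1 (by omega), h1]⟩
  · rintro k hk s₁ ⟨k1, k2, k3, k4⟩
    have hlen : (tens S k).length ≤ B := by
      rw [length_tens, hS]
      exact (Nat.pow_le_pow_right (by omega) hk.le).trans hB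
    refine Sim.set_seq (Det.conseq (Det.forTo (n := n + n)
      (t := B * (4 + 3) + 3) (fun a s' => s' 22 0 = a ∧
      s' g = overwrite (s g) w (tens S k ++ (S.take a).flatMap
        fun b => (tens S k).map fun a => xnor a b) ∧
      s' 21 0 = (tens S k ++ (S.take a).flatMap fun b => (tens S k).map fun a => xnor a b).length ∧
      s' 23 0 = (tens S k).length ∧ s' 24 0 = k ∧
      ∀ b, b ≠ g → b ≠ 17 → b ≠ 21 → b ≠ 22 → b ≠ 23 → b ≠ 24 → s' b = s b) hn ?_ ?_ ?_) ?_)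
    · refine ⟨by simp, ?_, ?_, by simp [Expr.eval, k3], by simp [k1],
        fun b l1 l2 l3 l4 l5 l6 => by simp [l4, l5, k4 b l1 l2 l3 l4 l5 l6]⟩
      · rw [store_ne _ _ _ (by omega), store_ne _ _ _ (by omega), k2]
        simp
      · simp [k3]
    · rintro a - s' ⟨l1, l2, l3, l4, l5, l6⟩
      exact ⟨l1, by simp [Expr.eval, l6 0 (by omega), h0]⟩
    · rintro a ha s₂ ⟨l1, l2, l3, l4, l5, l6⟩
      set L := tens S k ++ (S.take a).flatMap fun b => (tens S k).map fun a => xnor a b with hL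
      refine Det.conseq (Det.forTo (n := (tens S k).length) (t := 4) (fun i s' => s' 17 0 = i ∧
        s' g = overwrite (s g) w (L ++ ((tens S k).take i).map fun x => xnor x (S.getD a 0)) ∧
        s' 21 0 = (L ++ ((tens S k).take i).map fun x => xnor x (S.getD a 0)).length ∧
        s' 22 0 = a ∧ s' 23 0 = (tens S k).length ∧ s' 24 0 = k ∧
        ∀ b, b ≠ g → b ≠ 17 → b ≠ 21 → b ≠ 22 → b ≠ 23 → b ≠ 24 → s' b = s b) hlen ?_ ?_ ?_) ?_
      · refine ⟨by simp, ?_, by simp [l3], by simp [l1], by simp [l4], by simp [l5],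
          fun b e1 e2 e3 e4 e5 e6 => by simp [e2, l6 b e1 e2 e3 e4 e5 e6]⟩
        rw [store_ne _ _ _ (by omega), l2]
        simp
      · rintro i - s' ⟨e1, e2, e3, e4, e5, e6, e7⟩
        exact ⟨e1, by simp [Expr.eval, e5]⟩
      · rintro i hi s₃ ⟨e1, e2, e3, e4, e5, e6, e7⟩
        have h20 : s₃ 20 0 = w := by rw [e7 20 (by omega) (by simp) (by simp) (by simp) (by simp)
          (by simp)]
        have hget : s₃ g (w + i) = (tens S k).getD i 0 := by
          rw [e2, overwrite_get _ _ _ (by simp [hL]; omega) 0, hL, List.append_assoc,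
            List.getD_append _ _ _ _ hi]
        have h16' : s₃ 16 a = S.getD a 0 := by
          rw [e7 16 (by omega) (by simp) (by simp) (by simp) (by simp) (by simp), h16 a ha]
        have htake : List.take (i + 1) (tens S k) = List.take i (tens S k) ++
            [(tens S k).getD i 0] := by
          rw [List.take_succ_eq_append_getElem hi, List.getD_eq_getElem _ _ hi]
        refine (Sim.set_seq (Det.set ?_)).mono (by omega)
        simp only [Expr.eval, h20, e1, e4, hget, h16', e3]
        have hmap : L ++ List.map (fun x => xnor x (S.getD a 0)) (List.take (i + 1) (tens S k)) =
            (L ++ List.map (fun x => xnor x (S.getD a 0)) (List.take i (tens S k))) ++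
            [xnor ((tens S k).getD i 0) (S.getD a 0)] := by
          rw [htake, List.map_append, ← List.append_assoc]
          rfl
        refine ⟨?_, by simp, ?_, ?_, ?_, ?_, ?_, fun b e1 e2 e3 e4 e5 e6 => ?_⟩
        · rw [store_ne _ _ _ (by simp), store_ne _ _ _ (by omega), e1]
        · rw [store_ne _ _ _ (by omega), store_ne _ _ _ (by omega), store_same, e2,
            update_overwrite, hmap]
          rfl
        · rw [hmap, List.length_append (bs := [_])]
          rw [store_ne _ _ _ (by simp), store_same, Function.update_self,
            store_ne s₃ _ _ (show (21 : ℕ) ≠ g by omega), e3]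
          rfl
        · rw [store_ne _ _ _ (by simp), store_ne _ _ _ (by simp), store_ne _ _ _ (by omega), e4]
        · rw [store_ne _ _ _ (by simp), store_ne _ _ _ (by simp), store_ne _ _ _ (by omega), e5]
        · rw [store_ne _ _ _ (by simp), store_ne _ _ _ (by simp), store_ne _ _ _ (by omega), e6]
        · rw [store_ne _ _ _ (by omega), store_ne _ _ _ (by omega), store_ne _ _ _ (by omega),
            e7 b e1 e2 e3 e4 e5 e6]
      · rintro s₃ ⟨e1, e2, e3, e4, e5, e6, e7⟩
        have hL' : tens S k ++ List.flatMap (fun b => List.map (fun a => xnor a b) (tens S k))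
            (List.take (a + 1) S) = L ++ List.map (fun x => xnor x (S.getD a 0)) (tens S k) := by
          have ha' : a < S.length := by omega
          rw [List.take_succ_eq_append_getElem ha', List.getD_eq_getElem _ _ ha',
            List.flatMap_append, hL]
          simp
        rw [List.take_length] at e2 e3
        refine ⟨e4, by simp, ?_, ?_, by simp [e5], by simp [e6],
          fun b k1 k2 k3 k4 k5 k6 => by simp [k4, e7 b k1 k2 k3 k4 k5 k6]⟩
        · rw [store_ne _ _ _ (by omega), e2, hL']
        · rw [store_ne _ _ _ (by omega), e3, hL']
    · rintro s₂ ⟨l1, l2, l3, l4, l5, l6⟩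
      have : List.take (n + n) S = S := List.take_of_length_le (by omega)
      rw [this] at l2 l3
      refine ⟨l5, by simp, ?_, by simp [l3, tens],
          fun b e1 e2 e3 e4 e5 e6 => by simp [e6, l6 b e1 e2 e3 e4 e5 e6]⟩
      rw [store_ne _ _ _ (by omega), l2]
      rfl
  · rintro s₁ ⟨k1, k2, k3, k4⟩
    refine Det.set ?_
    have h20 : s₁ 20 0 = w := by rw [k4 20 (by omega) (by simp) (by simp) (by simp) (by simp)
          (by simp)]
    simp only [Expr.eval, h20, k3]
    refine ⟨?_, by simp, fun b e1 e2 e3 e4 e5 e6 e7 => ?_⟩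
    · rw [store_ne _ _ _ (by omega), k2]
    · simp [e3, k4 b e1 e2 e4 e5 e6 e7]

/-- Draw an example and write it to array `g`, from position `e` on. -/
def sampleProg (g : ℕ) (e : Expr) : Prog :=
  .seq (.flip 10 (.const 0)) (.seq (asg 20 e) (.seq
    (forTo 11 (V 2) (.seq idxProg (.seq (ptrProg 15 13 (V 12)) (.seq litProg (tensProg g)))))
    (.set g (V 20) (V 10))))

/-- Time bound for `sampleProg`. -/
def sampleTime (B : ℕ) : ℕ :=
  B * (B * ((B * ((B * (4 + 3) + 3) + 3) + 3) + 2 + 3) + 9 + B * 18 + B * 4 + B * 12 + 28) + 10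

lemma sim_sampleProg {n K m d q B g w : ℕ} [NeZero m] {J : KFormula n K m} {s : Memory} {e : Expr}
    (hg : 25 ≤ g) (hs : s 0 = arrayOf (encodeFormula J)) (h1 : s 1 0 = d) (h2 : s 2 0 = q)
    (he : ∀ s' : Memory, (∀ b, 25 ≤ b → s' b = s b) → e.eval s' = w) (hn : n + n ≤ B) (hK : K ≤ B)
    (hm : m ≤ B) (hd : d ≤ B) (hq : q ≤ B) (hB : (n + n + 1) ^ d ≤ B) :
    Sim (sampleProg g e) s (sampleTime B) (exampleLaw J d q) fun l s' =>
      s' g = overwrite (s g) w l ∧ ∀ b, (b < 10 ∨ 25 ≤ b) → b ≠ g → s' b = s b := by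
  refine (Sim.seq (Sim.flip (R := fun y s' => s' = s.store 10 0 y.toNat) fun y => rfl)
    (t₂ := B * (B * ((B * ((B * (4 + 3) + 3) + 3) + 3) + 2 + 3) + 9 + B * 18 + B * 4 + B * 12 + 28)
      + 7) ?_).mono (by unfold sampleTime; omega)
  rintro y - s₁ rfl
  set L : List (Fin m) → List ℕ := fun l => l.flatMap fun j => block d (sgn y) (J j) with hL
  refine Sim.set_seq (Sim.map (Sim.seq_det (t₂ := 1)
    (t₁ := B * (B * ((B * ((B * (4 + 3) + 3) + 3) + 3) + 2 + 3) + 9 + B * 18 + B * 4 + B * 12 + 28)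
      + 3) (Sim.forTo (n := q) (t := (B * ((B * ((B * (4 + 3) + 3) + 3) + 3) + 2 + 3) + 9 + B * 18 +
        B * 4 + B * 12 + 25)) (κ := fun l => (idxLaw m).map fun a => l ++ [a]) (a := [])
      (fun i (l : List (Fin m)) s' => s' 11 0 = i ∧ s' g = overwrite (s g) w (L l) ∧
        s' 20 0 = w + (L l).length ∧ s' 10 0 = y.toNat ∧
        ∀ b, (b < 10 ∨ 25 ≤ b) → b ≠ g → s' b = s b) hq ?_ ?_ ?_)
      (R₂ := fun l s' => s' g = overwrite (s g) w (L l ++ [y.toNat]) ∧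
        ∀ b, (b < 10 ∨ 25 ≤ b) → b ≠ g → s' b = s b) ?_) ?_)
  · have : e.eval (s.store 10 0 y.toNat) = w :=
      he _ fun b hb => by rw [store_ne _ _ _ (by omega)]
    refine ⟨by simp, ?_, by simp [Expr.eval, this, hL], by simp [Expr.eval], fun b hb hb' => ?_⟩
    · rw [store_ne _ _ _ (by omega), store_ne _ _ _ (by omega), store_ne _ _ _ (by omega), hL]
      simp [overwrite_nil]
    · rw [store_ne _ _ _ (by omega), store_ne _ _ _ (by omega), store_ne _ _ _ (by omega)]
  · rintro i - l s' ⟨k1, k2, k3, k4, k5⟩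
    exact ⟨k1, by simp [Expr.eval, k5 2 (by simp) (by omega), h2]⟩
  · rintro i hi l s' ⟨k1, k2, k3, k4, k5⟩
    have hs' : s' 0 = arrayOf (encodeFormula J) := by rw [k5 0 (by simp) (by omega), hs]
    refine (Sim.map (Sim.seq_det (sim_idxProg hs' hm) (R₂ := fun r s'' => s'' 11 0 = i ∧
      s'' g = overwrite (s g) w (L (l ++ [r])) ∧ s'' 20 0 = w + (L (l ++ [r])).length ∧
      s'' 10 0 = y.toNat ∧ ∀ b, (b < 10 ∨ 25 ≤ b) → b ≠ g → s'' b = s b)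
      (t₂ := (B * ((B * ((B * (4 + 3) + 3) + 3) + 3) + 2 + 3) + 9 + B * 18 + B * 4 + 19)) ?_)
      ?_).mono (by omega)
    · rintro r - s₂ ⟨l1, l2⟩
      have hs₂ : s₂ 0 = arrayOf (encodeFormula J) := by
        rw [l2 0 (by simp) (by simp) (by simp), hs']
      refine (Det.seq (det_ptrProg (B := B) hs₂ (by simp) (by simp) (by simp) (by simp) (by simp)
        l1 (r.isLt.le.trans hm)) (fun s₃ hs₃ => Det.seq (det_litProg (B := B) (s := s₃) (J := J)
          (j := r) (y := y) ?_ hn hK hs₃.1 ?_) (fun s₄ hs₄ => Det.conseq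
            (det_tensProg (B := B) (d := d) (n := n) (S := litVec ((J r).flip (sgn y)))
              hg ?_ ?_ ?_ ?_ hn hd hB) ?_))).mono (by omega)
      · rw [hs₃.2 0 (by simp) (by simp), hs₂]
      · rw [hs₃.2 10 (by simp) (by simp), l2 10 (by simp) (by simp) (by simp), k4]
      · rw [hs₄.2 0 (by simp) (by simp) (by simp) (by simp), hs₃.2 0 (by simp) (by simp), hs₂,
          encode_zero]
      · simp [litVec]
      · intro p hp
        rw [hs₄.1 p hp, litVec, List.getD_eq_getElem _ _ (by simpa using hp)]
        simp
      · rw [hs₄.2 1 (by simp) (by simp) (by simp) (by simp), hs₃.2 1 (by simp) (by simp),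
          l2 1 (by simp) (by simp) (by simp), k5 1 (by simp) (by omega), h1]
      · rintro s₅ ⟨e1, e2, e3⟩
        have hall : ∀ b, b ≠ 12 → b ≠ 13 → b ≠ 14 → b ≠ 15 → b ≠ 16 → b ≠ 17 → b ≠ 18 → b ≠ 19 →
            s₄ b = s' b := fun b p1 p2 p3 p4 p5 p6 p7 p8 => by
          rw [hs₄.2 b p5 p6 p7 p8, hs₃.2 b p4 p2, l2 b p1 p2 p3]
        have hg' : s₄ g = s' g := hall g (by omega) (by omega) (by omega) (by omega) (by omega)
          (by omega) (by omega) (by omega)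
        have h20 : s₄ 20 0 = w + (L l).length := by
          rw [hall 20 (by simp) (by simp) (by simp) (by simp) (by simp) (by simp) (by simp)
            (by simp), k3]
        have hLr : L (l ++ [r]) = L l ++ tens (litVec ((J r).flip (sgn y))) d := by
          simp [hL, block]
        refine ⟨?_, ?_, ?_, ?_, fun b p1 p2 => ?_⟩
        · rw [e3 11 (by omega) (by simp) (by simp) (by simp) (by simp) (by simp) (by simp),
            hall 11 (by simp) (by simp) (by simp) (by simp) (by simp) (by simp) (by simp)
            (by simp), k1]
        · rw [e1, hg', k2, h20, overwrite_append, hLr]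
        · rw [e2, h20, hLr, List.length_append, add_assoc]
        · rw [e3 10 (by omega) (by simp) (by simp) (by simp) (by simp) (by simp) (by simp),
            hall 10 (by simp) (by simp) (by simp) (by simp) (by simp) (by simp) (by simp)
            (by simp), k4]
        · rw [e3 b (by omega) (by omega) (by omega) (by omega) (by omega) (by omega) (by omega),
            hall b (by omega) (by omega) (by omega) (by omega) (by omega) (by omega) (by omega)
            (by omega), k5 b p1 p2]
    · rintro r - s₂ ⟨e1, e2, e3, e4, e5⟩
      refine ⟨e1, by simp, ?_, by simp [e3], by simp [e4], fun b p1 p2 => ?_⟩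
      · rw [store_ne _ _ _ (by omega), e2]
      · rw [store_ne _ _ _ (by omega), e5 b p1 p2]
  · rintro l - s' ⟨k1, k2, k3, k4, k5⟩
    refine Det.set ⟨?_, fun b p1 p2 => by rw [store_ne _ _ _ p2, k5 b p1 p2]⟩
    simp only [Expr.eval, k3, k4]
    rw [store_same, k2, update_overwrite]
  · rintro l - s' h
    exact h

/-! ### The correlation test and the parameters -/

/-- The correlation of two tuples: the sum over all sets `S` of positions of
`∏ i ∈ S, u i`, where `u i` is the product of the `i`-th literals if they have the same variable,
and 0 otherwise. -/
def pairCorr {n K : ℕ} (C C' : KTuple n K) : ℕ :=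
  ∏ i, if C.1 i = C'.1 i then (if C.2 i = C'.2 i then 2 else 0) else 1

/-- The total correlation of the constraints of a formula. -/
def corr {n K m : ℕ} (J : KFormula n K m) : ℕ := ∑ j, ∑ j', pairCorr (J j) (J j')

/-- One factor of `pairCorr`, in terms of the input array. -/
def factorAt (f : ℕ → ℕ) (x y i : ℕ) : ℕ :=
  if f (x + (i + i)) = f (y + (i + i)) then
    (if f (x + (i + i) + 1) = f (y + (i + i) + 1) then 2 else 0) else 1

lemma bit_injective : Function.Injective bit := by
  intro u v h
  rcases Int.units_eq_one_or u with rfl | rfl <;> rcases Int.units_eq_one_or v with rfl | rfl <;>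
    simp_all [bit]

lemma corr_eq {n K m : ℕ} (J : KFormula n K m) :
    corr J = ∑ j ∈ Finset.range m, ∑ j' ∈ Finset.range m, ∏ i ∈ Finset.range K,
      factorAt (arrayOf (encodeFormula J)) (3 + j * (K + K)) (3 + j' * (K + K)) i := by
  rw [corr, Finset.sum_range]
  refine Finset.sum_congr rfl fun j _ => ?_
  rw [Finset.sum_range]
  refine Finset.sum_congr rfl fun j' _ => ?_
  rw [pairCorr, Finset.prod_range]
  refine Finset.prod_congr rfl fun i _ => ?_
  simp only [factorAt, encode_var, encode_sign, bit_injective.eq_iff, Fin.val_inj]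

/-- Both differences of two expressions; the value is 0 if and only if they agree. -/
def Expr.dist (e₁ e₂ : Expr) : Expr := .add (.sub e₁ e₂) (.sub e₂ e₁)

lemma Expr.eval_dist_eq_zero {s : Memory} {e₁ e₂ : Expr} :
    (e₁.dist e₂).eval s = 0 ↔ e₁.eval s = e₂.eval s := by
  simp only [Expr.dist, Expr.eval]
  omega

/-- Compute the total correlation of the constraints in register 29. -/
def corrProg : Prog :=
  .seq (asg 29 (.const 0)) (.seq (asg 30 (.const 3)) (forTo 25 mE (.seq (asg 31 (.const 3)) (.seq
    (forTo 26 mE (.seq (asg 28 (.const 1)) (.seq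
      (forTo 27 kE (.ite ((Expr.get 0 (.add (V 30) (.add (V 27) (V 27)))).dist
          (Expr.get 0 (.add (V 31) (.add (V 27) (V 27))))) .skip
        (.ite ((Expr.get 0 (.add (.add (V 30) (.add (V 27) (V 27))) (.const 1))).dist
          (Expr.get 0 (.add (.add (V 31) (.add (V 27) (V 27))) (.const 1))))
          (asg 28 (.const 0)) (asg 28 (.add (V 28) (V 28))))))
      (.seq (asg 29 (.add (V 29) (V 28))) (asg 31 (.add (V 31) (.add kE kE)))))))
    (asg 30 (.add (V 30) (.add kE kE)))))))

lemma det_corrProg {n K m B : ℕ} {J : KFormula n K m} {s : Memory}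
    (hs : s 0 = arrayOf (encodeFormula J)) (hK : K ≤ B) (hm : m ≤ B) :
    Det corrProg s (B * (B * (B * 6 + 12) + 12) + 7) fun s' => s' 29 0 = corr J ∧
      ∀ b, (b < 25 ∨ 32 ≤ b) → s' b = s b := by
  set f := arrayOf (encodeFormula J) with hf
  set g : ℕ → ℕ → ℕ := fun j j' =>
    ∏ i ∈ Finset.range K, factorAt f (3 + j * (K + K)) (3 + j' * (K + K)) i with hg
  have f1 : f 1 = K := encode_one J
  have f2 : f 2 = m := encode_two J
  refine (Sim.set_seq (Sim.set_seq (Det.conseq (Det.forTo (n := m) (t := B * (B * 6 + 12) + 8)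
    (fun j s' => s' 25 0 = j ∧ s' 30 0 = 3 + j * (K + K) ∧
      s' 29 0 = ∑ j ∈ Finset.range j, ∑ j' ∈ Finset.range m, g j j' ∧
      ∀ b, (b < 25 ∨ 32 ≤ b) → s' b = s b) hm ?_ ?_ ?_) ?_))).mono (by ring_nf; omega)
  · refine ⟨by simp, by simp [Expr.eval], by simp [Expr.eval], fun b hb => ?_⟩
    rw [store_ne _ _ _ (by omega), store_ne _ _ _ (by omega), store_ne _ _ _ (by omega)]
  · rintro j - s' ⟨h1, h2, h3, h4⟩
    exact ⟨h1, by simp [Expr.eval, h4 0, hs, f2]⟩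
  · rintro j hj s₁ ⟨h1, h2, h3, h4⟩
    refine (Sim.set_seq (Det.seq (t₁ := B * (B * 6 + 9 + 3) + 3) (t₂ := 1) (Det.forTo (n := m)
      (t := B * 6 + 9)
      (fun j' s' => s' 26 0 = j' ∧ s' 31 0 = 3 + j' * (K + K) ∧ s' 25 0 = j ∧
        s' 30 0 = 3 + j * (K + K) ∧
        s' 29 0 = ∑ j ∈ Finset.range j, ∑ j' ∈ Finset.range m, g j j' +
          ∑ j' ∈ Finset.range j', g j j' ∧
        ∀ b, (b < 25 ∨ 32 ≤ b) → s' b = s b) hm ?_ ?_ ?_) ?_)).mono (by ring_nf; omega)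
    · refine ⟨by simp, by simp [Expr.eval], by simp [h1], by simp [h2], by simp [h3],
        fun b hb => ?_⟩
      rw [store_ne _ _ _ (by omega), store_ne _ _ _ (by omega), h4 b hb]
    · rintro j' - s' ⟨k1, k2, k3, k4, k5, k6⟩
      exact ⟨k1, by simp [Expr.eval, k6 0, hs, f2]⟩
    · rintro j' hj' s₂ ⟨k1, k2, k3, k4, k5, k6⟩
      refine (Sim.set_seq (Det.seq (t₁ := B * (3 + 3) + 3) (t₂ := 3) (Det.forTo (n := K) (t := 3)
        (fun i s' => s' 27 0 = i ∧ s' 28 0 = ∏ i ∈ Finset.range i,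
            factorAt f (3 + j * (K + K)) (3 + j' * (K + K)) i ∧
          ∀ b, b ≠ 27 → b ≠ 28 → s' b = s₂ b) hK ?_ ?_ ?_) ?_)).mono (by omega)
      · exact ⟨by simp, by simp [Expr.eval], fun b e1 e2 => by simp [e1, e2]⟩
      · rintro i - s' ⟨e1, e2, e3⟩
        exact ⟨e1, by simp [Expr.eval, e3 0, k6 0, hs, f1]⟩
      · rintro i hi s₃ ⟨e1, e2, e3⟩
        have e0 : s₃ 0 = f := by rw [e3 0 (by simp) (by simp), k6 0 (by simp), hs]
        have e30 : s₃ 30 0 = 3 + j * (K + K) := by rw [e3 30 (by simp) (by simp), k4]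
        have e31 : s₃ 31 0 = 3 + j' * (K + K) := by rw [e3 31 (by simp) (by simp), k2]
        refine Sim.ite (t := 2) (fun he => (Det.skip ?_).mono (by omega)) fun he =>
          Sim.ite (t := 1) (fun he' => Det.set ?_) fun he' => Det.set ?_
        · rw [Ne, Expr.eval_dist_eq_zero] at he
          simp only [Expr.eval, e0, e1, e30, e31] at he
          refine ⟨e1, by simp, ?_, fun b p1 p2 => by simp [p1, e3 b p1 p2]⟩
          rw [store_ne _ _ _ (by simp), e2, Finset.prod_range_succ]
          simp [factorAt, he]
        all_goals
          rw [Expr.eval_dist_eq_zero] at he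
          simp only [Expr.eval, e0, e1, e30, e31] at he
        · rw [Ne, Expr.eval_dist_eq_zero] at he'
          simp only [Expr.eval, e0, e1, e30, e31] at he'
          refine ⟨by simp [e1], by simp, ?_, fun b p1 p2 => by simp [p1, p2, e3 b p1 p2]⟩
          rw [Finset.prod_range_succ]
          simp [Expr.eval, factorAt, he, he']
        · rw [Expr.eval_dist_eq_zero] at he'
          simp only [Expr.eval, e0, e1, e30, e31] at he'
          refine ⟨by simp [e1], by simp, ?_, fun b p1 p2 => by simp [p1, p2, e3 b p1 p2]⟩
          rw [Finset.prod_range_succ]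
          simp [Expr.eval, e2, factorAt, he, he', mul_two]
      · rintro s₃ ⟨e1, e2, e3⟩
        refine Sim.set_seq (Det.set ?_)
        have e0 : s₃ 0 1 = K := by rw [e3 0 (by simp) (by simp), k6 0 (by simp), hs, f1]
        simp only [Expr.eval]
        refine ⟨by simp [e3 26, k1], by simp, ?_, by simp [e3 25, k3], by simp [e3 30, k4], ?_,
          fun b hb => ?_⟩
        · simp [e0, e3 31, k2]; ring
        · simp [e2, e3 29, k5, Finset.sum_range_succ, hg, add_assoc]
        · rw [store_ne _ _ _ (by omega), store_ne _ _ _ (by omega), store_ne _ _ _ (by omega),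
            e3 b (by omega) (by omega), k6 b hb]
    · rintro s₂ ⟨k1, k2, k3, k4, k5, k6⟩
      refine Det.set ?_
      have e0 : s₂ 0 1 = K := by rw [k6 0 (by simp), hs, f1]
      simp only [Expr.eval]
      refine ⟨by simp [k3], by simp, ?_, ?_, fun b hb => ?_⟩
      · simp [e0, k4]; ring
      · simp [k5, Finset.sum_range_succ]
      · rw [store_ne _ _ _ (by omega), store_ne _ _ _ (by omega), k6 b hb]
  · rintro s' ⟨h1, h2, h3, h4⟩
    exact ⟨by rw [h3, corr_eq], h4⟩

/-- Compute `e₀ * e₁ ^ e₂` in register `x`. -/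
def powProg (x : ℕ) (e₀ e₁ e₂ : Expr) : Prog :=
  .seq (asg x e₀) (forTo 9 e₂ (.seq (asg 7 (V x)) (.seq (asg x (.const 0))
    (forTo 8 e₁ (asg x (.add (V x) (V 7)))))))

lemma det_powProg {x a b c B : ℕ} {e₀ e₁ e₂ : Expr} {s : Memory} (h7 : x ≠ 7) (h8 : x ≠ 8)
    (h9 : x ≠ 9) (h₀ : e₀.eval s = a)
    (h₁ : ∀ s' : Memory, (∀ y, y ≠ x → y ≠ 7 → y ≠ 8 → y ≠ 9 → s' y = s y) → e₁.eval s' = b)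
    (h₂ : ∀ s' : Memory, (∀ y, y ≠ x → y ≠ 7 → y ≠ 8 → y ≠ 9 → s' y = s y) → e₂.eval s' = c)
    (hb : b ≤ B) (hc : c ≤ B) :
    Det (powProg x e₀ e₁ e₂) s (B * (B * 4 + 10) + 5) fun s' => s' x 0 = a * b ^ c ∧
      ∀ y, y ≠ x → y ≠ 7 → y ≠ 8 → y ≠ 9 → s' y = s y := by
  refine (Sim.set_seq (Det.conseq (Det.forTo (n := c) (t := B * 4 + 7) (fun i s' => s' 9 0 = i ∧
    s' x 0 = a * b ^ i ∧ ∀ y, y ≠ x → y ≠ 7 → y ≠ 8 → y ≠ 9 → s' y = s y) hc ?_ ?_ ?_) ?_)).mono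
    (le_of_eq (by ring))
  · refine ⟨by simp, by simp [Expr.eval, h₀, h9], fun y k1 k2 k3 k4 => by simp [k1, k4]⟩
  · rintro i - s' ⟨k1, k2, k3⟩
    exact ⟨k1, h₂ s' k3⟩
  · rintro i hi s₁ ⟨k1, k2, k3⟩
    refine (Sim.set_seq (Sim.set_seq (Det.conseq (Det.forTo (n := b) (t := 1) (fun j s' =>
      s' 8 0 = j ∧ s' 9 0 = i ∧ s' 7 0 = a * b ^ i ∧ s' x 0 = j * (a * b ^ i) ∧
      ∀ y, y ≠ x → y ≠ 7 → y ≠ 8 → y ≠ 9 → s' y = s y) hb ?_ ?_ ?_) ?_))).mono (by omega)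
    · refine ⟨by simp, by simp [k1, h9.symm], by simp [Expr.eval, h7.symm, k2],
        by simp [Expr.eval, h8], fun y p1 p2 p3 p4 => by simp [p1, p2, p3, k3 y p1 p2 p3 p4]⟩
    · rintro j - s' ⟨p1, p2, p3, p4, p5⟩
      exact ⟨p1, h₁ s' p5⟩
    · rintro j hj s' ⟨p1, p2, p3, p4, p5⟩
      refine Det.set ?_
      simp only [Expr.eval, p3, p4]
      refine ⟨by simp [p1, h8.symm], by simp, by simp [h9.symm, p2], by simp [h7.symm, p3],
        by simp [h8]; ring, fun y g1 g2 g3 g4 => by simp [g1, g3, p5 y g1 g2 g3 g4]⟩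
    · rintro s' ⟨p1, p2, p3, p4, p5⟩
      refine ⟨p2, by simp, by simp [h9, p4, pow_succ]; ring, fun y g1 g2 g3 g4 => by
        simp [g4, p5 y g1 g2 g3 g4]⟩
  · rintro s' ⟨k1, k2, k3⟩
    exact ⟨k2, k3⟩

/-- Compute the length of the binary representation of the number of variables in register 36. -/
def sizeProg : Prog :=
  .seq (asg 35 (.const 1)) (.seq (asg 36 (.const 0)) (forTo 25 nE
    (.ite (.sub (.add nE (.const 1)) (V 35))
      (.seq (asg 35 (.add (V 35) (V 35))) (asg 36 (.add (V 36) (.const 1)))) .skip)))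

lemma size_le_self (n : ℕ) : Nat.size n ≤ n := Nat.size_le.2 Nat.lt_two_pow_self

lemma det_sizeProg {n B : ℕ} {s : Memory} (h0 : s 0 0 = n) (hn : n ≤ B) :
    Det sizeProg s (B * 7 + 7) fun s' => s' 36 0 = Nat.size n ∧
      ∀ b, b ≠ 25 → b ≠ 35 → b ≠ 36 → s' b = s b := by
  refine (Sim.set_seq (Sim.set_seq (Det.conseq (Det.forTo (n := n) (t := 4) (fun i s' =>
    s' 25 0 = i ∧ s' 35 0 = 2 ^ (s' 36 0) ∧ s' 36 0 ≤ Nat.size n ∧ (s' 36 0 = i ∨ n < s' 35 0) ∧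
    ∀ b, b ≠ 25 → b ≠ 35 → b ≠ 36 → s' b = s b) hn ?_ ?_ ?_) ?_))).mono (by omega)
  · refine ⟨by simp, by simp [Expr.eval], by simp [Expr.eval], by simp [Expr.eval],
      fun b h1 h2 h3 => by simp [h1, h2, h3]⟩
  · rintro i - s' ⟨h1, h2, h3, h4, h5⟩
    exact ⟨h1, by simp [Expr.eval, h5 0, h0]⟩
  · rintro i hi s' ⟨h1, h2, h3, h4, h5⟩
    have h0' : s' 0 0 = n := by rw [h5 0 (by simp) (by simp) (by simp), h0]
    refine (Sim.ite (t := 3) (fun he => Sim.set_seq (Det.set ?_)) fun he =>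
      (Det.skip ?_).mono (by omega))
    · simp only [Expr.eval, h0'] at he ⊢
      refine ⟨by simp [h1], by simp, ?_, ?_, ?_, fun b g1 g2 g3 => by simp [g1, g2, g3, h5 b g1 g2 g3]⟩
      · simp [h2, pow_succ]; ring
      · have : s' 36 0 < Nat.size n := Nat.lt_size.2 (by omega)
        simpa using this
      · left
        simp
        omega
    · simp only [Expr.eval, h0'] at he ⊢
      refine ⟨h1, by simp, by simpa using h2, by simpa using h3, ?_,
        fun b g1 g2 g3 => by simp [g1, h5 b g1 g2 g3]⟩
      right
      simp
      omega
  · rintro s' ⟨h1, h2, h3, h4, h5⟩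
    refine ⟨le_antisymm h3 ?_, h5⟩
    rcases h4 with h4 | h4
    · rw [h4]; exact size_le_self n
    · rw [Nat.size_le, ← h2]; exact h4

/-- Test if the total correlation exceeds `m * m + m * (n * 2 ^ K)`; the result is in register
34. -/
def testProg : Prog :=
  .seq corrProg (.seq (powProg 33 nE (.const 2) kE) (.seq (powProg 32 (.add mE (V 33)) mE (.const 1))
    (asg 34 (.sub (V 29) (V 32)))))

lemma det_testProg {n K m B : ℕ} {J : KFormula n K m} {s : Memory}
    (hs : s 0 = arrayOf (encodeFormula J)) (hK : K ≤ B) (hm : m ≤ B) (hB : 2 ≤ B) :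
    Det testProg s (B * (B * (B * 6 + 12) + 12) + 2 * (B * (B * 4 + 10)) + 21) fun s' =>
      s' 34 0 = corr J - (m + n * 2 ^ K) * m ∧
      ∀ b, b ≠ 7 → b ≠ 8 → b ≠ 9 → (b < 25 ∨ 35 ≤ b) → s' b = s b := by
  have f0 : s 0 0 = n := by rw [hs, encode_zero]
  have f1 : s 0 1 = K := by rw [hs, encode_one]
  have f2 : s 0 2 = m := by rw [hs, encode_two]
  refine (Det.seq (det_corrProg hs hK hm) fun s₁ h₁ => Det.seq
    (det_powProg (a := n) (b := 2) (c := K) (B := B) (by simp) (by simp) (by simp) ?_ ?_ ?_ hB hK)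
    fun s₂ h₂ => Det.seq
    (det_powProg (a := m + n * 2 ^ K) (b := m) (c := 1) (B := B) (by simp) (by simp) (by simp)
      ?_ ?_ ?_ hm (by omega)) fun s₃ h₃ => Det.set ?_).mono (by omega)
  · simp [Expr.eval, h₁.2 0, f0]
  · intro s' _; rfl
  · intro s' h'
    simp [Expr.eval, h' 0, h₁.2 0, f1]
  · simp [Expr.eval, h₂.1, h₂.2 0, h₁.2 0, f2]
  · intro s' h'
    simp [Expr.eval, h' 0, h₂.2 0, h₁.2 0, f2]
  · intro s' _; rfl
  · refine ⟨?_, fun b k1 k2 k3 k4 => ?_⟩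
    · simp [Expr.eval, h₃.1, h₃.2 29, h₂.2 29, h₁.1]
    · rw [store_ne _ _ _ (by omega), h₃.2 b (by omega) k1 k2 k3, h₂.2 b (by omega) k1 k2 k3,
        h₁.2 b (by omega)]

/-- Compute the parameters of the reduction: the degree `d = A * l ^ a`, the number of blocks
`q = B * l ^ b`, the dimension `N = q * (2 * n + 1) ^ d`, and `N ^ κ`, `N ^ (2 * κ)`,
`N ^ (3 * κ)`. -/
def paramProg (cA a cB b κ : ℕ) : Prog :=
  .seq sizeProg (.seq (powProg 1 (.const cA) (V 36) (.const a))
    (.seq (powProg 2 (.const cB) (V 36) (.const b))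
    (.seq (powProg 3 (V 2) (.add (.add nE nE) (.const 1)) (V 1))
    (.seq (powProg 4 (.const 1) (V 3) (.const κ))
    (.seq (powProg 5 (.const 1) (V 4) (.const 2)) (powProg 6 (V 5) (V 4) (.const 1)))))))

lemma det_paramProg {n B cA a cB b κ d q N W : ℕ} {s : Memory} (h0 : s 0 0 = n)
    (hd : cA * Nat.size n ^ a = d) (hq : cB * Nat.size n ^ b = q) (hN : q * (n + n + 1) ^ d = N)
    (hW : N ^ κ = W) (hn : n + n + 1 ≤ B) (ha : a ≤ B) (hb : b ≤ B) (hdB : d ≤ B) (hNB : N ≤ B)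
    (hκ : κ ≤ B) (hWB : W ≤ B) (hB : 2 ≤ B) :
    Det (paramProg cA a cB b κ) s (6 * (B * (B * 4 + 10)) + B * 7 + 43) fun s' =>
      s' 1 0 = d ∧ s' 2 0 = q ∧ s' 3 0 = N ∧ s' 4 0 = W ∧ s' 5 0 = W ^ 2 ∧ s' 6 0 = W ^ 3 ∧
      ∀ x, (10 ≤ x ∨ x = 0) → x ≠ 25 → x ≠ 35 → x ≠ 36 → s' x = s x := by
  have hl : Nat.size n ≤ B := (size_le_self n).trans (by omega)
  refine (Det.seq (det_sizeProg (B := B) h0 (by omega)) fun s₁ h₁ => Det.seq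
    (det_powProg (B := B) (a := cA) (b := Nat.size n) (c := a) (by simp) (by simp) (by simp) rfl
      ?_ (fun _ _ => rfl) hl ha) fun s₂ h₂ => Det.seq
    (det_powProg (B := B) (a := cB) (b := Nat.size n) (c := b) (by simp) (by simp) (by simp) rfl
      ?_ (fun _ _ => rfl) hl hb) fun s₃ h₃ => Det.seq
    (det_powProg (B := B) (a := q) (b := n + n + 1) (c := d) (by simp) (by simp) (by simp) ?_ ?_ ?_
      hn hdB) fun s₄ h₄ => Det.seq
    (det_powProg (B := B) (a := 1) (b := N) (c := κ) (by simp) (by simp) (by simp) rfl ?_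
      (fun _ _ => rfl) hNB hκ) fun s₅ h₅ => Det.seq
    (det_powProg (B := B) (a := 1) (b := W) (c := 2) (by simp) (by simp) (by simp) rfl ?_
      (fun _ _ => rfl) hWB hB) fun s₆ h₆ => Det.conseq
    (det_powProg (B := B) (a := W ^ 2) (b := W) (c := 1) (by simp) (by simp) (by simp) ?_ ?_
      (fun _ _ => rfl) hWB (by omega)) fun s₇ h₇ => ?_).mono (by omega)
  · intro s' h'; simp [Expr.eval, h' 36, h₁.1]
  · intro s' h'; simp [Expr.eval, h' 36, h₂.2 36, h₁.1]
  · simp [Expr.eval, h₃.1, hq]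
  · intro s' h'; simp [Expr.eval, h' 0, h₃.2 0, h₂.2 0, h₁.2 0, h0]
  · intro s' h'; simp [Expr.eval, h' 1, h₃.2 1, h₂.1, hd]
  · intro s' h'; simp [Expr.eval, h' 3, h₄.1, hN]
  · intro s' h'; simp [Expr.eval, h' 4, h₅.1, hW]
  · simp [Expr.eval, h₆.1]
  · intro s' h'; simp [Expr.eval, h' 4, h₆.2 4, h₅.1, hW]
  · refine ⟨?_, ?_, ?_, ?_, ?_, ?_, fun x k1 k2 k3 k4 => ?_⟩
    · simp [h₇.2 1, h₆.2 1, h₅.2 1, h₄.2 1, h₃.2 1, h₂.1, hd]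
    · simp [h₇.2 2, h₆.2 2, h₅.2 2, h₄.2 2, h₃.1, hq]
    · simp [h₇.2 3, h₆.2 3, h₅.2 3, h₄.1, hN]
    · simp [h₇.2 4, h₆.2 4, h₅.1, hW]
    · simp [h₇.2 5, h₆.1]
    · rw [h₇.1]; ring
    · rw [h₇.2 x (by omega) (by omega) (by omega) (by omega), h₆.2 x (by omega) (by omega)
        (by omega) (by omega), h₅.2 x (by omega) (by omega) (by omega) (by omega), h₄.2 x (by omega)
        (by omega) (by omega) (by omega), h₃.2 x (by omega) (by omega) (by omega) (by omega),
        h₂.2 x (by omega) (by omega) (by omega) (by omega), h₁.2 x k2 k3 k4]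

/-! ### The distinguishing program -/

lemma length_out_le {O : PMF (List ℕ)} {c : Config} (t : ℕ) :
    ∀ c' ∈ (stepsFrom O c t).support, c'.out.length ≤ c.out.length + t := by
  have hstep : ∀ c : Config, ∀ c' ∈ (step O c).support, c'.out.length ≤ c.out.length + 1 := by
    rintro ⟨_ | ⟨P, k⟩, s, o⟩ c' hc'
    · simp only [step, PMF.mem_support_pure_iff] at hc'
      simp [hc']
    · cases P <;> simp only [step, PMF.mem_support_pure_iff, PMF.mem_support_map_iff] at hc'
      case flip => obtain ⟨a, -, rfl⟩ := hc'; simp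
      case sample => obtain ⟨a, -, rfl⟩ := hc'; simp
      all_goals simp [hc']
  induction t with
  | zero => simp [stepsFrom]
  | succ t ih =>
    intro c' hc'
    rw [stepsFrom, PMF.mem_support_bind_iff] at hc'
    obtain ⟨c'', h1, h2⟩ := hc'
    have := ih c'' h1
    have := hstep c'' c' h2
    omega

lemma length_output_le {O : PMF (List ℕ)} {P : Prog} {l : List ℕ} {t : ℕ} {z : List ℕ}
    (hz : z ∈ (output O P l t).support) : z.length ≤ t := by
  rw [output, run_eq_stepsFrom, PMF.mem_support_map_iff] at hz
  obtain ⟨c, hc, rfl⟩ := hz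
  simpa [initial] using length_out_le t c hc

lemma length_of_mem_iid {α : Type} {p : PMF α} {k : ℕ} {l : List α}
    (hl : l ∈ (iid p k).support) : l.length = k := by
  induction k generalizing l with
  | zero =>
    simp only [iid, iter, PMF.mem_support_pure_iff] at hl
    simp [hl]
  | succ k ih =>
    simp only [iid, iter, PMF.mem_support_bind_iff, PMF.mem_support_map_iff] at hl
    obtain ⟨l', hl', a, -, rfl⟩ := hl
    simp [ih hl']

lemma length_of_mem_exampleLaw {n K m d q : ℕ} [NeZero m] {J : KFormula n K m} {l : List ℕ}
    (hl : l ∈ (exampleLaw J d q).support) : l.length = q * (n + n + 1) ^ d + 1 := by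
  simp only [exampleLaw, PMF.mem_support_bind_iff, PMF.mem_support_map_iff] at hl
  obtain ⟨y, -, idx, hidx, rfl⟩ := hl
  have := length_of_mem_iid hidx
  simp [List.length_flatMap, length_block, this]

/-- Beyond the indices in use, the inner memory is empty. -/
def Fresh (s : Memory) : Prop := ∀ a, 50 ≤ a → ∀ i, s 48 0 + s 49 0 ≤ i → s a i = 0

lemma Represents.fresh {u v : ℕ} {F : Set ℕ} {s₀ mem s : Memory} {out : List ℕ}
    (h : Represents u v F s₀ mem out s) : Fresh s := by
  intro a ha i hi
  rw [h.base] at hi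
  obtain ⟨b, rfl⟩ : ∃ b, a = b + 50 := ⟨a - 50, by omega⟩
  obtain ⟨j, rfl⟩ : ∃ j, i = s₀ 48 0 + j := ⟨i - s₀ 48 0, by omega⟩
  rw [h.mem_eq, h.zero _ _ (by omega)]

/-- The sampling instruction of the simulated learner. -/
def learnSampler (a : ℕ) : Prog :=
  .seq (sampleProg (a + 50) (V 48)) (asg 49 (.add (V 49) (.add (V 3) (.const 1))))

/-- Run the learner; the description is stored in array 41, and its length in register 42. -/
def learnProg (L : Prog) : Prog :=
  .seq (asg 48 (.add (V 48) (V 49))) (.seq (asg 42 (.const 0)) (.seq (.set 50 (V 48) (V 3))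
    (.seq (asg 49 (.const 1)) (L.tr learnSampler 41 42))))

/-- The parameters stored in a memory. -/
structure Params {n K m : ℕ} (J : KFormula n K m) (d q N M' M : ℕ) (s : Memory) : Prop where
  input : s 0 = arrayOf (encodeFormula J)
  d_eq : s 1 0 = d
  q_eq : s 2 0 = q
  N_eq : s 3 0 = N
  M'_eq : s 5 0 = M'
  M_eq : s 6 0 = M

lemma Params.congr {n K m : ℕ} {J : KFormula n K m} {d q N M' M : ℕ} {s s' : Memory}
    (h : Params J d q N M' M s) (hs : ∀ b < 7, s' b = s b) : Params J d q N M' M s' where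
  input := by rw [hs 0 (by simp), h.input]
  d_eq := by rw [hs 1 (by simp), h.d_eq]
  q_eq := by rw [hs 2 (by simp), h.q_eq]
  N_eq := by rw [hs 3 (by simp), h.N_eq]
  M'_eq := by rw [hs 5 (by simp), h.M'_eq]
  M_eq := by rw [hs 6 (by simp), h.M_eq]

/-- Bounds for the parameters. -/
structure Bounds (n K m d q N M tL tE B : ℕ) : Prop where
  n_le : n + n + 1 ≤ B
  K_le : K ≤ B
  m_le : m ≤ B
  d_le : d ≤ B
  q_le : q ≤ B
  N_eq : q * (n + n + 1) ^ d = N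
  N_le : N ≤ B
  q_pos : 0 < q
  M_le : M ≤ B
  tL_le : tL ≤ B
  tE_le : tE ≤ B

lemma Bounds.pow_le {n K m d q N M tL tE B : ℕ} (h : Bounds n K m d q N M tL tE B) :
    (n + n + 1) ^ d ≤ B := by
  refine le_trans ?_ h.N_le
  rw [← h.N_eq]
  exact Nat.le_mul_of_pos_left _ h.q_pos

section Trial

variable {n K m d q N M' M tL tE B : ℕ} [NeZero m] {J : KFormula n K m} {L E : Prog}

lemma sim_learnProg (hB : Bounds n K m d q N M tL tE B)
    (hL : HaltsWithin (exampleLaw J d q) L [N] tL) {s : Memory} (hs : Params J d q N M' M s)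
    (hf : Fresh s) :
    Sim (learnProg L) s (B * (sampleTime B + 6) + 8) (output (exampleLaw J d q) L [N] tL)
      fun z s' => s' 42 0 = z.length ∧ (∀ i < z.length, s' 41 i = z.getD i 0) ∧ Fresh s' ∧
        ∀ b, b < 10 ∨ 25 ≤ b ∧ b < 48 → b ≠ 41 → b ≠ 42 → s' b = s b := by
  set F : Set ℕ := {b | (b < 10 ∨ 25 ≤ b) ∧ b < 48 ∧ b ≠ 41 ∧ b ≠ 42} with hF
  set s₀ := (((s.store 48 0 (s 48 0 + s 49 0)).store 42 0 0).store 50 (s 48 0 + s 49 0) N).store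
    49 0 1 with hs₀
  have h0 : s₀ 48 0 = s 48 0 + s 49 0 := by simp [hs₀]
  have hp : Params J d q N M' M s₀ := hs.congr fun b hb => by
    rw [hs₀, store_ne _ _ _ (by omega), store_ne _ _ _ (by omega), store_ne _ _ _ (by omega),
      store_ne _ _ _ (by omega)]
  have hS : Samples learnSampler 41 42 F s₀ (exampleLaw J d q) (sampleTime B + 2) := by
    intro a s₁ h1 h2
    have hp₁ : Params J d q N M' M s₁ := hp.congr fun b hb => h1 b ⟨by omega, by omega, by omega,
      by omega⟩
    refine Sim.seq_det (t₂ := 1) (sim_sampleProg (B := B) (w := s₀ 48 0) (by omega) hp₁.input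
      hp₁.d_eq hp₁.q_eq ?_
      (by have := hB.n_le; omega) hB.K_le hB.m_le hB.d_le hB.q_le hB.pow_le) ?_
    · intro s' h'
      simp [Expr.eval, h' 48, h2]
    · rintro l hl s₂ ⟨h3, h4⟩
      have hlen := length_of_mem_exampleLaw hl
      rw [hB.N_eq] at hlen
      have h3' : s₂ 3 0 = N := by rw [h4 3 (by simp) (by omega), hp₁.N_eq]
      have h49 : s₂ 49 0 = s₁ 49 0 := by rw [h4 49 (by simp) (by omega)]
      refine Det.set ?_
      simp only [Expr.eval, h3', h49]
      refine ⟨fun i => ?_, fun b h5 h6 => ?_, ?_, by simp, by simp; omega, ?_, ?_, fun b hb => ?_⟩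
      · rw [store_ne _ _ _ (by omega), h3]
        simp [overwrite]
      · rw [store_ne _ _ _ (by omega), h4 b (by omega) h6]
      · rw [store_ne _ _ _ (by omega), h4 48 (by omega) (by omega), h2]
      · rw [store_ne _ _ _ (by omega), h4 41 (by omega) (by omega)]
      · rw [store_ne _ _ _ (by omega), h4 42 (by omega) (by omega)]
      · obtain ⟨g1, g2, g3, g4⟩ := hb
        rw [store_ne _ _ _ (by omega), h4 b (by omega) (by omega)]
  have hrep : Represents 41 42 F s₀ (Function.update 0 0 (arrayOf [N])) [] s₀ := by
    refine ⟨fun a i => ?_, fun a i hi => ?_, rfl, by simp, by simp [hs₀], fun b _ => rfl⟩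
    · rw [h0]
      by_cases ha : a = 0
      · subst ha
        rw [hs₀, store_ne _ _ _ (by simp), store_same, store_ne _ _ _ (by simp),
          store_ne _ _ _ (by simp)]
        by_cases hi : i = 0
        · simp [hi, arrayOf]
        · have := hf 50 (by simp) (s 48 0 + s 49 0 + i) (by omega)
          simp [this, arrayOf, hi]
      · rw [hs₀, store_ne _ _ _ (by omega), store_ne _ _ _ (by omega), store_ne _ _ _ (by omega),
          store_ne _ _ _ (by omega), hf _ (by omega) _ (by omega)]
        simp [ha]
    · simp [hs₀] at hi
      by_cases ha : a = 0
      · subst ha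
        simp [arrayOf, show i ≠ 0 by omega]
      · simp [ha]
  have key := Sim.tr hS (by simp) (by simp) (by simp) (fun b hb => ⟨hb.2.1, hb.2.2.1, hb.2.2.2⟩)
    hL hrep
  refine (Sim.set_seq (Sim.set_seq (Sim.set_seq (Sim.set_seq (Sim.conseq (R := fun z s' =>
    ∃ mem, Represents 41 42 F s₀ mem z s') (t := tL * (sampleTime B + 2 + 4)) ?_ ?_))))).mono ?_
  · have e : (((s.store 48 ((Expr.const 0).eval s) (Expr.eval s (.add (V 48) (V 49)))).store 42 0
        0).store 50 (s 48 0 + s 49 0) (s 3 0)).store 49 0 1 = s₀ := by rw [hs₀, hs.N_eq]; rfl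
    simp only [Expr.eval] at e ⊢
    simp only [store_ne _ _ _ (show (48 : ℕ) ≠ 42 by simp), store_same, Function.update_self,
      store_ne _ _ _ (show (3 : ℕ) ≠ 42 by simp), store_ne _ _ _ (show (3 : ℕ) ≠ 48 by simp)]
    rw [e]
    exact key
  · rintro z - s' ⟨mem, h⟩
    refine ⟨h.len, h.out_eq, h.fresh, fun b hb h1 h2 => ?_⟩
    rw [h.frame b ⟨by omega, by omega, h1, h2⟩, hs₀, store_ne _ _ _ (by omega),
      store_ne _ _ _ (by omega), store_ne _ _ _ (by omega), store_ne _ _ _ (by omega)]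
  · have : tL * (sampleTime B + 2 + 4) ≤ B * (sampleTime B + 6) :=
      Nat.mul_le_mul_right _ hB.tL_le
    omega

/-- The query for the evaluation of the classifier with description `z` at the example `l`. -/
def queryOf (N : ℕ) (z l : List ℕ) : List ℕ := N :: (l.take N ++ z.length :: z)

lemma query_get {f : ℕ → ℕ} {w N : ℕ} {z l : List ℕ} (hf : ∀ i, w ≤ i → f i = 0)
    (hl : l.length = N + 1) (i : ℕ) :
    overwrite (Function.update (Function.update (overwrite f (w + 1) l) w N) (w + N + 1) z.length)
      (w + N + 2) z (w + i) = (queryOf N z l).getD i 0 := by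
  rw [queryOf]
  rcases Nat.eq_zero_or_pos i with rfl | hi
  · rw [overwrite, if_pos (by omega), Function.update_apply, if_neg (by omega)]
    simp
  obtain ⟨i, rfl⟩ : ∃ j, i = j + 1 := ⟨i - 1, by omega⟩
  rw [List.getD_cons_succ]
  have hlen : (List.take N l).length = N := by simp [hl]
  rcases lt_trichotomy i N with h | rfl | h
  · rw [List.getD_append _ _ _ _ (by omega), overwrite, if_pos (by omega), Function.update_apply,
      if_neg (by omega), Function.update_apply, if_neg (by omega)]
    rw [show w + (i + 1) = w + 1 + i by ring, overwrite_get _ _ _ (by omega) 0]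
    rw [List.getD_eq_getElem _ _ (by omega), List.getD_eq_getElem _ _ (by omega),
      List.getElem_take]
  · rw [List.getD_append_right _ _ _ _ (by omega), hlen, overwrite, if_pos (by omega)]
    simp [← add_assoc]
  · rw [List.getD_append_right _ _ _ _ (by omega), hlen, overwrite, if_neg (by omega),
      show i - N = (i - N - 1) + 1 by omega, List.getD_cons_succ,
      show w + (i + 1) - (w + N + 2) = i - N - 1 by omega]
    congr 1
    rw [Function.update_apply, if_neg (by omega), Function.update_apply, if_neg (by omega),
      overwrite, if_neg (by omega), hf _ (by omega), List.getD_eq_default _ _ (by omega)]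

/-- Draw an example, whose label is stored in register 45, and evaluate the classifier with the
description in array 41; the result is stored in array 43. -/
def evalProg (E : Prog) : Prog :=
  .seq (asg 48 (.add (V 48) (V 49))) (.seq (sampleProg 50 (.add (V 48) (.const 1)))
    (.seq (asg 45 (.get 50 (.add (.add (V 48) (V 3)) (.const 1))))
    (.seq (.set 50 (V 48) (V 3)) (.seq (.set 50 (.add (.add (V 48) (V 3)) (.const 1)) (V 42))
    (.seq (forTo 46 (V 42)
      (.set 50 (.add (.add (.add (V 48) (V 3)) (.const 2)) (V 46)) (.get 41 (V 46))))
    (.seq (asg 49 (.add (.add (V 3) (.const 2)) (V 42))) (.seq (asg 44 (.const 0))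
    (E.tr (fun _ => .skip) 43 44))))))))

lemma sim_evalProg (hB : Bounds n K m d q N M tL tE B) {z : List ℕ} {ev : List ℕ → ℕ}
    (hz : z.length ≤ B)
    (hE : ∀ l ∈ (exampleLaw J d q).support, ∀ c ∈ (run noExamples E (queryOf N z l) tE).support,
      c.todo = [] ∧ c.out = [ev l]) {s : Memory} (hs : Params J d q N M' M s)
    (hf : Fresh s) (h42 : s 42 0 = z.length) (h41 : ∀ i < z.length, s 41 i = z.getD i 0) :
    Sim (evalProg E) s (sampleTime B + B * 9 + 20) (exampleLaw J d q) fun l s' =>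
      s' 43 0 = ev l ∧ s' 45 0 = l.getD N 0 ∧ Fresh s' ∧
        ∀ b, b < 10 ∨ 25 ≤ b ∧ b < 48 → b ≠ 43 → b ≠ 44 → b ≠ 45 → b ≠ 46 → s' b = s b := by
  set w := s 48 0 + s 49 0 with hw
  set s₁ := s.store 48 0 w with hs₁
  have hp₁ : Params J d q N M' M s₁ := hs.congr fun b hb => by
    rw [hs₁, store_ne _ _ _ (by omega)]
  refine (Sim.set_seq (Sim.seq_det (t₂ := B * 9 + 17) (sim_sampleProg (s := s₁) (B := B)
    (w := w + 1) (by simp) hp₁.input hp₁.d_eq hp₁.q_eq ?_ (by have := hB.n_le; omega) hB.K_le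
    hB.m_le hB.d_le hB.q_le hB.pow_le) ?_)).mono (by omega)
  · intro s' h'
    simp [Expr.eval, h' 48, hs₁]
  rintro l hl s₂ ⟨h1, h2⟩
  have hlen := length_of_mem_exampleLaw hl
  rw [hB.N_eq] at hlen
  have h48 : s₂ 48 0 = w := by rw [h2 48 (by simp) (by simp), hs₁]; simp
  have h3 : s₂ 3 0 = N := by rw [h2 3 (by simp) (by simp), hp₁.N_eq]
  have h42' : s₂ 42 0 = z.length := by
    rw [h2 42 (by simp) (by simp), hs₁, store_ne _ _ _ (by simp), h42]
  have h41' : ∀ i < z.length, s₂ 41 i = z.getD i 0 := by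
    rw [h2 41 (by simp) (by simp), hs₁, store_ne _ _ _ (by simp)]; exact h41
  have hf₁ : ∀ a, 50 ≤ a → ∀ i, w ≤ i → s₁ a i = 0 := by
    intro a ha i hi
    rw [hs₁, store_ne _ _ _ (by omega), hf a ha i hi]
  have hy : s₂ 50 (w + N + 1) = l.getD N 0 := by
    rw [h1, show w + N + 1 = w + 1 + N by ring, overwrite_get _ _ _ (by omega) 0]
  set G := Function.update (Function.update (overwrite (s₁ 50) (w + 1) l) w N) (w + N + 1)
    z.length with hG
  refine (Sim.set_seq (Sim.set_seq (Sim.set_seq (Det.seq (Det.forTo (n := z.length) (N := B)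
    (t := 1) (fun i s' => s' 46 0 = i ∧ s' 50 = overwrite G (w + N + 2) (z.take i) ∧
      s' 45 0 = l.getD N 0 ∧ ∀ b, b ≠ 45 → b ≠ 46 → b ≠ 50 → s' b = s₂ b) hz ?_ ?_ ?_)
      (t₂ := B * 5 + 4) ?_)))).mono (by omega)
  · simp only [Expr.eval, h48, h3, hy]
    refine ⟨by simp, ?_, by simp, fun b g1 g2 g3 => by simp [g1, g2, g3]⟩
    simp [h48, h42', h3, hG, overwrite_nil, ← h1]
  · rintro i - s' ⟨g1, g2, g3, g4⟩
    exact ⟨g1, by simp [Expr.eval, g4 42, h42']⟩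
  · rintro i hi s' ⟨g1, g2, g3, g4⟩
    refine Det.set ?_
    simp only [Expr.eval, g4 48 (by simp) (by simp) (by simp), g4 3 (by simp) (by simp) (by simp),
      g4 41 (by simp) (by simp) (by simp), h48, h3, g1, h41' i hi]
    refine ⟨by simp [g1], by simp, ?_, by simp [g3], fun b k1 k2 k3 => by
      simp [k2, k3, g4 b k1 k2 k3]⟩
    rw [store_ne _ _ _ (by simp), store_same, g2, List.take_succ_eq_append_getElem hi,
      ← update_overwrite, List.getD_eq_getElem _ _ hi]
    simp [hi.le]
  · rintro s₃ ⟨g1, g2, g3, g4⟩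
    rw [List.take_length] at g2
    set F : Set ℕ := {b | (b < 10 ∨ 25 ≤ b) ∧ b < 48 ∧ b ≠ 43 ∧ b ≠ 44} with hF
    set s₀ := (s₃.store 49 0 (N + 2 + z.length)).store 44 0 0 with hs₀
    have h0 : s₀ 48 0 = w := by simp [hs₀, g4 48, h48]
    have hrep : Represents 43 44 F s₀ (Function.update 0 0 (arrayOf (queryOf N z l))) [] s₀ := by
      refine ⟨fun a i => ?_, fun a i hi => ?_, rfl, by simp, by simp [hs₀], fun b _ => rfl⟩
      · rw [h0]
        by_cases ha : a = 0
        · subst ha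
          rw [hs₀, store_ne _ _ _ (by simp), store_ne _ _ _ (by simp), g2,
            query_get (hf₁ 50 (by simp)) hlen]
          simp [arrayOf]
        · rw [hs₀, store_ne _ _ _ (by omega), store_ne _ _ _ (by omega), g4 _ (by omega)
            (by omega) (by omega), h2 _ (by omega) (by omega), hf₁ _ (by omega) _ (by omega)]
          simp [ha]
      · by_cases ha : a = 0
        · subst ha
          simp only [Function.update_self, arrayOf]
          rw [List.getD_eq_default]
          simp [hs₀] at hi
          simp [queryOf, hlen]
          omega
        · simp [ha]
    have hS : Samples (fun _ => Prog.skip) 43 44 F s₀ noExamples 1 := by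
      intro a s' k1 k2
      have h := Sim.map (f := fun _ : Unit => ([] : List ℕ))
        (R' := fun l s'' => l = [] ∧ s'' = s') (Det.skip (I := fun s'' => s'' = s') rfl)
        fun _ _ s'' h => ⟨rfl, h⟩
      rw [PMF.pure_map] at h
      refine Sim.conseq h ?_
      rintro l - s'' ⟨rfl, rfl⟩
      simp [k2]
    have key := Sim.tr (P := E) (t := tE) hS (by simp) (by simp) (by simp)
      (fun b hb => ⟨hb.2.1, hb.2.2.1, hb.2.2.2⟩) (fun c hc => (hE l hl c hc).1) hrep
    have key' := Sim.map (f := fun _ => ()) (R' := fun _ s' => s' 43 0 = ev l ∧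
      s' 45 0 = l.getD N 0 ∧ Fresh s' ∧
        ∀ b, b < 10 ∨ 25 ≤ b ∧ b < 48 → b ≠ 43 → b ≠ 44 → b ≠ 45 → b ≠ 46 → s' b = s b) key ?_
    · rw [show (fun _ : List ℕ => ()) = Function.const _ () from rfl, PMF.map_const] at key'
      refine (Sim.set_seq (Sim.set_seq (t := tE * (1 + 4)) ?_)).mono
        (by have := hB.tE_le; omega)
      have e : (s₃.store 49 ((Expr.const 0).eval s₃) (Expr.eval s₃ (.add (.add (V 3) (.const 2))
          (V 42)))).store 44 0 0 = s₀ := by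
        simp [hs₀, Expr.eval, g4 3, g4 42, h3, h42']
      simp only [Expr.eval] at e ⊢
      rw [e]
      exact key'
    · rintro o ho s' ⟨mem, h⟩
      have hos : o = [ev l] := by
        rw [output, PMF.mem_support_map_iff] at ho
        obtain ⟨c, hc, rfl⟩ := ho
        exact (hE l hl c hc).2
      subst hos
      refine ⟨by simpa using h.out_eq 0 (by simp), ?_, h.fresh, fun b k1 k2 k3 k4 k5 => ?_⟩
      · rw [h.frame 45 ⟨by simp, by simp, by simp, by simp⟩]
        simp [hs₀, g3]
      · rw [h.frame b ⟨by omega, by omega, k2, k3⟩, hs₀, store_ne _ _ _ (by omega),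
          store_ne _ _ _ (by omega), g4 b k4 k5 (by omega), h2 b (by omega) (by omega), hs₁,
          store_ne _ _ _ (by omega)]

end Trial

/-- The number of errors on a list of examples, if `ev` gives the predictions. -/
def errCount (ev : List ℕ → ℕ) (N : ℕ) (τ : List (List ℕ)) : ℕ :=
  τ.countP fun l => decide (ev l ≠ l.getD N 0)

/-- The law of the outcome of one trial: learn, and test the hypothesis on fresh examples. -/
def trialLaw (O : PMF (List ℕ)) (L : Prog) (N tL M' M : ℕ) (ev : List ℕ → List ℕ → ℕ) : PMF Bool :=
  (output O L [N] tL).bind fun z =>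
    (iid O M).map fun τ => decide (2 * errCount (ev z) N τ + M' ≤ M)

/-- Learn, and test the hypothesis; if the test is passed, set register 38 to 1. -/
def trialProg (L E : Prog) : Prog :=
  .seq (learnProg L) (.seq (asg 40 (.const 0)) (.seq
    (forTo 39 (V 6) (.seq (evalProg E) (.ite ((V 43).dist (V 45)) (asg 40 (.add (V 40) (.const 1)))
      .skip)))
    (.ite (.sub (.add (.add (V 40) (V 40)) (V 5)) (V 6)) .skip (asg 38 (.const 1)))))

/-- Time bound for `trialProg`. -/
def trialTime (B : ℕ) : ℕ :=
  B * (sampleTime B + 6) + B * (sampleTime B + B * 9 + 26) + 20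

section Program

variable {n K m d q N M' M tL tE B : ℕ} [NeZero m] {J : KFormula n K m} {L E : Prog}

lemma sim_trialProg (hB : Bounds n K m d q N M tL tE B)
    (hL : HaltsWithin (exampleLaw J d q) L [N] tL) {ev : List ℕ → List ℕ → ℕ}
    (hE : ∀ z ∈ (output (exampleLaw J d q) L [N] tL).support, ∀ l ∈ (exampleLaw J d q).support,
      ∀ c ∈ (run noExamples E (queryOf N z l) tE).support, c.todo = [] ∧ c.out = [ev z l])
    {s : Memory} (hs : Params J d q N M' M s) (hf : Fresh s) :
    Sim (trialProg L E) s (trialTime B) (trialLaw (exampleLaw J d q) L N tL M' M ev) fun b s' =>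
      s' 38 0 = (if b then 1 else s 38 0) ∧ s' 37 = s 37 ∧ Params J d q N M' M s' ∧ Fresh s' := by
  refine (Sim.seq (sim_learnProg hB hL hs hf) (t₂ := B * (sampleTime B + B * 9 + 26) + 11)
    ?_).mono (by unfold trialTime; omega)
  rintro z hz s₁ ⟨h1, h2, h3, h4⟩
  have hzB : z.length ≤ B := (length_output_le hz).trans hB.tL_le
  refine (Sim.set_seq (t := B * (sampleTime B + B * 9 + 23 + 3) + 7) (Sim.map (Sim.seq_det
    (t₁ := B * (sampleTime B + B * 9 + 23 + 3) + 3)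
    (t₂ := 3) (Sim.forTo (n := M) (N := B)
    (t := sampleTime B + B * 9 + 23)
    (κ := fun τ => (exampleLaw J d q).map fun l => τ ++ [l]) (a := []) (fun i τ s' => s' 39 0 = i ∧
      s' 40 0 = errCount (ev z) N τ ∧ Fresh s' ∧ (∀ b, b < 10 ∨ 25 ≤ b ∧ b < 48 → b ≠ 39 → b ≠ 40 →
        b ≠ 43 → b ≠ 44 → b ≠ 45 → b ≠ 46 → s' b = s₁ b)) hB.M_le ?_ ?_ ?_)
    (R₂ := fun τ s' => s' 38 0 = (if 2 * errCount (ev z) N τ + M' ≤ M then 1 else s 38 0) ∧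
      s' 37 = s 37 ∧ Params J d q N M' M s' ∧ Fresh s') ?_) ?_)).mono ?_
  · refine ⟨by simp, by simp [Expr.eval, errCount], ?_, fun b k1 k2 k3 _ _ _ _ => by
      simp [k2, k3]⟩
    intro a ha i hi
    rw [store_ne _ _ _ (by omega), store_ne _ _ _ (by omega)] at hi ⊢
    rw [store_ne _ _ _ (by omega), store_ne _ _ _ (by omega)] at hi
    exact h3 a ha i hi
  · rintro i - τ s' ⟨k1, k2, k3, k4⟩
    have : s' 6 0 = M := by
      rw [k4 6 (by simp) (by simp) (by simp) (by simp) (by simp) (by simp) (by simp),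
        h4 6 (by simp) (by simp) (by simp), hs.M_eq]
    exact ⟨k1, by simp [Expr.eval, this]⟩
  · rintro i hi τ s₂ ⟨k1, k2, k3, k4⟩
    have hp : Params J d q N M' M s₂ := hs.congr fun b hb => by
      rw [k4 b (by omega) (by omega) (by omega) (by omega) (by omega) (by omega) (by omega),
        h4 b (by omega) (by omega) (by omega)]
    have h42 : s₂ 42 0 = z.length := by
      rw [k4 42 (by simp) (by simp) (by simp) (by simp) (by simp) (by simp) (by simp), h1]
    have h41 : ∀ i < z.length, s₂ 41 i = z.getD i 0 := by
      rw [k4 41 (by simp) (by simp) (by simp) (by simp) (by simp) (by simp) (by simp)]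
      exact h2
    refine (Sim.map (Sim.seq_det (t₂ := 2) (sim_evalProg (ev := ev z) hB hzB (hE z hz) hp k3 h42
      h41) (R₂ := fun l s' => s' 39 0 = i ∧ s' 40 0 = errCount (ev z) N (τ ++ [l]) ∧ Fresh s' ∧
      (∀ b, b < 10 ∨ 25 ≤ b ∧ b < 48 → b ≠ 39 → b ≠ 40 →
        b ≠ 43 → b ≠ 44 → b ≠ 45 → b ≠ 46 → s' b = s₁ b)) ?_) ?_).mono (by omega)
    · rintro l - s₃ ⟨e1, e2, e3, e4⟩
      have e39 : s₃ 39 0 = i := by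
        rw [e4 39 (by simp) (by simp) (by simp) (by simp) (by simp), k1]
      have e40 : s₃ 40 0 = errCount (ev z) N τ := by
        rw [e4 40 (by simp) (by simp) (by simp) (by simp) (by simp), k2]
      refine Sim.ite (t := 1) (fun he => Det.set ?_) (fun he => Det.skip ?_)
      · rw [Ne, Expr.eval_dist_eq_zero] at he
        simp only [Expr.eval, e1, e2] at he
        refine ⟨by simp [e39], ?_, ?_, fun b g1 g2 g3 g4 g5 g6 g7 => ?_⟩
        · simp only [Expr.eval, e40, errCount, List.countP_append]
          simp only [store_same, Function.update_self, List.countP_singleton, ne_eq, he,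
            not_false_eq_true, decide_true, if_true]
        · intro a ha i hi
          rw [store_ne _ _ _ (by omega), store_ne _ _ _ (by omega)] at hi
          rw [store_ne _ _ _ (by omega)]
          exact e3 a ha i hi
        · rw [store_ne _ _ _ g3, e4 b g1 g4 g5 g6 g7, k4 b g1 g2 g3 g4 g5 g6 g7]
      · rw [Expr.eval_dist_eq_zero] at he
        simp only [Expr.eval, e1, e2] at he
        refine ⟨e39, ?_, e3, fun b g1 g2 g3 g4 g5 g6 g7 => ?_⟩
        · simp only [e40, errCount, List.countP_append, List.countP_singleton]
          simp [he]
        · rw [e4 b g1 g4 g5 g6 g7, k4 b g1 g2 g3 g4 g5 g6 g7]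
    · rintro l - s₃ ⟨e1, e2, e3, e4⟩
      refine ⟨e1, by simp, by simp [e2], ?_, fun b g1 g2 g3 g4 g5 g6 g7 => by
        simp [g2, e4 b g1 g2 g3 g4 g5 g6 g7]⟩
      intro a ha i hi
      rw [store_ne _ _ _ (by omega), store_ne _ _ _ (by omega)] at hi
      rw [store_ne _ _ _ (by omega)]
      exact e3 a ha i hi
  · rintro τ - s₂ ⟨k1, k2, k3, k4⟩
    have hk : ∀ b < 7, s₂ b = s b := fun b hb => by
      rw [k4 b (by omega) (by omega) (by omega) (by omega) (by omega) (by omega) (by omega),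
        h4 b (by omega) (by omega) (by omega)]
    have hp : Params J d q N M' M s₂ := hs.congr hk
    have e37 : s₂ 37 = s 37 := by
      rw [k4 37 (by simp) (by simp) (by simp) (by simp) (by simp) (by simp) (by simp),
        h4 37 (by simp) (by simp) (by simp)]
    have e38 : s₂ 38 = s 38 := by
      rw [k4 38 (by simp) (by simp) (by simp) (by simp) (by simp) (by simp) (by simp),
        h4 38 (by simp) (by simp) (by simp)]
    refine (Sim.ite (t := 1) (fun he => Det.skip ?_) (fun he => Det.set ?_)).mono (by omega)
    · simp only [Expr.eval, k2, hp.M'_eq, hp.M_eq] at he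
      refine ⟨?_, e37, hp, k3⟩
      rw [if_neg (by omega), e38]
    · simp only [Expr.eval, k2, hp.M'_eq, hp.M_eq] at he
      refine ⟨?_, by simp [e37], hp.congr fun b hb => by rw [store_ne _ _ _ (by omega)], ?_⟩
      · rw [if_pos (by omega)]
        simp [Expr.eval]
      · intro a ha i hi
        rw [store_ne _ _ _ (by omega), store_ne _ _ _ (by omega)] at hi
        rw [store_ne _ _ _ (by omega)]
        exact k3 a ha i hi
  · rintro τ - s' h
    simpa using h
  · have : sampleTime B + B * 9 + 23 + 3 = sampleTime B + B * 9 + 26 := rfl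
    rw [this]
    omega

/-- The law of the outcome of `R` trials. -/
def trialsLaw (p : PMF Bool) (R : ℕ) : PMF Bool :=
  iter (fun b => p.map fun b' => b || b') R false

/-- The main part of the distinguishing program. -/
def coreProg (L E : Prog) (cA a cB b κ R : ℕ) : Prog :=
  .seq (paramProg cA a cB b κ) (forTo 37 (.const R) (trialProg L E))

/-- The distinguishing program. -/
def mainProg (L E : Prog) (n₀ cA a cB b κ R : ℕ) : Prog :=
  .ite (.sub (.add nE (.const 1)) (.const n₀))
    (.seq testProg (.ite (V 34) (.emit (.const 1))
      (.seq (coreProg L E cA a cB b κ R) (.emit (V 38)))))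
    (.emit (.const 1))

/-- Time bound for `mainProg`. -/
def mainTime (B : ℕ) : ℕ :=
  B * (trialTime B + 3) + B * (B * (B * 6 + 12) + 12) + 8 * (B * (B * 4 + 10)) + B * 7 + 90

lemma final_emit (e : Expr) (s : Memory) :
    Final ⟨[.emit e], s, []⟩ 1 (PMF.pure [e.eval s]) :=
  final_step_pure (c' := ⟨[], s, [e.eval s]⟩) rfl (final_halted s _)

lemma final_mainProg_small {n₀ cA a cB b κ R : ℕ} {n K m : ℕ} (J : KFormula n K m) (hn : n < n₀) :
    Final (initial (mainProg L E n₀ cA a cB b κ R) (encodeFormula J)) 2 (PMF.pure [1]) := by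
  set s₀ : Memory := Function.update 0 0 (arrayOf (encodeFormula J)) with hs₀
  refine final_step_pure (c' := ⟨[.emit (.const 1)], s₀, []⟩) ?_ (final_emit _ _)
  have : (Expr.sub (.add nE (.const 1)) (.const n₀)).eval s₀ = 0 := by
    simp only [Expr.eval, hs₀, Function.update_self, encode_zero]
    omega
  simp only [initial, mainProg, step, ← hs₀, this, ne_eq, not_true_eq_false, if_false]

lemma final_mainProg {n₀ cA a cB b κ R W : ℕ} (hB : Bounds n K m d q N (W ^ 3) tL tE B)
    (hL : HaltsWithin (exampleLaw J d q) L [N] tL) {ev : List ℕ → List ℕ → ℕ}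
    (hE : ∀ z ∈ (output (exampleLaw J d q) L [N] tL).support, ∀ l ∈ (exampleLaw J d q).support,
      ∀ c ∈ (run noExamples E (queryOf N z l) tE).support, c.todo = [] ∧ c.out = [ev z l])
    (hn : n₀ ≤ n) (hd : cA * Nat.size n ^ a = d) (hq : cB * Nat.size n ^ b = q) (hW : N ^ κ = W)
    (ha : a ≤ B) (hb : b ≤ B) (hκ : κ ≤ B) (hWB : W ≤ B) (hB2 : 2 ≤ B) (hR : R ≤ B) :
    Final (initial (mainProg L E n₀ cA a cB b κ R) (encodeFormula J)) (mainTime B)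
      (if corr J ≤ (m + n * 2 ^ K) * m then (trialsLaw (trialLaw (exampleLaw J d q) L N tL (W ^ 2)
        (W ^ 3) ev) R).map fun b => [b.toNat] else PMF.pure [1]) := by
  set s₀ : Memory := Function.update 0 0 (arrayOf (encodeFormula J)) with hs₀
  have h0 : s₀ 0 = arrayOf (encodeFormula J) := by simp [hs₀]
  set ν := (trialsLaw (trialLaw (exampleLaw J d q) L N tL (W ^ 2) (W ^ 3) ev) R).map
    fun b => [b.toNat] with hν
  set Y : Prog := .seq (coreProg L E cA a cB b κ R) (.emit (V 38)) with hY
  set X : Prog := .ite (V 34) (.emit (.const 1)) Y with hX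
  set t₁ := B * (trialTime B + 3) + 6 * (B * (B * 4 + 10)) + B * 7 + 60 with ht₁
  set t₂ := B * (B * (B * 6 + 12) + 12) + 2 * (B * (B * 4 + 10)) + 21 with ht₂
  refine (final_step_pure (c' := ⟨[.seq testProg X], s₀, []⟩) (T := t₂ + t₁ + 1) ?_ ?_).mono
    (by unfold mainTime; omega)
  · have : (Expr.sub (.add nE (.const 1)) (.const n₀)).eval s₀ ≠ 0 := by
      simp only [Expr.eval, h0, encode_zero]
      omega
    simp only [initial, mainProg, step, ← hs₀, this, ne_eq, not_false_eq_true, if_true, hX, hY]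
  refine final_step_pure (c' := ⟨[testProg, X], s₀, []⟩) rfl ?_
  have := det_testProg (B := B) h0 hB.K_le hB.m_le hB2 [X] [] t₁
      (fun _ => if corr J ≤ (m + n * 2 ^ K) * m then ν else PMF.pure [1]) ?_
  · rwa [PMF.pure_bind] at this
  rintro - - s₁ ⟨h1, h2⟩
  by_cases hc : corr J ≤ (m + n * 2 ^ K) * m
  swap
  · rw [if_neg hc]
    refine (final_step_pure (c' := ⟨[.emit (.const 1)], s₁, []⟩) ?_ (final_emit _ _)).mono
      (by omega)
    have : (V 34).eval s₁ ≠ 0 := by simp only [Expr.eval, h1]; omega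
    simp [hX, step, this]
  rw [if_pos hc]
  refine (final_step_pure (c' := ⟨[Y], s₁, []⟩) (T := t₁ - 1) ?_ ?_).mono (by omega)
  · have : (V 34).eval s₁ = 0 := by simp only [Expr.eval, h1]; omega
    simp [hX, step, this]
  refine (final_step_pure (c' := ⟨[coreProg L E cA a cB b κ R, .emit (V 38)], s₁, []⟩)
    (T := t₁ - 2) rfl ?_).mono (by omega)
  have h0' : s₁ 0 = arrayOf (encodeFormula J) := by
    rw [h2 0 (by simp) (by simp) (by simp) (by simp), h0]
  have hsim : Sim (coreProg L E cA a cB b κ R) s₁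
      (6 * (B * (B * 4 + 10)) + B * 7 + 43 + (B * (trialTime B + 3) + 3) + 1)
      (trialsLaw (trialLaw (exampleLaw J d q) L N tL (W ^ 2) (W ^ 3) ev) R)
      fun b s' => s' 38 0 = b.toNat := by
    refine Det.seq_sim (det_paramProg (B := B) (d := d) (q := q) (N := N) (W := W)
      (by rw [h0', encode_zero]) hd hq hB.N_eq hW hB.n_le ha hb hB.d_le hB.N_le hκ hWB hB2) ?_
    rintro s₂ ⟨e1, e2, e3, e4, e5, e6, e7⟩
    have hp₂ : Params J d q N (W ^ 2) (W ^ 3) s₂ := ⟨by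
      rw [e7 0 (by simp) (by simp) (by simp) (by simp), h0'], e1, e2, e3, e5, e6⟩
    have hz : ∀ x, 37 ≤ x → s₂ x = 0 := fun x hx => by
      rw [e7 x (by omega) (by omega) (by omega) (by omega), h2 x (by omega) (by omega) (by omega)
        (by omega), hs₀]
      simp [show x ≠ 0 by omega]
    refine Sim.conseq (Sim.forTo (n := R) (t := trialTime B) (fun i b s' => s' 37 0 = i ∧
      s' 38 0 = b.toNat ∧ Params J d q N (W ^ 2) (W ^ 3) s' ∧ Fresh s') hR ?_ ?_ ?_) ?_
    · refine ⟨by simp, by simp [hz], hp₂.congr fun b hb => ?_, ?_⟩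
      · rw [store_ne _ _ _ (by omega)]
      · intro x hx i _
        rw [store_ne _ _ _ (by omega), hz x (by omega)]
        rfl
    · rintro i - b s' ⟨k1, -⟩
      exact ⟨k1, rfl⟩
    · rintro i - b s' ⟨k1, k2, k3, k4⟩
      refine Sim.map (sim_trialProg hB hL hE k3 k4) ?_
      rintro b' - s'' ⟨g1, g2, g3, g4⟩
      refine ⟨by rw [g2, k1], by simp, ?_, g3.congr fun b hb => by rw [store_ne _ _ _ (by omega)],
        ?_⟩
      · rw [store_ne _ _ _ (by simp), g1, k2]
        cases b <;> cases b' <;> simp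
      · intro a ha i hi
        rw [store_ne _ _ _ (by omega), store_ne _ _ _ (by omega)] at hi
        rw [store_ne _ _ _ (by omega)]
        exact g4 a ha i hi
    · rintro b - s' ⟨-, k2, -⟩
      exact k2
  have hfin := hsim [.emit (V 38)] [] 1 (fun b => PMF.pure [b.toNat]) ?_
  · exact hfin.mono (by omega)
  · rintro b - s' hs'
    have := final_emit (V 38) s'
    simpa [Expr.eval, hs'] using this

end Program

open scoped ENNReal

/-! ### Expectations and independent samples -/

/-- The expectation of a nonnegative function. -/
def pexp {α : Type} (p : PMF α) (f : α → ℝ≥0∞) : ℝ≥0∞ := ∑' a, p a * f a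

/-- The probability of an event. -/
abbrev pr {α : Type} (p : PMF α) (S : Set α) : ℝ≥0∞ := p.toOuterMeasure S

section Basic

variable {α β : Type} (p : PMF α)

lemma pr_eq_pexp (S : Set α) : pr p S = pexp p (S.indicator 1) := by
  rw [pr, PMF.toOuterMeasure_apply, pexp]
  refine tsum_congr fun a => ?_
  by_cases h : a ∈ S <;> simp [h]

lemma pexp_pure (a : α) (f : α → ℝ≥0∞) : pexp (PMF.pure a) f = f a := by
  rw [pexp, tsum_eq_single a]
  · simp
  · intro b hb
    simp [PMF.pure_apply, hb]

lemma pexp_bind (q : α → PMF β) (f : β → ℝ≥0∞) :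
    pexp (p.bind q) f = pexp p fun a => pexp (q a) f := by
  simp only [pexp, PMF.bind_apply, ← ENNReal.tsum_mul_right, ← ENNReal.tsum_mul_left]
  rw [ENNReal.tsum_comm]
  simp only [mul_assoc]

lemma pexp_map (g : α → β) (f : β → ℝ≥0∞) : pexp (p.map g) f = pexp p fun a => f (g a) := by
  rw [← PMF.bind_pure_comp, pexp_bind]
  simp [pexp_pure]

lemma pexp_mono {f g : α → ℝ≥0∞} (h : ∀ a ∈ p.support, f a ≤ g a) : pexp p f ≤ pexp p g := by
  refine ENNReal.tsum_le_tsum fun a => ?_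
  by_cases ha : a ∈ p.support
  · exact mul_le_mul_right (h a ha) _
  · rw [PMF.mem_support_iff, not_not] at ha
    simp [ha]

lemma pexp_mul_left (c : ℝ≥0∞) (f : α → ℝ≥0∞) : pexp p (fun a => c * f a) = c * pexp p f := by
  simp only [pexp, ← ENNReal.tsum_mul_left]
  exact tsum_congr fun a => by ring

lemma pexp_mul_right (c : ℝ≥0∞) (f : α → ℝ≥0∞) : pexp p (fun a => f a * c) = pexp p f * c := by
  simp only [pexp, ← ENNReal.tsum_mul_right]
  exact tsum_congr fun a => by ring

lemma pexp_add (f g : α → ℝ≥0∞) : pexp p (fun a => f a + g a) = pexp p f + pexp p g := by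
  simp only [pexp, mul_add]
  exact ENNReal.tsum_add

lemma pexp_const (c : ℝ≥0∞) : pexp p (fun _ => c) = c := by
  simp [pexp, ENNReal.tsum_mul_right, p.tsum_coe]

lemma pr_le_pexp {S : Set α} {f : α → ℝ≥0∞} (h : ∀ a ∈ S, a ∈ p.support → 1 ≤ f a) :
    pr p S ≤ pexp p f := by
  rw [pr_eq_pexp]
  refine pexp_mono p fun a ha => ?_
  by_cases haS : a ∈ S
  · simpa [haS] using h a haS ha
  · simp [haS]

lemma pr_bind (q : α → PMF β) (S : Set β) :
    pr (p.bind q) S = pexp p fun a => pr (q a) S := by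
  simp only [pr_eq_pexp, pexp_bind]

lemma pr_map (g : α → β) (S : Set β) : pr (p.map g) S = pr p (g ⁻¹' S) :=
  PMF.toOuterMeasure_map_apply g p S

lemma pr_mono {S T : Set α} (h : ∀ a ∈ S, a ∈ p.support → a ∈ T) : pr p S ≤ pr p T := by
  rw [pr_eq_pexp p T]
  exact pr_le_pexp p fun a ha ha' => by simp [h a ha ha']

lemma pr_union_le (S T : Set α) : pr p (S ∪ T) ≤ pr p S + pr p T :=
  MeasureTheory.measure_union_le S T

lemma pr_le_one (S : Set α) : pr p S ≤ 1 := by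
  rw [← pexp_const p 1]
  exact pr_le_pexp p fun _ _ _ => le_rfl

lemma pr_compl (S : Set α) : pr p S + pr p Sᶜ = 1 := by
  rw [pr_eq_pexp, pr_eq_pexp, ← pexp_add, ← pexp_const p 1]
  congr 1
  ext a
  by_cases h : a ∈ S <;> simp [h]

lemma pr_singleton (a : α) : pr p {a} = p a := PMF.toOuterMeasure_apply_singleton p a

lemma pexp_le_pr_add {f : α → ℝ≥0∞} {S : Set α} {c : ℝ≥0∞} (h1 : ∀ a, f a ≤ 1)
    (hc : ∀ a ∉ S, f a ≤ c) : pexp p f ≤ pr p S + c := by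
  rw [pr_eq_pexp, ← pexp_const p c, ← pexp_add]
  refine pexp_mono p fun a _ => ?_
  by_cases h : a ∈ S
  · simpa [h] using (h1 a).trans le_self_add
  · simpa [h] using hc a h

lemma pr_le_of_forall {w : ℝ≥0∞} (hw : ∀ a, p a ≤ w) (l : List α) :
    pr p {a | a ∈ l} ≤ l.length * w := by
  induction l with
  | nil => simp
  | cons b l ih =>
    have : {a | a ∈ b :: l} = {b} ∪ {a | a ∈ l} := by ext; simp
    rw [this]
    refine (pr_union_le _ _ _).trans ?_
    rw [pr_singleton]
    push_cast [List.length_cons]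
    rw [add_mul, one_mul, add_comm]
    exact add_le_add ih (hw b)

end Basic

section Iid

variable {α β : Type} (p : PMF α)

lemma iid_succ (k : ℕ) : iid p (k + 1) = (iid p k).bind fun l => p.map fun a => l ++ [a] := rfl

lemma pexp_iid_prod (f : α → ℝ≥0∞) (k : ℕ) :
    pexp (iid p k) (fun l => (l.map f).prod) = pexp p f ^ k := by
  induction k with
  | zero => simp [iid, iter, pexp_pure]
  | succ k ih =>
    rw [iid_succ, pexp_bind, pow_succ, ← ih, ← pexp_mul_right]
    congr 1
    ext l
    rw [pexp_map, ← pexp_mul_left]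
    simp

lemma iid_map (f : α → β) (k : ℕ) : iid (p.map f) k = (iid p k).map (List.map f) := by
  induction k with
  | zero => simp [iid, iter, PMF.pure_map]
  | succ k ih =>
    rw [iid_succ, iid_succ, ih, bind_map', map_bind']
    simp only [PMF.map_comp]
    congr 1
    ext l : 1
    congr 1
    ext a : 1
    simp

lemma iid_add (a b : ℕ) :
    iid p (a + b) = (iid p a).bind fun l => (iid p b).map fun l' => l ++ l' := by
  induction b with
  | zero => simp [iid, iter, PMF.pure_map]
  | succ b ih =>
    rw [← add_assoc, iid_succ, ih, PMF.bind_bind]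
    congr 1
    ext l : 1
    rw [iid_succ, bind_map', map_bind']
    congr 1
    ext l' : 1
    rw [PMF.map_comp]
    congr 1
    ext a : 1
    simp

lemma pr_iid_exists (S : Set α) (k : ℕ) : pr (iid p k) {l | ∃ a ∈ l, a ∈ S} ≤ k * pr p S := by
  induction k with
  | zero =>
    rw [pr_eq_pexp]
    simp [iid, iter, pexp_pure]
  | succ k ih =>
    rw [iid_succ, pr_bind]
    push_cast
    rw [add_mul, one_mul]
    refine le_trans ?_ (add_le_add_left ih _)
    refine pexp_le_pr_add _ (fun l => pr_le_one _ _) fun l hl => ?_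
    rw [pr_map]
    refine pr_mono _ fun a ha _ => ?_
    simp only [Set.mem_preimage, Set.mem_ofPred_eq, List.mem_append, List.mem_singleton] at ha hl
    obtain ⟨b, hb | rfl, hb'⟩ := ha
    · exact absurd ⟨b, hb, hb'⟩ hl
    · exact hb'

lemma pr_iid_not_nodup {w : ℝ≥0∞} (hw : ∀ a, p a ≤ w) (k : ℕ) :
    pr (iid p k) {l | ¬ l.Nodup} ≤ (k : ℝ≥0∞) ^ 2 * w := by
  induction k with
  | zero =>
    rw [pr_eq_pexp]
    simp [iid, iter, pexp_pure]
  | succ k ih =>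
    rw [iid_succ, pr_bind]
    have h1 : pexp (iid p k) (fun l => pr (p.map fun a => l ++ [a]) {l | ¬ l.Nodup}) ≤
        pexp (iid p k) (fun l => ({l | ¬ l.Nodup} : Set (List α)).indicator 1 l + k * w) := by
      refine pexp_mono _ fun l hl => ?_
      by_cases hn : l.Nodup
      · refine le_trans ?_ le_add_self
        rw [pr_map]
        rw [← length_of_mem_iid hl]
        refine (pr_mono _ fun a ha _ => ?_).trans (pr_le_of_forall p hw l)
        simp only [Set.mem_preimage, Set.mem_ofPred_eq, List.nodup_append] at ha ⊢
        by_contra hal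
        refine ha ⟨hn, by simp, ?_⟩
        rintro b hb c hc rfl
        rw [List.mem_singleton] at hc
        exact hal (hc ▸ hb)
      · refine (pr_le_one _ _).trans ?_
        simp [hn]
    refine h1.trans ?_
    rw [pexp_add, ← pr_eq_pexp, pexp_const]
    calc pr (iid p k) {l | ¬ l.Nodup} + k * w ≤ (k : ℝ≥0∞) ^ 2 * w + k * w := add_le_add_left ih _
      _ ≤ ((k + 1 : ℕ) : ℝ≥0∞) ^ 2 * w := by
        rw [← add_mul]
        refine mul_le_mul_left ?_ w
        norm_cast
        nlinarith

open Classical in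
/-- An exponential moment bound for the number of samples in `S`. -/
lemma pr_iid_count_le (S : Set α) {x y c : ℝ} (hx : 0 ≤ x) (hy : 0 ≤ y) (hc : 0 < c) (k : ℕ)
    {T : Set (List α)}
    (hT : ∀ l ∈ T, l.length = k →
      c ≤ x ^ (l.countP fun a => a ∈ S) * y ^ (k - l.countP fun a => a ∈ S)) :
    pr (iid p k) T ≤ ENNReal.ofReal ((x * (pr p S).toReal + y * (1 - (pr p S).toReal)) ^ k / c) := by
  set π := (pr p S).toReal with hπ
  have hS1 : pr p S ≤ 1 := pr_le_one p S
  have hSt : pr p S ≠ ⊤ := ne_top_of_le_ne_top ENNReal.one_ne_top hS1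
  have hS : pr p S = ENNReal.ofReal π := (ENNReal.ofReal_toReal hSt).symm
  have hπ0 : 0 ≤ π := ENNReal.toReal_nonneg
  have hπ1 : π ≤ 1 := by
    rw [hπ, ← ENNReal.toReal_one]
    exact ENNReal.toReal_mono ENNReal.one_ne_top hS1
  have hSc : pr p Sᶜ = ENNReal.ofReal (1 - π) := by
    have h := pr_compl p S
    rw [ENNReal.ofReal_sub _ hπ0, ENNReal.ofReal_one, ← hS]
    exact ENNReal.eq_sub_of_add_eq hSt (by rw [add_comm]; exact h)
  set f : α → ℝ≥0∞ := fun a => if a ∈ S then ENNReal.ofReal x else ENNReal.ofReal y with hf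
  have hfe : pexp p f = ENNReal.ofReal (x * π + y * (1 - π)) := by
    have : f = fun a => ENNReal.ofReal x * S.indicator 1 a + ENNReal.ofReal y * Sᶜ.indicator 1 a := by
      ext a
      by_cases h : a ∈ S <;> simp [hf, h]
    rw [this, pexp_add, pexp_mul_left, pexp_mul_left, ← pr_eq_pexp, ← pr_eq_pexp, hS, hSc,
      ENNReal.ofReal_add (by positivity) (mul_nonneg hy (by linarith)), ENNReal.ofReal_mul hx,
      ENNReal.ofReal_mul hy]
  have hprod : ∀ l : List α, (l.map f).prod = ENNReal.ofReal
      (x ^ (l.countP fun a => a ∈ S) * y ^ (l.length - l.countP fun a => a ∈ S)) := by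
    intro l
    induction l with
    | nil => simp
    | cons a l ih =>
      have hle : (l.countP fun a => decide (a ∈ S)) ≤ l.length := List.countP_le_length
      rw [List.map_cons, List.prod_cons, ih]
      by_cases h : a ∈ S
      · simp only [hf, h, if_true, List.countP_cons, List.length_cons, decide_true]
        rw [← ENNReal.ofReal_mul hx, Nat.add_sub_add_right]
        congr 1
        ring
      · simp only [hf, h, if_false, List.countP_cons, List.length_cons, decide_false]
        rw [← ENNReal.ofReal_mul hy]
        congr 1
        simp only [Bool.false_eq_true, if_false, add_zero]
        rw [Nat.succ_sub hle, pow_succ]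
        ring
  rw [div_eq_inv_mul, ENNReal.ofReal_mul (by positivity), ENNReal.ofReal_pow, ← hfe,
    ← pexp_iid_prod, ← pexp_mul_left]
  · refine pr_le_pexp _ fun l hl hl' => ?_
    have hlen := length_of_mem_iid hl'
    rw [hprod, ← ENNReal.ofReal_mul (by positivity), ← ENNReal.ofReal_one]
    refine ENNReal.ofReal_le_ofReal ?_
    rw [hlen]
    have := hT l hl hlen
    rw [← div_eq_inv_mul, le_div_iff₀ hc]
    linarith
  · exact add_nonneg (by positivity) (mul_nonneg hy (by linarith))

end Iid

section Trials

variable (p : PMF Bool)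

lemma trialsLaw_false (R : ℕ) : trialsLaw p R false = p false ^ R := by
  induction R with
  | zero => simp [trialsLaw, iter]
  | succ R ih =>
    rw [trialsLaw, iter, ← trialsLaw, PMF.bind_apply, tsum_bool, ih, pow_succ]
    simp [PMF.map_apply]

lemma trialsLaw_true_le (R : ℕ) : trialsLaw p R true ≤ R * p true := by
  induction R with
  | zero => simp [trialsLaw, iter]
  | succ R ih =>
    rw [trialsLaw, iter, ← trialsLaw, ← pr_singleton, pr_bind]
    push_cast
    rw [add_mul, one_mul]
    rw [← pr_singleton] at ih
    refine le_trans (pexp_le_pr_add (S := {true}) (c := p true) _ (fun _ => pr_le_one _ _)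
      fun b hb => ?_) (add_le_add_left ih _)
    have : b = false := by simpa using hb
    subst this
    rw [pr_singleton]
    exact le_of_eq (by rw [show (fun b' : Bool => false || b') = id from rfl, PMF.map_id])

end Trials

/-! ### The law of the indices -/

lemma coin_apply (b : Bool) : coin b = 2⁻¹ := by simp [coin]

lemma coin_map_le (r x : ℕ) :
    (coin.map fun c => r + r + c.toNat) x ≤ if r = x / 2 then 2⁻¹ else 0 := by
  rw [PMF.map_apply, tsum_bool]
  simp only [coin_apply, Bool.toNat_false, Bool.toNat_true]
  split_ifs <;> first | omega | simp

/-- The number with `k` random binary digits. -/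
def digitsLaw (k : ℕ) : PMF ℕ := iter (fun r => coin.map fun c => r + r + c.toNat) k 0

lemma digitsLaw_succ (k : ℕ) : digitsLaw (k + 1) =
    (digitsLaw k).bind fun r => coin.map fun c => r + r + c.toNat := rfl

lemma digitsLaw_le (k x : ℕ) :
    digitsLaw k x ≤ if x < 2 ^ k then (2⁻¹ : ℝ≥0∞) ^ k else 0 := by
  induction k generalizing x with
  | zero =>
    simp only [digitsLaw, iter, PMF.pure_apply]
    split_ifs <;> first | omega | simp
  | succ k ih =>
    rw [digitsLaw, iter, ← digitsLaw, PMF.bind_apply]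
    calc ∑' r, digitsLaw k r * (coin.map fun c => r + r + c.toNat) x
        ≤ ∑' r, digitsLaw k r * (if r = x / 2 then 2⁻¹ else 0) :=
          ENNReal.tsum_le_tsum fun r => mul_le_mul_right (coin_map_le r x) _
      _ = digitsLaw k (x / 2) * 2⁻¹ := by
        rw [tsum_eq_single (x / 2) (fun r hr => by simp [hr])]
        simp
      _ ≤ (if x / 2 < 2 ^ k then (2⁻¹ : ℝ≥0∞) ^ k else 0) * 2⁻¹ := mul_le_mul_left (ih _) _
      _ = _ := by
        have : x / 2 < 2 ^ k ↔ x < 2 ^ (k + 1) := by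
          rw [pow_succ]
          omega
        simp only [this]
        split_ifs
        · rw [pow_succ]
        · simp

lemma idxLaw_eq (m : ℕ) [NeZero m] : idxLaw m = (digitsLaw m).map (Fin.ofNat m) := by
  have : ∀ k, iter (fun r : Fin m => coin.map fun c => Fin.ofNat m (r + r + c.toNat)) k 0 =
      (digitsLaw k).map (Fin.ofNat m) := by
    intro k
    induction k with
    | zero =>
      simp only [digitsLaw, iter, PMF.pure_map]
      congr 1
    | succ k ih =>
      rw [iter, ih, digitsLaw_succ, map_bind', bind_map']
      congr 1
      ext r : 1
      rw [PMF.map_comp]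
      congr 1
      ext c : 1
      apply Fin.ext
      simp [Nat.add_mod]
  exact this m

lemma idxLaw_le (m : ℕ) [NeZero m] (j : Fin m) :
    idxLaw m j ≤ ENNReal.ofReal (1 / m + 1 / 2 ^ m) := by
  have hm : 0 < m := Nat.pos_of_ne_zero (NeZero.ne m)
  set S := (Finset.range (2 ^ m)).filter fun x => x % m = j with hS
  have hcard : S.card ≤ 2 ^ m / m + 1 := by
    rw [← Finset.card_range (2 ^ m / m + 1)]
    refine Finset.card_le_card_of_injOn (fun x => x / m) ?_ ?_
    · intro x hx
      simp only [hS, Finset.coe_filter, Finset.mem_range, Set.mem_ofPred_eq] at hx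
      simp only [Finset.coe_range, Set.mem_Iio]
      exact Nat.lt_succ_of_le (Nat.div_le_div_right hx.1.le)
    · intro x hx y hy hxy
      simp only [hS, Finset.coe_filter, Finset.mem_range, Set.mem_ofPred_eq] at hx hy hxy
      rw [← Nat.div_add_mod x m, ← Nat.div_add_mod y m, hxy, hx.2, hy.2]
  rw [idxLaw_eq, PMF.map_apply]
  calc _ ≤ ∑' x, (if x ∈ S then (2⁻¹ : ℝ≥0∞) ^ m else 0) := by
        refine ENNReal.tsum_le_tsum fun x => ?_
        by_cases h : j = Fin.ofNat m x
        · rw [if_pos h]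
          refine (digitsLaw_le m x).trans ?_
          have hx : x % m = j := by rw [h, Fin.val_ofNat]
          simp [hS, hx]
        · rw [if_neg h]
          exact zero_le
    _ = S.card * (2⁻¹ : ℝ≥0∞) ^ m := by
        rw [tsum_eq_sum (s := S) (fun x hx => by simp [hx])]
        rw [Finset.sum_congr rfl fun x hx => if_pos hx]
        simp
    _ = ENNReal.ofReal (S.card * (1 / 2) ^ m) := by
        rw [ENNReal.ofReal_mul (by positivity), ENNReal.ofReal_natCast,
          ENNReal.ofReal_pow (by norm_num)]
        congr 2
        rw [one_div, ENNReal.ofReal_inv_of_pos (by norm_num)]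
        simp
    _ ≤ _ := by
        refine ENNReal.ofReal_le_ofReal ?_
        have h1 : (S.card : ℝ) ≤ 2 ^ m / m + 1 := by
          have h2 : (S.card : ℝ) ≤ ((2 ^ m / m : ℕ) : ℝ) + 1 := by exact_mod_cast hcard
          refine h2.trans ?_
          have := Nat.cast_div_le (α := ℝ) (m := 2 ^ m) (n := m)
          push_cast at this
          linarith
        calc (S.card : ℝ) * (1 / 2) ^ m ≤ (2 ^ m / m + 1) * (1 / 2) ^ m := by gcongr
          _ = _ := by
            have : (m : ℝ) ≠ 0 := by positivity
            field_simp
            rw [← mul_pow]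
            norm_num

/-! ### Concentration for formulas with small correlation -/

/-- A sign as a real number. -/
abbrev rs (u : ℤˣ) : ℝ := ((u : ℤ) : ℝ)

lemma rs_mul (u v : ℤˣ) : rs (u * v) = rs u * rs v := by simp [rs]

@[simp] lemma rs_one : rs 1 = 1 := by simp [rs]

@[simp] lemma rs_neg_one : rs (-1) = -1 := by simp [rs]

lemma rs_sq (u : ℤˣ) : rs u * rs u = 1 := by
  rcases Int.units_eq_one_or u with rfl | rfl <;> simp [rs]

lemma sum_units (f : ℤˣ → ℝ) : ∑ u, f u = f 1 + f (-1) := by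
  rw [show (Finset.univ : Finset ℤˣ) = {1, -1} from rfl, Finset.sum_pair (by decide)]

section Correlation

variable {n K m : ℕ} (J : KFormula n K m)

/-- The sum of the products of the `i`-th literals, `i ∈ S`, for pairs of constraints. -/
def corrAt (S : Finset (Fin K)) : ℝ :=
  ∑ j, ∑ j', ∏ i ∈ S,
    if (J j).1 i = (J j').1 i then rs ((J j).2 i) * rs ((J j').2 i) else 0

lemma corr_eq_sum : (corr J : ℝ) = ∑ S : Finset (Fin K), corrAt J S := by
  have h : ∀ C C' : KTuple n K, (pairCorr C C' : ℝ) = ∑ S : Finset (Fin K), ∏ i ∈ S,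
      if C.1 i = C'.1 i then rs (C.2 i) * rs (C'.2 i) else 0 := by
    intro C C'
    rw [← Finset.powerset_univ, ← Finset.prod_one_add, pairCorr]
    push_cast
    refine Finset.prod_congr rfl fun i _ => ?_
    by_cases h : C.1 i = C'.1 i
    · simp only [h, if_true]
      rcases Int.units_eq_one_or (C.2 i) with h1 | h1 <;>
        rcases Int.units_eq_one_or (C'.2 i) with h2 | h2 <;> simp [h1, h2] <;> norm_num
    · simp [h]
  simp only [corr, corrAt, Nat.cast_sum, h]
  rw [Finset.sum_comm]
  conv_rhs => rw [Finset.sum_comm]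
  rw [Finset.sum_comm]
  refine Finset.sum_congr rfl fun j _ => ?_
  rw [Finset.sum_comm]

lemma corrAt_empty : corrAt J ∅ = (m : ℝ) * m := by simp [corrAt]

/-- The number of occurrences of the tuple `w` of variables at the positions in `S`, with signs. -/
def occur (S : Finset (Fin K)) (w : S → Fin n) : ℝ :=
  ∑ j, ∏ i : S, if (J j).1 i = w i then rs ((J j).2 i) else 0

lemma corrAt_eq (S : Finset (Fin K)) : corrAt J S = ∑ w : S → Fin n, occur J S w ^ 2 := by
  have h : ∀ j j', ∏ i ∈ S, (if (J j).1 i = (J j').1 i then rs ((J j).2 i) * rs ((J j').2 i)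
      else 0) = ∑ w : S → Fin n, (∏ i : S, if (J j).1 i = w i then rs ((J j).2 i) else 0) *
        ∏ i : S, if (J j').1 i = w i then rs ((J j').2 i) else 0 := by
    intro j j'
    simp only [← Finset.prod_mul_distrib]
    rw [← Fintype.piFinset_univ, ← Finset.prod_univ_sum (fun _ => Finset.univ) (fun (i : S) x =>
      (if (J j).1 i = x then rs ((J j).2 i) else 0) *
        if (J j').1 i = x then rs ((J j').2 i) else 0), ← Finset.prod_coe_sort]
    refine Finset.prod_congr rfl fun i _ => ?_
    rw [Finset.sum_eq_single ((J j).1 i)]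
    · by_cases h : (J j).1 i = (J j').1 i
      · simp [h]
      · simp [h, Ne.symm h]
    · intro x _ hx
      simp [Ne.symm hx]
    · simp
  simp only [corrAt, occur, h, sq, Finset.sum_mul_sum]
  rw [Finset.sum_comm]
  conv_rhs => rw [Finset.sum_comm]
  rw [Finset.sum_comm]
  refine Finset.sum_congr rfl fun j _ => ?_
  rw [Finset.sum_comm]

lemma corrAt_le {S : Finset (Fin K)} (hS : S.Nonempty) : corrAt J S ≤ corr J - (m : ℝ) * m := by
  have h0 : ∀ S, 0 ≤ corrAt J S := fun S => by
    rw [corrAt_eq]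
    positivity
  rw [corr_eq_sum, ← corrAt_empty J,
    ← Finset.add_sum_erase _ _ (Finset.mem_univ (∅ : Finset (Fin K)))]
  rw [add_sub_cancel_left]
  exact Finset.single_le_sum (fun S _ => h0 S) (Finset.mem_erase.2 ⟨hS.ne_empty, Finset.mem_univ _⟩)

lemma sq_sum_prod_le (ψ : Fin n → ℤˣ) (S : Finset (Fin K)) :
    (∑ j, ∏ i ∈ S, rs ((J j).apply ψ i)) ^ 2 ≤ (n : ℝ) ^ S.card * corrAt J S := by
  have h : ∀ j, ∏ i ∈ S, rs ((J j).apply ψ i) = ∑ w : S → Fin n, (∏ i : S, rs (ψ (w i))) *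
      ∏ i : S, if (J j).1 i = w i then rs ((J j).2 i) else 0 := by
    intro j
    simp only [← Finset.prod_mul_distrib]
    rw [← Fintype.piFinset_univ, ← Finset.prod_univ_sum (fun _ => Finset.univ) (fun (i : S) x =>
      rs (ψ x) * if (J j).1 i = x then rs ((J j).2 i) else 0), ← Finset.prod_coe_sort]
    refine Finset.prod_congr rfl fun i _ => ?_
    rw [Finset.sum_eq_single ((J j).1 i)]
    · simp [KTuple.apply, rs_mul, mul_comm]
    · intro x _ hx
      simp [Ne.symm hx]
    · simp
  have h2 : ∑ j, ∏ i ∈ S, rs ((J j).apply ψ i) =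
      ∑ w : S → Fin n, (∏ i : S, rs (ψ (w i))) * occur J S w := by
    simp only [h, occur, Finset.mul_sum]
    rw [Finset.sum_comm]
  rw [h2, corrAt_eq]
  refine (Finset.sum_mul_sq_le_sq_mul_sq _ _ _).trans (le_of_eq ?_)
  congr 1
  have : ∀ w : S → Fin n, (∏ i : S, rs (ψ (w i))) ^ 2 = 1 := by
    intro w
    rw [sq, ← Finset.prod_mul_distrib]
    exact Finset.prod_eq_one fun i _ => rs_sq _
  rw [Finset.sum_congr rfl fun w _ => this w]
  simp

end Correlation

section Moments

variable {K : ℕ}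

/-- The set of values that are attained an odd number of times. -/
def oddSet {p : ℕ} (f : Fin p → Fin K) : Finset (Fin K) :=
  Finset.univ.filter fun i => Odd (Finset.univ.filter fun l => f l = i).card

lemma prod_comp_eq {p : ℕ} (f : Fin p → Fin K) (z : Fin K → ℤˣ) :
    ∏ l, rs (z (f l)) = ∏ i ∈ oddSet f, rs (z i) := by
  rw [← Finset.prod_fiberwise (s := Finset.univ) (g := f), oddSet, Finset.prod_filter]
  refine Finset.prod_congr rfl fun i _ => ?_
  rw [Finset.prod_congr rfl (g := fun _ => rs (z i))
    (fun l hl => by rw [(Finset.mem_filter.1 hl).2]), Finset.prod_const]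
  rcases Nat.even_or_odd (Finset.univ.filter fun l => f l = i).card with h | h
  · rw [if_neg (by simpa using h)]
    obtain ⟨r, hr⟩ := h
    rw [hr, pow_add, ← mul_pow, rs_sq, one_pow]
  · rw [if_pos h]
    obtain ⟨r, hr⟩ := h
    rw [hr, pow_succ, two_mul, pow_add, ← mul_pow, rs_sq, one_pow, one_mul]

lemma card_oddSet_le {p : ℕ} (f : Fin p → Fin K) : (oddSet f).card ≤ p := by
  have : oddSet f ⊆ Finset.univ.image f := by
    intro i hi
    simp only [oddSet, Finset.mem_filter, Finset.mem_univ, true_and] at hi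
    obtain ⟨l, hl⟩ := Finset.card_pos.1 hi.pos
    exact Finset.mem_image.2 ⟨l, Finset.mem_univ _, (Finset.mem_filter.1 hl).2⟩
  simpa using (Finset.card_le_card this).trans Finset.card_image_le

lemma sum_pow_eq (z : Fin K → ℤˣ) (p : ℕ) :
    (∑ i, rs (z i)) ^ p = ∑ f : Fin p → Fin K, ∏ i ∈ oddSet f, rs (z i) := by
  simp only [← prod_comp_eq]
  rw [← Fintype.piFinset_univ, ← Finset.prod_univ_sum (fun _ => Finset.univ)
    (fun (_ : Fin p) i => rs (z i))]
  simp

lemma sum_cube_prod {S : Finset (Fin K)} (hS : S.Nonempty) :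
    ∑ z : Fin K → ℤˣ, ∏ i ∈ S, rs (z i) = 0 := by
  obtain ⟨i, hi⟩ := hS
  have h : ∀ z : Fin K → ℤˣ, ∏ i ∈ S, rs (z i) = ∏ i, if i ∈ S then rs (z i) else 1 := by
    intro z
    rw [Finset.prod_ite_mem, Finset.univ_inter]
  simp only [h]
  rw [← Fintype.piFinset_univ, ← Finset.prod_univ_sum (fun _ => Finset.univ)
    (fun i (u : ℤˣ) => if i ∈ S then rs u else 1)]
  refine Finset.prod_eq_zero (Finset.mem_univ i) ?_
  rw [sum_units]
  simp [hi]

/-- The average of the `p`-th power of the sum of `K` signs. -/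
def moment (K p : ℕ) : ℝ := (∑ z : Fin K → ℤˣ, (∑ i, rs (z i)) ^ p) / 2 ^ K

lemma sum_pow_le {n m : ℕ} (J : KFormula n K m) (ψ : Fin n → ℤˣ) (p : ℕ) {δ : ℝ} (hδ : 0 ≤ δ)
    (hS : ∀ S : Finset (Fin K), S.Nonempty → S.card ≤ p →
      ∑ j, ∏ i ∈ S, rs ((J j).apply ψ i) ≤ δ) :
    ∑ j, (∑ i, rs ((J j).apply ψ i)) ^ p ≤ m * moment K p + K ^ p * δ := by
  have h1 : ∀ S : Finset (Fin K), S.card ≤ p → ∑ j, ∏ i ∈ S, rs ((J j).apply ψ i) ≤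
      m * ((∑ z : Fin K → ℤˣ, ∏ i ∈ S, rs (z i)) / 2 ^ K) + δ := by
    intro S hSp
    rcases S.eq_empty_or_nonempty with rfl | h
    · simp [hδ]
    · rw [sum_cube_prod h]
      simpa using hS S h hSp
  simp only [sum_pow_eq]
  rw [Finset.sum_comm, moment]
  simp only [sum_pow_eq]
  calc ∑ f : Fin p → Fin K, ∑ j, ∏ i ∈ oddSet f, rs ((J j).apply ψ i)
      ≤ ∑ f : Fin p → Fin K,
        (m * ((∑ z : Fin K → ℤˣ, ∏ i ∈ oddSet f, rs (z i)) / 2 ^ K) + δ) :=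
        Finset.sum_le_sum fun f _ => h1 _ (card_oddSet_le f)
    _ = _ := by
        rw [Finset.sum_add_distrib, ← Finset.mul_sum, ← Finset.sum_div, Finset.sum_comm]
        simp

lemma sum_exp_cube (K : ℕ) (a : ℝ) :
    ∑ z : Fin K → ℤˣ, Real.exp (a * ∑ i, rs (z i)) = 2 ^ K * Real.cosh a ^ K := by
  have h : ∀ z : Fin K → ℤˣ, Real.exp (a * ∑ i, rs (z i)) = ∏ i, Real.exp (a * rs (z i)) := by
    intro z
    rw [Finset.mul_sum, Real.exp_sum]
  rw [Finset.sum_congr rfl fun z _ => h z]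
  rw [← Fintype.piFinset_univ, ← Finset.prod_univ_sum (fun _ => Finset.univ)
    (fun (_ : Fin K) (u : ℤˣ) => Real.exp (a * rs u))]
  simp only [sum_units, Finset.prod_const, Finset.card_univ, Fintype.card_fin]
  rw [← mul_pow, Real.cosh_eq]
  simp
  ring

lemma pow_le_exp {t : ℕ} (x : ℝ) :
    x ^ (2 * t) ≤ (2 * t).factorial * (Real.exp x + Real.exp (-x)) := by
  have h : |x| ^ (2 * t) ≤ (2 * t).factorial * Real.exp |x| := by
    have := Real.pow_div_factorial_le_exp |x| (abs_nonneg x) (2 * t)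
    rw [div_le_iff₀ (by positivity)] at this
    linarith
  rw [pow_mul, ← sq_abs, ← pow_mul]
  refine h.trans ?_
  gcongr
  rcases abs_cases x with ⟨h, -⟩ | ⟨h, -⟩ <;> rw [h]
  · linarith [Real.exp_pos (-x)]
  · linarith [Real.exp_pos x]

lemma moment_le {K t : ℕ} (hK : 1 ≤ K) (ht : 1 ≤ t) :
    moment K (2 * t) ≤ 2 * (6 * (K : ℝ) * t) ^ t := by
  have hK' : (0 : ℝ) < K := by exact_mod_cast hK
  have ht' : (0 : ℝ) < t := by exact_mod_cast ht
  set a := √(2 * t / K) with ha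
  have ha2 : a ^ 2 = 2 * t / K := Real.sq_sqrt (by positivity)
  have ha0 : 0 < a := Real.sqrt_pos.2 (by positivity)
  have h1 : ∀ z : Fin K → ℤˣ, a ^ (2 * t) * (∑ i, rs (z i)) ^ (2 * t) ≤ (2 * t).factorial *
      (Real.exp (a * ∑ i, rs (z i)) + Real.exp ((-a) * ∑ i, rs (z i))) := by
    intro z
    rw [← mul_pow, neg_mul]
    exact pow_le_exp _
  have h2 : a ^ (2 * t) * ∑ z : Fin K → ℤˣ, (∑ i, rs (z i)) ^ (2 * t) ≤
      (2 * t).factorial * (2 * (2 ^ K * Real.cosh a ^ K)) := by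
    rw [Finset.mul_sum]
    refine (Finset.sum_le_sum fun z _ => h1 z).trans (le_of_eq ?_)
    rw [← Finset.mul_sum, Finset.sum_add_distrib, sum_exp_cube, sum_exp_cube, Real.cosh_neg]
    ring
  have h3 : Real.cosh a ^ K ≤ 3 ^ t := by
    calc Real.cosh a ^ K ≤ Real.exp (a ^ 2 / 2) ^ K := by
          gcongr
          exact Real.cosh_le_exp_half_sq a
      _ = Real.exp 1 ^ t := by
          rw [← Real.exp_nat_mul, ← Real.exp_nat_mul, ha2]
          congr 1
          field_simp
      _ ≤ 3 ^ t := by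
          gcongr
          linarith [Real.exp_one_lt_d9]
  have h4 : ((2 * t).factorial : ℝ) ≤ (2 * t : ℝ) ^ (2 * t) := by
    exact_mod_cast Nat.factorial_le_pow (2 * t)
  have h5 : a ^ (2 * t) = (2 * t / K) ^ t := by rw [pow_mul, ha2]
  have h6 : 0 < (2 * t / K : ℝ) ^ t := by positivity
  rw [moment, div_le_iff₀ (by positivity), ← mul_le_mul_iff_right₀ h6, ← h5]
  refine h2.trans ?_
  calc ((2 * t).factorial : ℝ) * (2 * (2 ^ K * Real.cosh a ^ K))
      ≤ (2 * t : ℝ) ^ (2 * t) * (2 * (2 ^ K * 3 ^ t)) := by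
        gcongr
    _ = a ^ (2 * t) * (2 * (6 * K * t) ^ t * 2 ^ K) := by
        have e : (2 * t : ℝ) ^ 2 * 3 = 2 * t / K * (6 * K * t) := by
          field_simp
          ring
        have e' : ((2 * t : ℝ) ^ 2) ^ t * 3 ^ t = (2 * t / K) ^ t * (6 * K * t) ^ t := by
          rw [← mul_pow, ← mul_pow, e]
        rw [h5, pow_mul]
        linear_combination (2 * 2 ^ K) * e'

end Moments

/-- The sum of the literals of `C` under the assignment `ψ`. -/
def litSum {n K : ℕ} (C : KTuple n K) (ψ : Fin n → ℤˣ) : ℤ := ∑ i, (C.apply ψ i : ℤ)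

lemma rs_litSum {n K : ℕ} (C : KTuple n K) (ψ : Fin n → ℤˣ) :
    (litSum C ψ : ℝ) = ∑ i, rs (C.apply ψ i) := by simp [litSum]

/-- If the correlation of a formula is small, then only for few constraints, the sum of the
literals is large. -/
lemma card_litSum_le {n K m t D : ℕ} (hK : 1 ≤ K) (ht : 1 ≤ t) (hm : 1 ≤ m) {J : KFormula n K m}
    (hJ : corr J ≤ (m + n * 2 ^ K) * m) (h : n ^ (2 * t + 1) * 2 ^ K * K ^ (4 * t) ≤ m)
    (hD : 12 * K * t ≤ D ^ 2) (ψ : Fin n → ℤˣ) :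
    ((Finset.univ.filter fun j => (D : ℤ) ≤ |litSum (J j) ψ|).card : ℝ) * 2 ^ t ≤ 3 * m := by
  have hK' : (1 : ℝ) ≤ K := by exact_mod_cast hK
  have ht' : (1 : ℝ) ≤ t := by exact_mod_cast ht
  have hm' : (1 : ℝ) ≤ m := by exact_mod_cast hm
  have hJ' : (corr J : ℝ) - m * m ≤ n * 2 ^ K * m := by
    have : (corr J : ℝ) ≤ (m + n * 2 ^ K) * m := by exact_mod_cast hJ
    linarith
  set δ : ℝ := m / K ^ (2 * t) with hδ
  have hδ0 : 0 ≤ δ := by positivity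
  have hS : ∀ S : Finset (Fin K), S.Nonempty → S.card ≤ 2 * t →
      ∑ j, ∏ i ∈ S, rs ((J j).apply ψ i) ≤ δ := by
    intro S hS hcard
    have hn : 1 ≤ n := by
      obtain ⟨i, -⟩ := hS
      exact Nat.one_le_of_lt ((J ⟨0, hm⟩).1 i).isLt
    refine abs_le_of_sq_le_sq' ?_ hδ0 |>.2
    have h' : (n : ℝ) ^ (2 * t + 1) * 2 ^ K * K ^ (4 * t) ≤ m := by exact_mod_cast h
    calc (∑ j, ∏ i ∈ S, rs ((J j).apply ψ i)) ^ 2 ≤ (n : ℝ) ^ S.card * corrAt J S :=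
          sq_sum_prod_le J ψ S
      _ ≤ (n : ℝ) ^ (2 * t) * (n * 2 ^ K * m) := by
          have h1 := corrAt_le J hS
          have h2 : 0 ≤ corrAt J S := by rw [corrAt_eq]; positivity
          have h3 : (1 : ℝ) ≤ n := by exact_mod_cast hn
          gcongr
          linarith
      _ = ((n : ℝ) ^ (2 * t + 1) * 2 ^ K * K ^ (4 * t)) * m / (K ^ (2 * t)) ^ 2 := by
          rw [← pow_mul, show 2 * t * 2 = 4 * t by ring]
          field_simp
          ring
      _ ≤ m * m / (K ^ (2 * t)) ^ 2 := by gcongr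
      _ = δ ^ 2 := by rw [hδ, div_pow, sq (m : ℝ)]
  have h1 := sum_pow_le J ψ (2 * t) hδ0 hS
  have h2 := moment_le hK ht
  have h3 : (K : ℝ) ^ (2 * t) * δ = m := by rw [hδ]; field_simp
  set T := Finset.univ.filter fun j => (D : ℤ) ≤ |litSum (J j) ψ| with hT
  have h4 : (T.card : ℝ) * (D : ℝ) ^ (2 * t) ≤ ∑ j, (∑ i, rs ((J j).apply ψ i)) ^ (2 * t) := by
    rw [← nsmul_eq_mul, ← Finset.sum_const]
    refine (Finset.sum_le_sum (g := fun j => (∑ i, rs ((J j).apply ψ i)) ^ (2 * t))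
      fun j hj => ?_).trans ?_
    · have hj' : (D : ℤ) ≤ |litSum (J j) ψ| := (Finset.mem_filter.1 hj).2
      have hj'' : (D : ℝ) ≤ |∑ i, rs ((J j).apply ψ i)| := by
        rw [← rs_litSum]
        exact_mod_cast hj'
      rw [pow_mul, pow_mul]
      refine pow_le_pow_left₀ (by positivity) ?_ t
      rw [← sq_abs (∑ i, rs ((J j).apply ψ i))]
      gcongr
    · refine Finset.sum_le_sum_of_subset_of_nonneg (Finset.subset_univ _) fun j _ _ => ?_
      rw [pow_mul]
      positivity
  set Y : ℝ := (6 * (K : ℝ) * t) ^ t with hY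
  have hY1 : 1 ≤ Y := one_le_pow₀ (by nlinarith)
  have h5 : 2 ^ t * Y ≤ (D : ℝ) ^ (2 * t) := by
    rw [hY, ← mul_pow, pow_mul]
    refine pow_le_pow_left₀ (by positivity) ?_ t
    have : (12 * K * t : ℝ) ≤ (D : ℝ) ^ 2 := by exact_mod_cast hD
    linarith
  have h6 : (T.card : ℝ) * 2 ^ t * Y ≤ 3 * m * Y := by
    calc (T.card : ℝ) * 2 ^ t * Y = T.card * (2 ^ t * Y) := by ring
      _ ≤ T.card * (D : ℝ) ^ (2 * t) := by gcongr
      _ ≤ m * moment K (2 * t) + K ^ (2 * t) * δ := h4.trans h1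
      _ ≤ m * (2 * Y) + m * Y := by
          rw [h3]
          gcongr
          nlinarith
      _ = 3 * m * Y := by ring
  exact le_of_mul_le_mul_right h6 (by linarith)

/-! ### Halfspaces that compute majorities of parities -/

/-- The sign that a bit stands for. -/
def unitOf (b : ℕ) : ℤˣ := if b = 1 then 1 else -1

lemma bit_unitOf {b : ℕ} (hb : b ≤ 1) : bit (unitOf b) = b := by
  interval_cases b <;> simp [bit, unitOf]

lemma unitOf_bit (u : ℤˣ) : unitOf (bit u) = u := by
  rcases Int.units_eq_one_or u with rfl | rfl <;> simp [bit, unitOf]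

lemma xnor_le (a b : ℕ) : xnor a b ≤ 1 := by simp [xnor]

lemma unitOf_xnor {a b : ℕ} (ha : a ≤ 1) (hb : b ≤ 1) :
    unitOf (xnor a b) = unitOf a * unitOf b := by
  interval_cases a <;> interval_cases b <;> simp [xnor, unitOf]

lemma tens_le {S : List ℕ} (d : ℕ) : ∀ b ∈ tens S d, b ≤ 1 := by
  induction d with
  | zero => simp [tens]
  | succ d ih =>
    intro b hb
    simp only [tens, List.mem_append, List.mem_flatMap, List.mem_map] at hb
    rcases hb with hb | ⟨c, -, a, -, rfl⟩
    · exact ih b hb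
    · exact xnor_le _ _

/-- A linear functional on vectors of signs that are given by lists of bits. -/
def lin (W : List ℝ) (L : List ℕ) : ℝ := (List.zipWith (fun c b => c * rs (unitOf b)) W L).sum

lemma lin_append {W W' : List ℝ} {L L' : List ℕ} (h : W.length = L.length) :
    lin (W ++ W') (L ++ L') = lin W L + lin W' L' := by
  rw [lin, List.zipWith_append h, List.sum_append]
  rfl

lemma lin_mul (c : ℝ) (W : List ℝ) (L : List ℕ) : lin (W.map fun x => c * x) L = c * lin W L := by
  induction W generalizing L with
  | nil => simp [lin]
  | cons x W ih =>
    cases L with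
    | nil => simp [lin]
    | cons b L =>
      have := ih L
      simp only [lin, List.map_cons, List.zipWith_cons_cons, List.sum_cons] at this ⊢
      rw [this]
      ring

lemma lin_add {W W' : List ℝ} (L : List ℕ) (h : W.length = W'.length) :
    lin (List.zipWith (· + ·) W W') L = lin W L + lin W' L := by
  induction W generalizing L W' with
  | nil => cases W' <;> simp_all [lin]
  | cons x W ih =>
    cases W' with
    | nil => simp at h
    | cons x' W' =>
      cases L with
      | nil => simp [lin]
      | cons b L =>
        have := ih (W' := W') L (by simpa using h)
        simp only [lin, List.zipWith_cons_cons, List.sum_cons] at this ⊢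
        rw [this]
        ring

lemma lin_xnor {W : List ℝ} {L : List ℕ} {b : ℕ} (hb : b ≤ 1) (hL : ∀ a ∈ L, a ≤ 1) :
    lin W (L.map fun a => xnor a b) = rs (unitOf b) * lin W L := by
  induction W generalizing L with
  | nil => simp [lin]
  | cons x W ih =>
    cases L with
    | nil => simp [lin]
    | cons a L =>
      have := ih (L := L) fun a ha => hL a (by simp [ha])
      simp only [lin, List.map_cons, List.zipWith_cons_cons, List.sum_cons] at this ⊢
      rw [this, unitOf_xnor (hL a (by simp)) hb, rs_mul]
      ring

lemma lin_zeros (k : ℕ) (L : List ℕ) : lin (List.replicate k 0) L = 0 := by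
  induction k generalizing L with
  | zero => simp [lin]
  | succ k ih =>
    cases L with
    | nil => simp [lin]
    | cons b L =>
      have := ih L
      simp only [lin, List.replicate_succ, List.zipWith_cons_cons, List.sum_cons] at this ⊢
      rw [this]
      simp

lemma lin_eq_sum {N : ℕ} {W : List ℝ} {L : List ℕ} (hW : W.length = N) (hL : L.length = N) :
    lin W L = ∑ i : Fin N, W.getD i 0 * rs (unitOf (L.getD i 0)) := by
  induction N generalizing W L with
  | zero =>
    rw [List.length_eq_zero_iff] at hW
    simp [hW, lin]
  | succ N ih =>
    obtain ⟨x, W, rfl⟩ := List.exists_cons_of_length_eq_add_one hW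
    obtain ⟨b, L, rfl⟩ := List.exists_cons_of_length_eq_add_one hL
    have := ih (W := W) (L := L) (by simpa using hW) (by simpa using hL)
    rw [Fin.sum_univ_succ]
    simp only [Fin.val_succ, Fin.val_zero, List.getD_cons_succ, List.getD_cons_zero]
    rw [← this]
    simp [lin]

/-- Functions on `{±1}^ℓ` that are linear functionals of the `d`-th tensor power. -/
def Repr (ℓ d : ℕ) (F : List ℕ → ℝ) : Prop :=
  ∃ W : List ℝ, W.length = (ℓ + 1) ^ d ∧
    ∀ S : List ℕ, S.length = ℓ → (∀ b ∈ S, b ≤ 1) → lin W (tens S d) = F S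

lemma Repr.const (ℓ d : ℕ) (c : ℝ) : Repr ℓ d fun _ => c := by
  induction d with
  | zero => exact ⟨[c], by simp, fun S _ _ => by simp [lin, tens, unitOf]⟩
  | succ d ih =>
    obtain ⟨W, hW, h⟩ := ih
    refine ⟨W ++ List.replicate (ℓ * (ℓ + 1) ^ d) 0, ?_, fun S hS hb => ?_⟩
    · simp [hW]; ring
    · rw [tens, lin_append (by rw [hW, length_tens, hS]), h S hS hb, lin_zeros, add_zero]

lemma Repr.add {ℓ d : ℕ} {F G : List ℕ → ℝ} (hF : Repr ℓ d F) (hG : Repr ℓ d G) :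
    Repr ℓ d fun S => F S + G S := by
  obtain ⟨W, hW, h⟩ := hF
  obtain ⟨W', hW', h'⟩ := hG
  refine ⟨List.zipWith (· + ·) W W', by simp [hW, hW'], fun S hS hb => ?_⟩
  rw [lin_add _ (by rw [hW, hW']), h S hS hb, h' S hS hb]

lemma lin_flatMap {W : List ℝ} {L : List ℕ} (hWL : W.length = L.length) (hL : ∀ a ∈ L, a ≤ 1)
    {c : List ℝ} {S : List ℕ} (hc : c.length = S.length) (hS : ∀ b ∈ S, b ≤ 1) :
    lin (c.flatMap fun x => W.map fun y => x * y) (S.flatMap fun b => L.map fun a => xnor a b) =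
      lin c S * lin W L := by
  induction c generalizing S with
  | nil => simp [lin]
  | cons x c ih =>
    cases S with
    | nil => simp at hc
    | cons b S =>
      have := ih (S := S) (by simpa using hc) fun b hb => hS b (by simp [hb])
      simp only [List.flatMap_cons]
      rw [lin_append (by simp [hWL]), this, lin_mul, lin_xnor (hS b (by simp)) hL]
      simp only [lin, List.zipWith_cons_cons, List.sum_cons]
      ring

lemma Repr.mul {ℓ d : ℕ} {F : List ℕ → ℝ} (hF : Repr ℓ d F) (c₀ : ℝ) {c : List ℝ}
    (hc : c.length = ℓ) : Repr ℓ (d + 1) fun S => (c₀ + lin c S) * F S := by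
  obtain ⟨W, hW, h⟩ := hF
  refine ⟨W.map (fun y => c₀ * y) ++ c.flatMap fun x => W.map fun y => x * y, ?_,
    fun S hS hb => ?_⟩
  · simp [List.length_flatMap, hW, hc]; ring
  · have hlen : W.length = (tens S d).length := by rw [hW, length_tens, hS]
    rw [tens, lin_append (by simpa using hlen), lin_mul,
      lin_flatMap hlen (tens_le d) (by rw [hc, hS]) hb, h S hS hb]
    ring

lemma Repr.polynomial {ℓ d : ℕ} (p : Polynomial ℝ) (hp : p.natDegree ≤ d) (c₀ : ℝ) {c : List ℝ}
    (hc : c.length = ℓ) : Repr ℓ d fun S => p.eval (c₀ + lin c S) := by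
  induction d generalizing p with
  | zero =>
    rw [Polynomial.eq_C_of_natDegree_le_zero hp]
    simpa using Repr.const ℓ 0 _
  | succ d ih =>
    have h1 := ih p.divX (by rw [Polynomial.natDegree_divX_eq_natDegree_tsub_one]; omega)
    have h2 := (h1.mul c₀ hc).add (Repr.const ℓ (d + 1) (p.coeff 0))
    convert h2 using 2 with S
    have := congrArg (Polynomial.eval (c₀ + lin c S)) (Polynomial.divX_mul_X_add p)
    rw [← this]
    simp only [Polynomial.eval_add, Polynomial.eval_mul, Polynomial.eval_X, Polynomial.eval_C]
    ring

section Literals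

variable {n K : ℕ}

/-- The value of a literal under an assignment. -/
def litVal (ψ : Fin n → ℤˣ) (p : ℕ) : ℝ :=
  if h : p / 2 < n then rs (unitOf (p % 2)) * rs (ψ ⟨p / 2, h⟩) else 0

lemma bit_le (u : ℤˣ) : bit u ≤ 1 := by
  rcases Int.units_eq_one_or u with rfl | rfl <;> simp [bit]

lemma litVal_lit (ψ : Fin n → ℤˣ) (v : Fin n) (u : ℤˣ) :
    litVal ψ (v + v + bit u) = rs (u * ψ v) := by
  have hb := bit_le u
  have h1 : ((v : ℕ) + v + bit u) / 2 = v := by omega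
  have h2 : ((v : ℕ) + v + bit u) % 2 = bit u := by omega
  have h : ((v : ℕ) + v + bit u) / 2 < n := by rw [h1]; exact v.isLt
  rw [litVal, dif_pos h, h2, unitOf_bit, rs_mul]
  congr

lemma litBit_eq_sum (C : KTuple n K) (p : ℕ) :
    (litBit C p : ℝ) = ∑ i, if p = C.1 i + C.1 i + bit (C.2 i) then 1 else 0 := by
  by_cases h : ∃ i, p = C.1 i + C.1 i + bit (C.2 i)
  · obtain ⟨i, hi⟩ := h
    rw [litBit, if_pos ⟨i, hi⟩, Finset.sum_eq_single i]
    · simp [hi]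
    · intro i' _ hi'
      rw [if_neg]
      intro h'
      apply hi'
      apply C.1.injective
      have := bit_le (C.2 i)
      have := bit_le (C.2 i')
      apply Fin.ext
      omega
    · simp
  · rw [litBit, if_neg h, Finset.sum_eq_zero]
    · simp
    · intro i _
      rw [if_neg fun h' => h ⟨i, h'⟩]

lemma sum_litVal (C : KTuple n K) (ψ : Fin n → ℤˣ) :
    ∑ p ∈ Finset.range (n + n), litVal ψ p * litBit C p = litSum C ψ := by
  simp only [litBit_eq_sum, Finset.mul_sum]
  rw [Finset.sum_comm, rs_litSum]
  refine Finset.sum_congr rfl fun i _ => ?_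
  rw [Finset.sum_eq_single (C.1 i + C.1 i + bit (C.2 i) : ℕ)]
  · simp [litVal_lit, KTuple.apply]
  · intro p _ hp
    simp [hp]
  · intro h
    exfalso
    apply h
    have := bit_le (C.2 i)
    have := (C.1 i).isLt
    rw [Finset.mem_range]
    omega

lemma litBit_le (C : KTuple n K) (p : ℕ) : litBit C p ≤ 1 := by
  unfold litBit
  split_ifs <;> simp

lemma rs_unitOf {b : ℕ} (hb : b ≤ 1) : rs (unitOf b) = 2 * b - 1 := by
  interval_cases b <;> simp [unitOf]; norm_num

/-- The sum of the literals is an affine functional of the literal vector. -/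
lemma exists_lin_litVec (ψ : Fin n → ℤˣ) : ∃ (c₀ : ℝ) (c : List ℝ), c.length = n + n ∧
    ∀ {K : ℕ} (C : KTuple n K), c₀ + lin c (litVec C) = litSum C ψ := by
  refine ⟨∑ p ∈ Finset.range (n + n), litVal ψ p / 2,
    (List.range (n + n)).map fun p => litVal ψ p / 2, by simp, fun {K} C => ?_⟩
  have : lin ((List.range (n + n)).map fun p => litVal ψ p / 2) (litVec C) =
      ∑ p ∈ Finset.range (n + n), litVal ψ p / 2 * rs (unitOf (litBit C p)) := by
    rw [lin, litVec, List.zipWith_map, List.zipWith_self]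
    rfl
  rw [this, ← sum_litVal, ← Finset.sum_add_distrib]
  refine Finset.sum_congr rfl fun p _ => ?_
  rw [rs_unitOf (litBit_le C p)]
  ring

end Literals

/-! ### Parity as a polynomial -/

lemma exists_parity {K : ℕ} (z : Fin K → ℤˣ) : ∃ k : ℕ, ∑ i, (z i : ℤ) = K - 2 * k ∧
    xor z = (-1) ^ k := by
  induction K with
  | zero => exact ⟨0, by simp, by simp [xor]⟩
  | succ K ih =>
    obtain ⟨k, h1, h2⟩ := ih fun i => z i.succ
    rw [xor] at h2 ⊢
    rw [Fin.sum_univ_succ, Fin.prod_univ_succ, h1, h2]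
    rcases Int.units_eq_one_or (z 0) with h | h
    · exact ⟨k, by simp [h]; ring, by simp [h]⟩
    · exact ⟨k + 1, by simp [h]; ring, by simp [h, pow_succ]⟩

lemma exists_polynomial_parity (K d : ℕ) : ∃ p : Polynomial ℝ, p.natDegree ≤ d ∧
    ∀ z : Fin K → ℤˣ, |∑ i, (z i : ℤ)| ≤ d → p.eval ((∑ i, (z i : ℤ) : ℤ) : ℝ) = rs (xor z) := by
  set s := (Finset.Icc (-(d : ℤ)) d).filter fun x => x % 2 = (K : ℤ) % 2 with hs
  set r : ℤ → ℝ := fun x => rs ((-1) ^ (((K : ℤ) - x) / 2).toNat) with hr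
  have hinj : Set.InjOn (fun x : ℤ => (x : ℝ)) s := fun x _ y _ h => Int.cast_injective h
  refine ⟨Lagrange.interpolate s (fun x : ℤ => (x : ℝ)) r, ?_, fun z hz => ?_⟩
  · have h1 := Lagrange.degree_interpolate_lt r hinj
    have h2 : s.card ≤ d + 1 := by
      rw [← Finset.card_range (d + 1)]
      refine Finset.card_le_card_of_injOn (fun x => ((x + d) / 2).toNat) ?_ ?_
      · intro x hx
        simp only [hs, Finset.coe_filter, Finset.mem_Icc, Set.mem_ofPred_eq] at hx
        simp only [Finset.coe_range, Set.mem_Iio]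
        omega
      · intro x hx y hy hxy
        simp only [hs, Finset.coe_filter, Finset.mem_Icc, Set.mem_ofPred_eq] at hx hy hxy
        omega
    by_cases h0 : Lagrange.interpolate s (fun x : ℤ => (x : ℝ)) r = 0
    · simp [h0]
    · have := (Polynomial.natDegree_lt_iff_degree_lt h0).2 h1
      omega
  · obtain ⟨k, h1, h2⟩ := exists_parity z
    have hmem : ∑ i, (z i : ℤ) ∈ s := by
      rw [hs, Finset.mem_filter, Finset.mem_Icc]
      rw [abs_le] at hz
      exact ⟨hz, by omega⟩
    have := Lagrange.eval_interpolate_at_node r hinj hmem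
    rw [this, hr, h2]
    simp only
    congr 2
    omega

/-! ### Formulas of large value give almost realizable distributions -/

section Flip

variable {n K : ℕ}

lemma flip_apply (C : KTuple n K) (u : ℤˣ) (ψ : Fin n → ℤˣ) (i : Fin K) :
    (C.flip u).apply ψ i = if (i : ℕ) = 0 then u * C.apply ψ i else C.apply ψ i := by
  simp only [KTuple.apply, KTuple.flip]
  split_ifs
  · rw [mul_assoc]
  · rfl

lemma xor_flip (hK : 1 ≤ K) (C : KTuple n K) (u : ℤˣ) (ψ : Fin n → ℤˣ) :
    xor ((C.flip u).apply ψ) = u * xor (C.apply ψ) := by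
  obtain ⟨K, rfl⟩ := Nat.exists_eq_add_of_le' hK
  simp only [xor, Fin.prod_univ_succ, flip_apply]
  simp [mul_assoc]

lemma abs_litSum_flip_le (C : KTuple n K) (u : ℤˣ) (ψ : Fin n → ℤˣ) :
    |litSum (C.flip u) ψ| ≤ |litSum C ψ| + 2 := by
  cases K with
  | zero => simp [litSum]
  | succ K =>
    simp only [litSum, Fin.sum_univ_succ, flip_apply]
    simp only [Fin.val_zero, if_true, Fin.val_succ, Nat.succ_ne_zero, if_false]
    generalize ∑ i : Fin K, ((C.apply ψ i.succ : ℤˣ) : ℤ) = x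
    rcases Int.units_eq_one_or u with rfl | rfl <;>
      rcases Int.units_eq_one_or (C.apply ψ 0) with h | h <;> rw [h] <;> simp <;>
      grind

end Flip

lemma lin_flatten {α : Type} {W : List ℝ} {f : α → List ℕ} (l : List α)
    (h : ∀ a ∈ l, W.length = (f a).length) :
    lin (List.replicate l.length W).flatten (l.flatMap f) = (l.map fun a => lin W (f a)).sum := by
  induction l with
  | nil => simp [lin]
  | cons a l ih =>
    rw [List.length_cons, List.replicate_succ, List.flatten_cons, List.flatMap_cons,
      lin_append (h a (by simp)), ih fun b hb => h b (by simp [hb])]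
    simp

lemma exists_weights {n : ℕ} (K d : ℕ) (ψ : Fin n → ℤˣ) :
    ∃ W : List ℝ, W.length = (n + n + 1) ^ d ∧ ∀ (C : KTuple n K) (u : ℤˣ),
      |litSum (C.flip u) ψ| ≤ d → lin W (block d u C) = rs (xor ((C.flip u).apply ψ)) := by
  obtain ⟨c₀, c, hc, h⟩ := exists_lin_litVec ψ
  obtain ⟨p, hp, hp'⟩ := exists_polynomial_parity K d
  obtain ⟨W, hW, hW'⟩ := Repr.polynomial p hp c₀ hc
  refine ⟨W, hW, fun C u hu => ?_⟩
  rw [block, hW' _ (by simp [litVec])]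
  · simp only
    rw [h, litSum, hp' _ hu]
  · intro b hb
    obtain ⟨p, -, rfl⟩ := List.mem_map.1 hb
    exact litBit_le _ _

/-- The point of the cube given by a list of bits. -/
def cubeOf (N : ℕ) (L : List ℕ) : Cube N := fun i => unitOf (L.getD i 0)

lemma ofFn_cubeOf {N : ℕ} {L : List ℕ} (hN : L.length = N) (hL : ∀ b ∈ L, b ≤ 1) :
    List.ofFn (fun i => bit (cubeOf N L i)) = L := by
  subst hN
  refine List.ext_getElem (by simp) fun i h1 h2 => ?_
  rw [List.getElem_ofFn]
  simp only [cubeOf]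
  rw [List.getD_eq_getElem _ _ h2, bit_unitOf (hL _ (List.getElem_mem h2))]

section Law

variable {n K m : ℕ} (J : KFormula n K m) (d q : ℕ)

lemma length_flatMap_block {q : ℕ} {l : List (Fin m)} (hl : l.length = q) (u : ℤˣ) :
    (l.flatMap fun j => block d u (J j)).length = q * (n + n + 1) ^ d := by
  simp [List.length_flatMap, length_block, hl]

lemma flatMap_block_le (l : List (Fin m)) (u : ℤˣ) :
    ∀ b ∈ l.flatMap fun j => block d u (J j), b ≤ 1 := by
  intro b hb
  obtain ⟨j, -, hb⟩ := List.mem_flatMap.1 hb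
  exact tens_le d b hb

lemma exists_valAt_eq_val (J : KFormula n K m) : ∃ ψ, valAt J ψ = val J :=
  exists_eq_ciSup_of_finite

open Classical in
/-- The majority of the parities of `l` is computed by a halfspace. -/
lemma exists_halfspace {q D : ℕ} (hK : 1 ≤ K) (ψ : Fin n → ℤˣ) :
    ∃ w : Fin (q * (n + n + 1) ^ (D + 1)) → ℝ, ∀ (l : List (Fin m)) (u : ℤˣ), l.length = q →
      (∀ j ∈ l, |litSum (J j) ψ| < D) →
      2 * (l.countP fun j => xor ((J j).apply ψ) ≠ 1) < q →
      halfspace w (cubeOf _ (l.flatMap fun j => block (D + 1) u (J j))) = u := by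
  obtain ⟨W, hW, h⟩ := exists_weights K (D + 1) ψ
  refine ⟨fun i => (List.replicate q W).flatten.getD i 0, fun l u hl hlit hcount => ?_⟩
  have h1 : ∑ i : Fin (q * (n + n + 1) ^ (D + 1)), (List.replicate q W).flatten.getD i 0 *
      rs (cubeOf _ (l.flatMap fun j => block (D + 1) u (J j)) i) =
      rs u * (l.map fun j => rs (xor ((J j).apply ψ))).sum := by
    refine (lin_eq_sum (by simp [hW]) (length_flatMap_block J _ hl u)).symm.trans ?_
    rw [← hl, lin_flatten l fun j _ => by rw [hW, length_block], ← List.sum_map_mul_left]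
    congr 1
    refine List.map_congr_left fun j hj => ?_
    rw [h, xor_flip hK, rs_mul]
    have := abs_litSum_flip_le (J j) u ψ
    have := hlit j hj
    push_cast
    linarith
  have h2 : ∀ l : List (Fin m), (l.map fun j => rs (xor ((J j).apply ψ))).sum =
      l.length - 2 * (l.countP fun j => xor ((J j).apply ψ) ≠ 1) := by
    intro l
    induction l with
    | nil => simp
    | cons j l ih =>
      rw [List.map_cons, List.sum_cons, ih, List.countP_cons, List.length_cons]
      rcases Int.units_eq_one_or (xor ((J j).apply ψ)) with hx | hx
      · simp [hx]; ring
      · simp [hx]; ring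
  have h3 : (0 : ℝ) < (l.map fun j => rs (xor ((J j).apply ψ))).sum := by
    rw [h2, hl, sub_pos]
    exact_mod_cast hcount
  rcases Int.units_eq_one_or u with rfl | rfl
  · refine if_pos ?_
    rw [h1]
    simpa using h3.le
  · refine if_neg ?_
    rw [h1]
    simpa using h3

variable [NeZero m]

/-- The distribution on the cube whose examples are distributed according to `exampleLaw`. -/
def exampleDist : PMF (Cube (q * (n + n + 1) ^ d) × ℤˣ) :=
  coin.bind fun y => (iid (idxLaw m) q).map fun l =>
    (cubeOf _ (l.flatMap fun j => block d (sgn y) (J j)), sgn y)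

lemma examples_exampleDist : examples (exampleDist J d q) = exampleLaw J d q := by
  rw [examples, exampleDist, exampleLaw, map_bind']
  congr 1
  ext y : 1
  rw [PMF.map_comp, ← PMF.bind_pure_comp, ← PMF.bind_pure_comp]
  refine pmf_bind_congr _ fun l hl => ?_
  simp only [Function.comp_apply]
  rw [ofFn_cubeOf (length_flatMap_block J d (length_of_mem_iid hl) _) (flatMap_block_le J d l _),
    bit_sgn]

variable {J d q}

lemma pr_idxLaw_le {S : Finset (Fin m)} {c : ℝ} (hS : (S.card : ℝ) * (1 + m / 2 ^ m) ≤ c * m) :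
    pr (idxLaw m) S ≤ ENNReal.ofReal c := by
  have hm : (0 : ℝ) < m := by exact_mod_cast Nat.pos_of_ne_zero (NeZero.ne m)
  rw [pr, PMF.toOuterMeasure_apply_finset]
  calc ∑ j ∈ S, idxLaw m j ≤ ∑ j ∈ S, ENNReal.ofReal (1 / m + 1 / 2 ^ m) :=
        Finset.sum_le_sum fun j _ => idxLaw_le m j
    _ = ENNReal.ofReal (S.card * (1 / m + 1 / 2 ^ m)) := by
        rw [Finset.sum_const, nsmul_eq_mul, ENNReal.ofReal_mul (by positivity),
          ENNReal.ofReal_natCast]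
    _ ≤ ENNReal.ofReal c := by
        refine ENNReal.ofReal_le_ofReal ?_
        refine le_of_mul_le_mul_right ?_ hm
        calc (S.card : ℝ) * (1 / m + 1 / 2 ^ m) * m = S.card * (1 + m / 2 ^ m) := by
              field_simp
          _ ≤ c * m := hS

open Classical in
lemma pr_majority_le {S : Set (Fin m)} {η : ℝ} (hη : 0 < η) (hη' : η ≤ 1 / 2)
    (hS : pr (idxLaw m) S ≤ ENNReal.ofReal η) :
    pr (iid (idxLaw m) q) {l | q ≤ 2 * l.countP fun j => j ∈ S} ≤
      ENNReal.ofReal ((1 / 2 + 2 * η * (1 - η)) ^ q) := by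
  set μ := 1 / (2 * η) with hμ
  have hμ1 : 1 ≤ μ := by
    rw [hμ, le_div_iff₀ (by positivity)]
    linarith
  have hμ0 : 0 < μ := by linarith
  refine (pr_iid_count_le (idxLaw m) S hμ0.le (inv_nonneg.2 hμ0.le) one_pos q
    fun l hl hlen => ?_).trans ?_
  · simp only [Set.mem_ofPred_eq] at hl
    set c := l.countP fun j => decide (j ∈ S) with hc
    have hcq : c ≤ q := hlen ▸ List.countP_le_length
    have : μ ^ c * μ⁻¹ ^ (q - c) = μ ^ (c - (q - c)) := by
      rw [inv_pow, ← div_eq_mul_inv, div_eq_iff (by positivity), ← pow_add]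
      congr 1
      omega
    rw [this]
    exact one_le_pow₀ hμ1
  · refine ENNReal.ofReal_le_ofReal ?_
    rw [div_one]
    have hπ : (pr (idxLaw m) S).toReal ≤ η := ENNReal.toReal_le_of_le_ofReal hη.le hS
    have hμ2 : μ⁻¹ ≤ μ := (inv_le_one_of_one_le₀ hμ1).trans hμ1
    have hinv : μ⁻¹ = 2 * η := by rw [hμ, one_div, inv_inv]
    have hμη : μ * η = 1 / 2 := by rw [hμ]; field_simp
    have h0 : 0 ≤ (pr (idxLaw m) S).toReal := ENNReal.toReal_nonneg
    refine pow_le_pow_left₀ ?_ ?_ q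
    · have := mul_nonneg hμ0.le h0
      have := mul_nonneg (inv_nonneg.2 hμ0.le) (show 0 ≤ 1 - (pr (idxLaw m) S).toReal by linarith)
      linarith
    · have h1 := mul_le_mul_of_nonneg_left hπ (sub_nonneg.2 hμ2)
      have h2 : (μ - μ⁻¹) * η + μ⁻¹ = 1 / 2 + 2 * η * (1 - η) := by
        rw [sub_mul, hμη, hinv]
        ring
      linarith

open Classical in
/-- If a formula passes the correlation test, then its distribution of examples is almost
realizable. -/
theorem errHalf_exampleDist_le {t D : ℕ} {η η' : ℝ} (hη : 0 < η') (hη' : η' ≤ 1 / 2) (hK : 1 ≤ K)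
    (ht : 1 ≤ t) (hηη : η * (1 + m / 2 ^ m) ≤ η') (hJ : corr J ≤ (m + n * 2 ^ K) * m)
    (h : n ^ (2 * t + 1) * 2 ^ K * K ^ (4 * t) ≤ m) (hD : 12 * K * t ≤ D ^ 2)
    (hval : 1 - η ≤ val J) :
    errHalf (exampleDist J (D + 1) q) ≤ 6 * q / 2 ^ t + (1 / 2 + 2 * η' * (1 - η')) ^ q := by
  have hm1 : 1 ≤ m := Nat.pos_of_ne_zero (NeZero.ne m)
  have hm : (0 : ℝ) < m := by exact_mod_cast hm1
  have hm2 : 1 + (m : ℝ) / 2 ^ m ≤ 2 := by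
    have : (m : ℝ) / 2 ^ m ≤ 1 := by
      rw [div_le_one (by positivity)]
      exact_mod_cast Nat.lt_two_pow_self.le
    linarith
  obtain ⟨ψ, hψ⟩ := exists_valAt_eq_val J
  obtain ⟨w, hw⟩ := exists_halfspace (J := J) (q := q) (D := D) hK ψ
  refine (ciInf_le ⟨0, ?_⟩ w).trans ?_
  · rintro _ ⟨w, rfl⟩
    exact ENNReal.toReal_nonneg
  set S : Finset (Fin m) := Finset.univ.filter fun j => (D : ℤ) ≤ |litSum (J j) ψ| with hS
  set U : Finset (Fin m) := Finset.univ.filter fun j => xor ((J j).apply ψ) ≠ 1 with hU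
  have h1 : pr (idxLaw m) S ≤ ENNReal.ofReal (6 / 2 ^ t) := by
    refine pr_idxLaw_le ?_
    have := card_litSum_le hK ht hm1 hJ h hD ψ
    rw [← hS] at this
    calc (S.card : ℝ) * (1 + m / 2 ^ m) ≤ S.card * 2 := by gcongr
      _ = S.card * 2 ^ t * 2 / 2 ^ t := by field_simp
      _ ≤ 3 * m * 2 / 2 ^ t := by gcongr
      _ = _ := by ring
  have h2 : pr (idxLaw m) U ≤ ENNReal.ofReal η' := by
    refine pr_idxLaw_le ?_
    have hU' : (U.card : ℝ) ≤ η * m := by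
      have h3 : Set.ncard {j : Fin m | xor ((J j).apply ψ) = 1} + U.card = m := by
        rw [Set.ncard_eq_toFinset_card', hU, Set.toFinset_ofPred]
        simpa using Finset.card_filter_add_card_filter_not (s := Finset.univ)
          fun j : Fin m => xor ((J j).apply ψ) = 1
      rw [← hψ, valAt, le_div_iff₀ hm] at hval
      have h3' : (Set.ncard {j : Fin m | xor ((J j).apply ψ) = 1} : ℝ) + U.card = m := by
        exact_mod_cast h3
      linarith
    calc (U.card : ℝ) * (1 + m / 2 ^ m) ≤ η * m * (1 + m / 2 ^ m) := by gcongr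
      _ = η * (1 + m / 2 ^ m) * m := by ring
      _ ≤ η' * m := by gcongr
  obtain ⟨V, hV⟩ : ∃ V : Set (Fin m), V = U := ⟨_, rfl⟩
  rw [← hV] at h2
  have hρ : 0 ≤ 1 / 2 + 2 * η' * (1 - η') := by nlinarith
  rw [err]
  refine ENNReal.toReal_le_of_le_ofReal (by positivity) ?_
  rw [exampleDist]
  change pr _ _ ≤ _
  rw [pr_bind, ← pexp_const coin (ENNReal.ofReal _)]
  refine pexp_mono _ fun y _ => ?_
  rw [pr_map]
  refine le_trans (pr_mono _ (T := {l | ∃ j ∈ l, j ∈ (S : Set (Fin m))} ∪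
    {l | q ≤ 2 * l.countP fun j => j ∈ V}) fun l hl hl' => ?_) ?_
  · by_contra hcon
    rw [Set.mem_union, not_or] at hcon
    obtain ⟨hc1, hc2⟩ := hcon
    simp only [Set.mem_ofPred_eq, not_exists, not_and, not_le, hS, Finset.coe_filter,
      Finset.mem_univ, true_and] at hc1
    rw [Set.mem_ofPred_eq, not_le] at hc2
    have hc : (l.countP fun j => xor ((J j).apply ψ) ≠ 1) =
        l.countP fun j => j ∈ V := List.countP_congr fun j _ => by simp [hV, hU]
    rw [Set.mem_preimage, Set.mem_ofPred_eq] at hl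
    refine hl (hw l (sgn y) (length_of_mem_iid hl') hc1 ?_)
    rw [hc]
    exact hc2
  · refine (pr_union_le _ _ _).trans ?_
    rw [ENNReal.ofReal_add (by positivity) (by positivity)]
    refine add_le_add ((pr_iid_exists _ _ _).trans ?_)
      (pr_majority_le hη hη' h2)
    refine (mul_le_mul_right h1 _).trans (le_of_eq ?_)
    rw [← ENNReal.ofReal_natCast, ← ENNReal.ofReal_mul (by positivity)]
    congr 1
    ring

end Law

/-! ### Testing a hypothesis on fresh examples -/

section Test

variable (O : PMF (List ℕ)) (ev : List ℕ → ℕ) (N : ℕ) {W : ℕ}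

open Classical in
lemma pr_test_fails_le (hW : 1 ≤ W)
    (h : (pr O {l | ev l ≠ l.getD N 0}).toReal ≤ 1 / 2 - 1 / W) :
    pr (iid O (W ^ 3)) {τ | ¬ 2 * errCount ev N τ + W ^ 2 ≤ W ^ 3} ≤
      ENNReal.ofReal (Real.exp (-(W / 4))) := by
  have hW' : (1 : ℝ) ≤ W := by exact_mod_cast hW
  have hW0 : (0 : ℝ) < W := by linarith
  obtain ⟨S, hS⟩ : ∃ S : Set (List ℕ), S = {l | ev l ≠ l.getD N 0} := ⟨_, rfl⟩
  rw [← hS] at h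
  set u : ℝ := 1 / (2 * W) with hu
  have hu0 : 0 < u := by positivity
  have hu1 : u ≤ 1 / 2 := by
    rw [hu, div_le_div_iff₀ (by positivity) (by norm_num)]
    linarith
  refine (pr_iid_count_le O S (x := Real.exp u) (y := Real.exp (-u)) (c := Real.exp (-(u * W ^ 2)))
    (Real.exp_pos _).le (Real.exp_pos _).le (Real.exp_pos _) (W ^ 3) fun τ hτ hlen => ?_).trans
    (ENNReal.ofReal_le_ofReal ?_)
  · have hc : errCount ev N τ = τ.countP fun l => l ∈ S :=
      List.countP_congr fun l _ => by simp [hS]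
    rw [Set.mem_ofPred_eq, not_le, hc] at hτ
    set c := τ.countP fun l => decide (l ∈ S) with hc'
    have hcW : c ≤ W ^ 3 := hlen ▸ List.countP_le_length
    rw [← Real.exp_nat_mul, ← Real.exp_nat_mul, ← Real.exp_add, Real.exp_le_exp]
    have hτ' : ((W : ℝ) ^ 3) ≤ 2 * c + W ^ 2 := by exact_mod_cast hτ.le
    rw [Nat.cast_sub hcW]
    push_cast
    have := mul_le_mul_of_nonneg_left hτ' hu0.le
    linarith
  · set π := (pr O S).toReal with hπ
    have hπ0 : 0 ≤ π := ENNReal.toReal_nonneg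
    have hπ1 : π ≤ 1 / 2 - 1 / W := h
    have hsinh : u ≤ Real.sinh u := Real.self_le_sinh_iff.2 hu0.le
    have hcosh : Real.cosh u ≤ 1 + u ^ 2 := by
      refine (Real.cosh_le_exp_half_sq u).trans ?_
      have h1 : |u ^ 2 / 2| ≤ 1 := by
        rw [abs_of_nonneg (by positivity)]
        nlinarith
      have h2 := Real.abs_exp_sub_one_sub_id_le h1
      have h3 := (abs_le.1 h2).2
      have h4 : u ^ 2 ≤ 1 := by nlinarith
      nlinarith [mul_le_mul_of_nonneg_left h4 (sq_nonneg u)]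
    have hmgf : Real.exp u * π + Real.exp (-u) * (1 - π) ≤ Real.exp (u ^ 2 - 2 * u / W) := by
      have h1 : Real.exp u * π + Real.exp (-u) * (1 - π) =
          Real.cosh u - (1 - 2 * π) * Real.sinh u := by
        rw [Real.cosh_eq, Real.sinh_eq]
        ring
      have h2 := Real.add_one_le_exp (u ^ 2 - 2 * u / W)
      have h3 : 2 / (W : ℝ) * u ≤ (1 - 2 * π) * Real.sinh u := by
        refine mul_le_mul ?_ hsinh hu0.le ?_
        · have : 2 / (W : ℝ) = 2 * (1 / W) := by ring
          linarith
        · have : 0 < 1 / (W : ℝ) := by positivity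
          linarith
      have h4 : 2 / (W : ℝ) * u = 2 * u / W := by ring
      linarith
    have hpos : 0 ≤ Real.exp u * π + Real.exp (-u) * (1 - π) := by
      have : 0 < 1 / (W : ℝ) := by positivity
      have h1 : 0 ≤ 1 - π := by linarith
      positivity
    calc (Real.exp u * π + Real.exp (-u) * (1 - π)) ^ W ^ 3 / Real.exp (-(u * W ^ 2))
        ≤ Real.exp (u ^ 2 - 2 * u / W) ^ W ^ 3 / Real.exp (-(u * W ^ 2)) := by gcongr
      _ = Real.exp (-(W / 4)) := by
        rw [← Real.exp_nat_mul, ← Real.exp_sub, hu]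
        congr 1
        push_cast
        field_simp
        ring

open Classical in
lemma pr_test_passes_le (hW : 1 ≤ W)
    (h : pr O {l | ev l ≠ l.getD N 0} = ENNReal.ofReal (1 / 2)) :
    pr (iid O (W ^ 3)) {τ | 2 * errCount ev N τ + W ^ 2 ≤ W ^ 3} ≤
      ENNReal.ofReal (Real.exp (-(W / 2))) := by
  have hW' : (1 : ℝ) ≤ W := by exact_mod_cast hW
  have hW0 : (0 : ℝ) < W := by linarith
  obtain ⟨S, hS⟩ : ∃ S : Set (List ℕ), S = {l | ev l ≠ l.getD N 0} := ⟨_, rfl⟩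
  rw [← hS] at h
  set u : ℝ := 1 / W with hu
  have hu0 : 0 < u := by positivity
  refine (pr_iid_count_le O S (x := Real.exp (-u)) (y := Real.exp u) (c := Real.exp (u * W ^ 2))
    (Real.exp_pos _).le (Real.exp_pos _).le (Real.exp_pos _) (W ^ 3) fun τ hτ hlen => ?_).trans
    (ENNReal.ofReal_le_ofReal ?_)
  · have hc : errCount ev N τ = τ.countP fun l => l ∈ S :=
      List.countP_congr fun l _ => by simp [hS]
    rw [Set.mem_ofPred_eq, hc] at hτ
    set c := τ.countP fun l => decide (l ∈ S) with hc'
    have hcW : c ≤ W ^ 3 := hlen ▸ List.countP_le_length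
    rw [← Real.exp_nat_mul, ← Real.exp_nat_mul, ← Real.exp_add, Real.exp_le_exp]
    have hτ' : 2 * c + (W : ℝ) ^ 2 ≤ (W : ℝ) ^ 3 := by exact_mod_cast hτ
    rw [Nat.cast_sub hcW]
    push_cast
    have := mul_le_mul_of_nonneg_left hτ' hu0.le
    linarith
  · rw [h, ENNReal.toReal_ofReal (by norm_num)]
    have hmgf : Real.exp (-u) * (1 / 2) + Real.exp u * (1 - 1 / 2) ≤ Real.exp (u ^ 2 / 2) := by
      refine le_trans (le_of_eq ?_) (Real.cosh_le_exp_half_sq u)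
      rw [Real.cosh_eq]
      ring
    calc (Real.exp (-u) * (1 / 2) + Real.exp u * (1 - 1 / 2)) ^ W ^ 3 / Real.exp (u * W ^ 2)
        ≤ Real.exp (u ^ 2 / 2) ^ W ^ 3 / Real.exp (u * W ^ 2) := by gcongr
      _ = Real.exp (-(W / 2)) := by
        rw [← Real.exp_nat_mul, ← Real.exp_sub, hu]
        congr 1
        push_cast
        field_simp
        ring

end Test

/-! ### Runs on a given tape of examples -/

/-- The law of the configuration after a run with the given examples. -/
def runTape (c : Config) (τ : List (List ℕ)) : PMF Config :=
  τ.foldl (fun ν l => ν.bind (step (PMF.pure l))) (PMF.pure c)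

lemma step_eq_bind (O : PMF (List ℕ)) (c : Config) :
    step O c = O.bind fun l => step (PMF.pure l) c := by
  obtain ⟨_ | ⟨P, k⟩, s, o⟩ := c
  · simp [step]
  · cases P <;> simp only [step, PMF.bind_const, PMF.pure_map]
    rw [← PMF.bind_pure_comp]
    rfl

lemma stepsFrom_eq_bind (O : PMF (List ℕ)) (c : Config) (t : ℕ) :
    stepsFrom O c t = (iid O t).bind (runTape c) := by
  induction t with
  | zero => simp [stepsFrom, iid, iter, runTape]
  | succ t ih =>
    rw [stepsFrom, ih, iid_succ, PMF.bind_bind, PMF.bind_bind]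
    congr 1
    ext τ : 1
    rw [bind_map']
    have : step O = fun c => O.bind fun l => step (PMF.pure l) c := funext (step_eq_bind O)
    rw [this, PMF.bind_comm]
    congr 1
    ext l : 1
    rw [runTape, runTape, List.foldl_append]
    rfl

/-- The law of the outcome of one trial, given the examples. -/
def trialTape (L : Prog) (N tL M' M : ℕ) (ev : List ℕ → List ℕ → ℕ) (τ : List (List ℕ)) :
    PMF Bool :=
  (runTape (initial L [N]) (τ.take tL)).map fun c =>
    decide (2 * errCount (ev c.out) N (τ.drop tL) + M' ≤ M)

lemma trialLaw_eq_bind (O : PMF (List ℕ)) (L : Prog) (N tL M' M : ℕ)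
    (ev : List ℕ → List ℕ → ℕ) :
    trialLaw O L N tL M' M ev = (iid O (tL + M)).bind (trialTape L N tL M' M ev) := by
  rw [trialLaw, output, run_eq_stepsFrom, stepsFrom_eq_bind, iid_add, bind_map', PMF.bind_bind,
    PMF.bind_bind]
  refine pmf_bind_congr _ fun τ hτ => ?_
  rw [bind_map']
  have hlen := length_of_mem_iid hτ
  calc (runTape (initial L [N]) τ).bind (fun c => (iid O M).map fun τ' =>
        decide (2 * errCount (ev c.out) N τ' + M' ≤ M))
      = (runTape (initial L [N]) τ).bind fun c => (iid O M).bind fun τ' =>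
        PMF.pure (decide (2 * errCount (ev c.out) N τ' + M' ≤ M)) := rfl
    _ = (iid O M).bind fun τ' => (runTape (initial L [N]) τ).bind fun c =>
        PMF.pure (decide (2 * errCount (ev c.out) N τ' + M' ≤ M)) := PMF.bind_comm _ _ _
    _ = _ := by
        congr 1
        ext τ' : 1
        rw [trialTape, List.take_left' hlen, List.drop_left' hlen]
        rfl

/-! ### Uniform laws -/

lemma iid_cons {α : Type} (p : PMF α) (k : ℕ) :
    iid p (k + 1) = p.bind fun a => (iid p k).map fun l => a :: l := by
  have h : iid p 1 = p.map fun a => [a] := by simp [iid, iter]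
  rw [add_comm, iid_add, h, bind_map']
  rfl

/-- The uniform law. -/
abbrev unif (α : Type) [Fintype α] [Nonempty α] : PMF α := PMF.uniformOfFintype α

section Uniform

variable {α β : Type} [Fintype α] [Nonempty α] [Fintype β] [Nonempty β]

lemma unif_map_equiv (e : α ≃ β) : (unif α).map e = unif β := by
  classical
  ext b
  rw [PMF.map_apply, tsum_eq_single (e.symm b)]
  · simp [Fintype.card_congr e]
  · intro a ha
    rw [if_neg]
    rintro rfl
    simp at ha

lemma unif_prod : unif (α × β) = (unif α).bind fun a => (unif β).map fun b => (a, b) := by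
  classical
  ext ⟨a, b⟩
  rw [PMF.bind_apply, tsum_eq_single a]
  · rw [PMF.map_apply, tsum_eq_single b]
    · simp only [if_true, PMF.uniformOfFintype_apply, Fintype.card_prod, Nat.cast_mul]
      rw [ENNReal.mul_inv (by simp) (by simp)]
    · intro b' hb'
      rw [if_neg]
      simpa using hb'.symm
  · intro a' ha'
    rw [PMF.map_apply]
    simp [ha'.symm]

lemma unif_map_snd : (unif (α × β)).map Prod.snd = unif β := by
  rw [unif_prod, map_bind']
  simp only [PMF.map_comp]
  have h : ∀ a : α, (Prod.snd ∘ fun b : β => (a, b)) = id := fun _ => rfl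
  simp only [h, PMF.map_id, PMF.bind_const]

/-- Resampling one coordinate does not change the uniform law. -/
lemma unif_bind_update {ι : Type} [Fintype ι] [DecidableEq ι] (j : ι) :
    (unif (ι → α)).bind (fun J => (unif α).map fun c => Function.update J j c) = unif (ι → α) := by
  have h1 : (unif ((ι → α) × α)).map (fun p => Function.update p.1 j p.2) =
      (unif (ι → α)).bind fun J => (unif α).map fun c => Function.update J j c := by
    rw [unif_prod, map_bind']
    simp only [PMF.map_comp]
    rfl
  let e : (ι → α) × α ≃ α × (ι → α) :=
    { toFun := fun p => (p.1 j, Function.update p.1 j p.2)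
      invFun := fun p => (Function.update p.2 j p.1, p.2 j)
      left_inv := fun p => by simp
      right_inv := fun p => by simp }
  have h2 := unif_map_snd (α := α) (β := ι → α)
  rw [← unif_map_equiv e, PMF.map_comp] at h2
  rw [← h1, ← h2]
  rfl

lemma pexp_unif (f : α → ℝ≥0∞) : pexp (unif α) f = (∑ a, f a) / Fintype.card α := by
  rw [pexp, tsum_fintype, ENNReal.div_eq_inv_mul, Finset.mul_sum]
  simp

/-- Uniform random functions at different points. -/
lemma unif_map_nodup {ι : Type} [Fintype ι] [DecidableEq ι] {l : List ι} (hl : l.Nodup) :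
    (unif (ι → α)).map (fun J => l.map J) = iid (unif α) l.length := by
  induction l with
  | nil =>
    simp only [List.length_nil, iid, iter]
    exact PMF.map_const _ _
  | cons j l ih =>
    rw [List.nodup_cons] at hl
    rw [List.length_cons, iid_cons, ← ih hl.2, ← unif_bind_update j, map_bind']
    simp only [PMF.map_comp]
    calc _ = (unif (ι → α)).bind fun J => (unif α).bind fun c =>
          PMF.pure (((j :: l).map (Function.update J j c))) := rfl
      _ = (unif α).bind fun c => (unif (ι → α)).bind fun J =>
          PMF.pure (((j :: l).map (Function.update J j c))) := PMF.bind_comm _ _ _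
      _ = (unif α).bind fun c => (unif (ι → α)).bind fun J => PMF.pure (c :: l.map J) := by
          congr 1
          ext c : 1
          congr 1
          ext J : 1
          rw [List.map_cons, Function.update_self]
          congr 2
          refine List.map_congr_left fun i hi => ?_
          rw [Function.update_of_ne]
          rintro rfl
          exact hl.1 hi
      _ = _ := by
          congr 1
          ext c : 1
          rw [unif_bind_update]
          rfl

end Uniform

section Fresh

variable {n K m : ℕ} [Nonempty (KTuple n K)]

/-- The tensor power of the literal vector of a constraint. -/
def features (d : ℕ) (C : KTuple n K) : List ℕ := tens (litVec C) d

/-- The law of the points of the cube given by independent uniform constraints. -/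
def pointLaw (n K d q : ℕ) [Nonempty (KTuple n K)] : PMF (List ℕ) :=
  (iid (unif (KTuple n K)) q).map fun l => l.flatMap (features d)

/-- The law of an example with independent uniform constraints. -/
def freshLaw (n K d q : ℕ) [Nonempty (KTuple n K)] : PMF (List ℕ) :=
  coin.bind fun y => (pointLaw n K d q).map fun x => x ++ [y.toNat]

/-- The example given by a coin and a list of indices. -/
def exampleOf (J : KFormula n K m) (d : ℕ) (p : Bool × List (Fin m)) : List ℕ :=
  p.2.flatMap (fun j => block d (sgn p.1) (J j)) ++ [p.1.toNat]

/-- The law of a coin and a list of indices. -/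
def rawLaw (m q : ℕ) [NeZero m] : PMF (Bool × List (Fin m)) :=
  coin.bind fun y => (iid (idxLaw m) q).map fun l => (y, l)

omit [Nonempty (KTuple n K)] in
lemma exampleLaw_eq_map [NeZero m] (J : KFormula n K m) (d q : ℕ) :
    exampleLaw J d q = (rawLaw m q).map (exampleOf J d) := by
  rw [exampleLaw, rawLaw, map_bind']
  simp only [PMF.map_comp]
  rfl

/-- Flipping the sign of the first literal, as a permutation. -/
def flipEquiv (n K : ℕ) (u : ℤˣ) : KTuple n K ≃ KTuple n K :=
  Function.Involutive.toPerm (fun C => C.flip u) fun C => by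
    refine Prod.ext rfl ?_
    funext i
    simp only [KTuple.flip]
    split_ifs
    · rw [← mul_assoc, Int.units_mul_self, one_mul]
    · rfl

lemma iid_map_flip (u : ℤˣ) (k : ℕ) :
    (iid (unif (KTuple n K)) k).map (List.map fun C => C.flip u) = iid (unif (KTuple n K)) k := by
  rw [← iid_map]
  congr 1
  exact unif_map_equiv (flipEquiv n K u)

lemma pointLaw_eq (d q : ℕ) (u : ℤˣ) : pointLaw n K d q = (iid (unif (KTuple n K)) q).map
    fun cs => (cs.map fun C => C.flip u).flatMap (features d) := by
  rw [pointLaw, ← iid_map_flip u, PMF.map_comp, iid_map_flip]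
  rfl

/-- The law of the examples that come from independent uniform constraints, given coins and lists
of indices. -/
def tapeLaw (n K d : ℕ) [Nonempty (KTuple n K)] : List (Bool × List (Fin m)) → PMF (List (List ℕ))
  | [] => PMF.pure []
  | (y, l) :: r => (pointLaw n K d l.length).bind fun x =>
      (tapeLaw n K d r).map fun τ => (x ++ [y.toNat]) :: τ

/-- The examples for given coins and a list of all constraints. -/
def assemble (d : ℕ) : List (Bool × List (Fin m)) → List (KTuple n K) → List (List ℕ)
  | [], _ => []
  | (y, l) :: r, cs => (((cs.take l.length).map fun C => C.flip (sgn y)).flatMap (features d) ++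
      [y.toNat]) :: assemble d r (cs.drop l.length)

omit [Nonempty (KTuple n K)] in
lemma assemble_eq (J : KFormula n K m) (d : ℕ) (r : List (Bool × List (Fin m))) :
    assemble d r ((r.flatMap Prod.snd).map J) = r.map (exampleOf J d) := by
  induction r with
  | nil => rfl
  | cons p r ih =>
    obtain ⟨y, l⟩ := p
    rw [List.flatMap_cons, List.map_append, assemble, List.take_left' (by simp),
      List.drop_left' (by simp), ih, List.map_cons]
    congr 1
    simp only [exampleOf, List.map_map, List.flatMap_map]
    rfl

lemma iid_map_assemble (d : ℕ) (r : List (Bool × List (Fin m))) :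
    (iid (unif (KTuple n K)) (r.flatMap Prod.snd).length).map (assemble d r) =
      tapeLaw n K d r := by
  induction r with
  | nil => exact PMF.map_const _ _
  | cons p r ih =>
    obtain ⟨y, l⟩ := p
    rw [List.flatMap_cons, List.length_append, iid_add, map_bind', tapeLaw, ← ih,
      pointLaw_eq d _ (sgn y), bind_map']
    refine pmf_bind_congr _ fun cs hcs => ?_
    have hlen := length_of_mem_iid hcs
    rw [PMF.map_comp, PMF.map_comp]
    congr 1
    ext cs' : 1
    simp only [Function.comp_apply, assemble]
    rw [List.take_left' hlen, List.drop_left' hlen]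

lemma unif_map_exampleOf (d : ℕ) {r : List (Bool × List (Fin m))}
    (hr : (r.flatMap Prod.snd).Nodup) :
    (unif (KFormula n K m)).map (fun J => r.map (exampleOf J d)) = tapeLaw n K d r := by
  rw [← iid_map_assemble, ← unif_map_nodup hr, PMF.map_comp]
  congr 1
  ext J : 1
  exact (assemble_eq J d r).symm

variable [NeZero m]

lemma iid_rawLaw_bind_tapeLaw (d q k : ℕ) :
    (iid (rawLaw m q) k).bind (tapeLaw n K d) = iid (freshLaw n K d q) k := by
  induction k with
  | zero => simp [iid, iter, tapeLaw]
  | succ k ih =>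
    have hraw (f : Bool × List (Fin m) → PMF (List (List ℕ))) : (rawLaw m q).bind f =
        coin.bind fun y => (iid (idxLaw m) q).bind fun l => f (y, l) := by
      rw [rawLaw, PMF.bind_bind]
      simp only [bind_map']
    rw [iid_cons, iid_cons, ← ih, PMF.bind_bind, hraw, freshLaw, PMF.bind_bind]
    congr 1
    ext y : 1
    rw [bind_map']
    calc _ = (iid (idxLaw m) q).bind fun _ => (iid (rawLaw m q) k).bind fun r =>
          (pointLaw n K d q).bind fun x => (tapeLaw n K d r).map fun τ => (x ++ [y.toNat]) :: τ := by
          refine pmf_bind_congr _ fun l hl => ?_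
          rw [bind_map']
          simp only [tapeLaw, length_of_mem_iid hl]
      _ = (iid (rawLaw m q) k).bind fun r =>
          (pointLaw n K d q).bind fun x => (tapeLaw n K d r).map fun τ => (x ++ [y.toNat]) :: τ :=
          PMF.bind_const _ _
      _ = _ := by
          rw [PMF.bind_comm]
          congr 1
          ext x : 1
          rw [map_bind']

lemma iid_rawLaw_map (q k : ℕ) :
    (iid (rawLaw m q) k).map (fun r => r.flatMap Prod.snd) = iid (idxLaw m) (k * q) := by
  induction k with
  | zero => simp [iid, iter, PMF.pure_map]
  | succ k ih =>
    rw [iid_succ, map_bind', Nat.succ_mul, iid_add, ← ih, bind_map']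
    congr 1
    ext r : 1
    rw [PMF.map_comp, rawLaw, map_bind']
    simp only [PMF.map_comp]
    simp only [Function.comp_def, List.flatMap_append, List.flatMap_cons, List.flatMap_nil,
      List.append_nil]
    exact PMF.bind_const _ _

lemma pr_collision_le (q k : ℕ) :
    pr (iid (rawLaw m q) k) {r | ¬ (r.flatMap Prod.snd).Nodup} ≤
      ENNReal.ofReal ((k * q) ^ 2 * (2 / m)) := by
  have hm : (0 : ℝ) < m := by exact_mod_cast Nat.pos_of_ne_zero (NeZero.ne m)
  have h := pr_iid_not_nodup (idxLaw m) (w := ENNReal.ofReal (2 / m)) (fun j =>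
    (idxLaw_le m j).trans (ENNReal.ofReal_le_ofReal ?_)) (k * q)
  · rw [← iid_rawLaw_map, pr_map] at h
    refine h.trans (le_of_eq ?_)
    rw [ENNReal.ofReal_mul (by positivity), ENNReal.ofReal_pow (by positivity),
      ← Nat.cast_mul, ENNReal.ofReal_natCast]
  · have : (1 : ℝ) / 2 ^ m ≤ 1 / m := by
      gcongr
      exact_mod_cast Nat.lt_two_pow_self.le
    have h2 : (2 : ℝ) / m = 1 / m + 1 / m := by ring
    linarith

/-- On average over the formula, a trial behaves as for fresh constraints, up to collisions. -/
lemma pexp_trialLaw_le (d q : ℕ) (L : Prog) (N tL M' M : ℕ) (ev : List ℕ → List ℕ → ℕ) :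
    pexp (unif (KFormula n K m)) (fun J => trialLaw (exampleLaw J d q) L N tL M' M ev true) ≤
      ENNReal.ofReal (((tL + M : ℕ) * q) ^ 2 * (2 / m)) +
        trialLaw (freshLaw n K d q) L N tL M' M ev true := by
  set Q := tL + M with hQ
  set F := trialTape L N tL M' M ev with hF
  have h1 : pexp (unif (KFormula n K m)) (fun J => trialLaw (exampleLaw J d q) L N tL M' M ev true)
      = pexp (iid (rawLaw m q) Q) fun r => pexp (unif (KFormula n K m)) fun J =>
        F (r.map (exampleOf J d)) true := by
    have h2 : ∀ J : KFormula n K m, trialLaw (exampleLaw J d q) L N tL M' M ev true =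
        pexp (iid (rawLaw m q) Q) fun r => F (r.map (exampleOf J d)) true := by
      intro J
      rw [trialLaw_eq_bind, exampleLaw_eq_map, iid_map, bind_map']
      rfl
    simp only [h2]
    simp only [pexp, ← ENNReal.tsum_mul_left]
    rw [ENNReal.tsum_comm]
    refine tsum_congr fun r => tsum_congr fun J => ?_
    ring
  have h3 : ∀ r : List (Bool × List (Fin m)), (r.flatMap Prod.snd).Nodup →
      pexp (unif (KFormula n K m)) (fun J => F (r.map (exampleOf J d)) true) =
        pexp (tapeLaw n K d r) fun τ => F τ true := by
    intro r hr
    rw [← unif_map_exampleOf d hr, pexp_map]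
  have h4 : trialLaw (freshLaw n K d q) L N tL M' M ev true =
      pexp (iid (rawLaw m q) Q) fun r => pexp (tapeLaw n K d r) fun τ => F τ true := by
    rw [trialLaw_eq_bind, ← iid_rawLaw_bind_tapeLaw (m := m), ← pexp_bind]
    rfl
  rw [h1, h4]
  refine le_trans ?_ (add_le_add_left (pr_collision_le q Q) _)
  rw [pr_eq_pexp, ← pexp_add]
  refine pexp_mono _ fun r _ => ?_
  by_cases hr : (r.flatMap Prod.snd).Nodup
  · rw [h3 r hr]
    exact le_add_self
  · refine le_trans ?_ le_self_add
    rw [Set.indicator_of_mem (by simpa using hr), Pi.one_apply,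
      ← pexp_const (unif (KFormula n K m)) 1]
    exact pexp_mono _ fun J _ => PMF.coe_le_one _ _

omit [NeZero m] in
/-- With fresh constraints, the label is independent of the point, so no hypothesis passes. -/
lemma trialLaw_freshLaw_le {d q W N : ℕ} (hN : q * (n + n + 1) ^ d = N) (hW : 1 ≤ W) (L : Prog)
    (tL : ℕ) {ev : List ℕ → List ℕ → ℕ}
    (hev : ∀ z x, x.length = N → ∃ u : ℤˣ, ∀ y : ℕ, ev z (x ++ [y]) = bit u) :
    trialLaw (freshLaw n K d q) L N tL (W ^ 2) (W ^ 3) ev true ≤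
      ENNReal.ofReal (Real.exp (-(W / 2))) := by
  rw [trialLaw, ← pr_singleton, pr_bind, ← pexp_const (output (freshLaw n K d q) L [N] tL)
    (ENNReal.ofReal _)]
  refine pexp_mono _ fun z _ => ?_
  rw [pr_map]
  refine (pr_mono _ fun τ hτ _ => ?_).trans (pr_test_passes_le (freshLaw n K d q) (ev z) N hW ?_)
  · simpa using hτ
  · have h1 : freshLaw n K d q =
        (pointLaw n K d q).bind fun x => coin.map fun y => x ++ [y.toNat] := by
      calc _ = coin.bind fun y => (pointLaw n K d q).bind fun x => PMF.pure (x ++ [y.toNat]) := rfl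
        _ = _ := PMF.bind_comm _ _ _
    rw [h1, pr_bind, ← pexp_const (pointLaw n K d q) (ENNReal.ofReal _)]
    refine tsum_congr fun x => ?_
    by_cases hx : x ∈ (pointLaw n K d q).support
    · congr 1
      have hlen : x.length = N := by
        rw [pointLaw, PMF.mem_support_map_iff] at hx
        obtain ⟨l, hl, rfl⟩ := hx
        simp [List.length_flatMap, features, length_tens, litVec, length_of_mem_iid hl, hN]
      obtain ⟨u, hu⟩ := hev z x hlen
      change pr (PMF.map _ coin) _ = _
      have hset : (fun y : Bool => x ++ [y.toNat]) ⁻¹' {l | ev z l ≠ l.getD N 0} =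
          {y : Bool | bit u ≠ y.toNat} := by
        ext y
        rw [Set.mem_preimage, Set.mem_ofPred_eq, Set.mem_ofPred_eq, hu,
          List.getD_append_right _ _ _ _ hlen.le, hlen, Nat.sub_self]
        rfl
      rw [pr_map, hset, pr_eq_pexp, pexp, tsum_bool]
      simp only [coin_apply]
      rcases Int.units_eq_one_or u with rfl | rfl <;> simp [bit]
    · rw [PMF.mem_support_iff, not_not] at hx
      simp [hx]

end Fresh

/-! ### The correlation test on random formulas -/

section CorrTest

variable {n K m : ℕ}

lemma sum_pairCorr (C : KTuple n K) :
    ∑ C' : KTuple n K, pairCorr C C' = Fintype.card (KTuple n K) := by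
  rw [Fintype.sum_prod_type]
  have h : ∀ v : Fin K ↪ Fin n, ∑ σ : Fin K → ℤˣ, pairCorr C (v, σ) = 2 ^ K := by
    intro v
    simp only [pairCorr]
    rw [← Fintype.piFinset_univ, ← Finset.prod_univ_sum (fun _ => Finset.univ)
      (fun i u => if C.1 i = v i then (if C.2 i = u then 2 else 0) else 1)]
    rw [Finset.prod_congr rfl (g := fun _ => 2), Finset.prod_const, Finset.card_univ,
      Fintype.card_fin]
    intro i _
    split_ifs
    · rw [show (Finset.univ : Finset ℤˣ) = {1, -1} from rfl, Finset.sum_pair (by decide)]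
      rcases Int.units_eq_one_or (C.2 i) with hu | hu <;> simp [hu]
    · simp
  simp only [h, Finset.sum_const, Finset.card_univ, Fintype.card_prod, Fintype.card_fun,
    Fintype.card_fin, Fintype.card_units_int, smul_eq_mul]

lemma pairCorr_self (C : KTuple n K) : pairCorr C C = 2 ^ K := by
  simp [pairCorr]

lemma sq_le_corr (J : KFormula n K m) : m * m ≤ corr J := by
  have h : (m : ℝ) * m ≤ corr J := by
    rw [corr_eq_sum, ← corrAt_empty J]
    refine Finset.single_le_sum (f := fun S => corrAt J S) (fun S _ => ?_) (Finset.mem_univ _)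
    rw [corrAt_eq]
    positivity
  exact_mod_cast h

variable [Nonempty (KTuple n K)]

lemma pexp_pairCorr {j j' : Fin m} (h : j ≠ j') :
    pexp (unif (KFormula n K m)) (fun J => (pairCorr (J j) (J j') : ℝ≥0∞)) = 1 := by
  rw [← unif_bind_update j', pexp_bind, ← pexp_const (unif (KFormula n K m)) 1]
  congr 1
  ext J
  rw [pexp_map, pexp_unif]
  simp only [Function.update_self, Function.update_of_ne h]
  rw [← Nat.cast_sum, sum_pairCorr]
  exact ENNReal.div_self (by exact_mod_cast Fintype.card_ne_zero) (ENNReal.natCast_ne_top _)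

lemma pexp_sum {α ι : Type} (p : PMF α) (s : Finset ι) (f : ι → α → ℝ≥0∞) :
    pexp p (fun a => ∑ i ∈ s, f i a) = ∑ i ∈ s, pexp p (f i) := by
  classical
  induction s using Finset.induction_on with
  | empty => simp [pexp]
  | insert i s hi ih => simp only [Finset.sum_insert hi, pexp_add, ih]

lemma pexp_corr_le :
    pexp (unif (KFormula n K m)) (fun J => (corr J : ℝ≥0∞)) ≤ m * m + m * 2 ^ K := by
  simp only [corr, Nat.cast_sum]
  rw [pexp_sum]
  have h : ∀ j : Fin m, pexp (unif (KFormula n K m)) (fun J => ∑ j', (pairCorr (J j) (J j') : ℝ≥0∞))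
      ≤ m + 2 ^ K := by
    intro j
    rw [pexp_sum]
    calc _ ≤ ∑ j' : Fin m, (1 + if j' = j then (2 : ℝ≥0∞) ^ K else 0) := by
          refine Finset.sum_le_sum fun j' _ => ?_
          by_cases hj : j = j'
          · subst hj
            simp only [pairCorr_self, pexp_const, if_true, Nat.cast_pow, Nat.cast_ofNat]
            exact le_add_self
          · rw [pexp_pairCorr hj]
            exact le_self_add
      _ = _ := by simp [Finset.sum_add_distrib]
  refine (Finset.sum_le_sum fun j _ => h j).trans (le_of_eq ?_)
  simp

lemma pr_corr_large_le (hn : 1 ≤ n) [NeZero m] :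
    pr (unif (KFormula n K m)) {J | ¬ corr J ≤ (m + n * 2 ^ K) * m} ≤ ENNReal.ofReal (1 / n) := by
  have hm : 0 < m := Nat.pos_of_ne_zero (NeZero.ne m)
  set c : ℕ := n * 2 ^ K * m with hc
  have h1 : pexp (unif (KFormula n K m)) (fun J => ((corr J - m * m : ℕ) : ℝ≥0∞)) ≤ m * 2 ^ K := by
    have h2 := pexp_corr_le (n := n) (K := K) (m := m)
    have h3 : pexp (unif (KFormula n K m)) (fun J => (corr J : ℝ≥0∞)) =
        m * m + pexp (unif (KFormula n K m)) (fun J => ((corr J - m * m : ℕ) : ℝ≥0∞)) := by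
      rw [← pexp_const (unif (KFormula n K m)) (m * m : ℝ≥0∞), ← pexp_add]
      congr 1
      ext J
      rw [← Nat.cast_mul, ← Nat.cast_add, Nat.add_sub_cancel' (sq_le_corr J)]
    rw [h3] at h2
    exact (ENNReal.add_le_add_iff_left (by finiteness)).1 h2
  have hc0 : (c : ℝ≥0∞) ≠ 0 := by
    have : 0 < c := by positivity
    exact_mod_cast this.ne'
  calc _ ≤ pexp (unif (KFormula n K m)) (fun J => ((corr J - m * m : ℕ) : ℝ≥0∞) * (c : ℝ≥0∞)⁻¹) := by
        refine pr_le_pexp _ fun J hJ _ => ?_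
        rw [Set.mem_ofPred_eq, not_le] at hJ
        have h4 : c ≤ corr J - m * m := by
          rw [hc]
          refine Nat.le_sub_of_add_le ?_
          nlinarith
        rw [← ENNReal.mul_inv_cancel hc0 (by finiteness)]
        gcongr
    _ ≤ m * 2 ^ K * (c : ℝ≥0∞)⁻¹ := by
        rw [pexp_mul_right]
        gcongr
    _ = ENNReal.ofReal (1 / n) := by
        have h5 : (m * 2 ^ K * (c : ℝ≥0∞)⁻¹) = ENNReal.ofReal (m * 2 ^ K / c) := by
          rw [ENNReal.ofReal_div_of_pos (by positivity), ENNReal.div_eq_inv_mul, mul_comm]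
          congr 2
          · simp
          · rw [ENNReal.ofReal_mul (by positivity), ENNReal.ofReal_pow (by norm_num)]
            simp
        rw [h5, hc]
        congr 1
        have : (0 : ℝ) < n := by exact_mod_cast hn
        have : (0 : ℝ) < m := by exact_mod_cast hm
        push_cast
        field_simp

end CorrTest

/-! ### Fractions of formulas -/

lemma ncard_div_card {α : Type} [Fintype α] [Nonempty α] (S : Set α) :
    (S.ncard : ℝ) / Nat.card α = (pr (unif α) S).toReal := by
  classical
  rw [pr, PMF.toOuterMeasure_uniformOfFintype_apply, ENNReal.toReal_div, Set.ncard_eq_toFinset_card',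
    Nat.card_eq_fintype_card]
  simp [Set.toFinset_card]

/-- The decision of the reduction is "random" on most formulas. -/
lemma le_pr_random {n K m d q W N R tL : ℕ} [Nonempty (KTuple n K)] [NeZero m] (hn : 1 ≤ n)
    (hN : q * (n + n + 1) ^ d = N) (hW : 1 ≤ W) (L : Prog) {ev : List ℕ → List ℕ → ℕ}
    (hev : ∀ z x, x.length = N → ∃ u : ℤˣ, ∀ y : ℕ, ev z (x ++ [y]) = bit u)
    (S : Set (KFormula n K m))
    (hS : ∀ J, corr J ≤ (m + n * 2 ^ K) * m → 3 / 4 ≤ trialsLaw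
      (trialLaw (exampleLaw J d q) L N tL (W ^ 2) (W ^ 3) ev) R false → J ∈ S) :
    1 - (1 / n + 4 * R * (((tL + W ^ 3 : ℕ) * q : ℝ) ^ 2 * (2 / m) + Real.exp (-(W / 2)))) ≤
      (pr (unif (KFormula n K m)) S).toReal := by
  set ε := ((tL + W ^ 3 : ℕ) * q : ℝ) ^ 2 * (2 / m) + Real.exp (-(W / 2)) with hε
  have hε0 : 0 ≤ ε := by positivity
  have h1 : pexp (unif (KFormula n K m)) (fun J => trialLaw (exampleLaw J d q) L N tL (W ^ 2)
      (W ^ 3) ev true) ≤ ENNReal.ofReal ε := by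
    rw [hε, ENNReal.ofReal_add (by positivity) (by positivity)]
    exact (pexp_trialLaw_le d q L N tL (W ^ 2) (W ^ 3) ev).trans
      (add_le_add_right (trialLaw_freshLaw_le hN hW L tL hev) _)
  have h2 : pr (unif (KFormula n K m)) Sᶜ ≤ ENNReal.ofReal (1 / n + 4 * R * ε) := by
    refine le_trans (pr_mono _ (T := {J | ¬ corr J ≤ (m + n * 2 ^ K) * m} ∪
      {J | 1 ≤ 4 * R * trialLaw (exampleLaw J d q) L N tL (W ^ 2) (W ^ 3) ev true})
      fun J hJ _ => ?_) ?_
    · by_contra hcon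
      rw [Set.mem_union, not_or, Set.mem_ofPred_eq, not_not, Set.mem_ofPred_eq, not_le] at hcon
      refine hJ (hS J hcon.1 ?_)
      set p := trialLaw (exampleLaw J d q) L N tL (W ^ 2) (W ^ 3) ev with hp
      have h3 := trialsLaw_true_le p R
      have h4 : trialsLaw p R false + trialsLaw p R true = 1 := by
        rw [← tsum_bool]
        exact (trialsLaw p R).tsum_coe
      have h5 : 4 * trialsLaw p R true ≤ 1 := by
        refine le_trans ?_ hcon.2.le
        rw [mul_assoc]
        gcongr
      have ht : trialsLaw p R true ≠ ⊤ := PMF.apply_ne_top _ _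
      have hf : trialsLaw p R false ≠ ⊤ := PMF.apply_ne_top _ _
      lift trialsLaw p R true to NNReal using ht with a
      lift trialsLaw p R false to NNReal using hf with b
      have h4' : (b : ℝ) + a = 1 := by exact_mod_cast h4
      have h5' : 4 * (a : ℝ) ≤ 1 := by exact_mod_cast h5
      rw [ENNReal.div_le_iff (by simp) (by simp)]
      have : (3 : ℝ) ≤ b * 4 := by linarith
      exact_mod_cast this
    · refine (pr_union_le _ _ _).trans ?_
      rw [ENNReal.ofReal_add (by positivity) (by positivity)]
      refine add_le_add (pr_corr_large_le hn) ?_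
      refine (pr_le_pexp _ (f := fun J => 4 * R * trialLaw (exampleLaw J d q) L N tL (W ^ 2) (W ^ 3)
        ev true) fun J hJ _ => hJ).trans ?_
      rw [pexp_mul_left, ENNReal.ofReal_mul (by positivity), ENNReal.ofReal_mul (by positivity)]
      refine mul_le_mul' (le_of_eq ?_) h1
      simp
  have h3 := pr_compl (unif (KFormula n K m)) S
  have hS1 : pr (unif (KFormula n K m)) S ≠ ⊤ := ne_top_of_le_ne_top ENNReal.one_ne_top (pr_le_one _ _)
  have hS2 : pr (unif (KFormula n K m)) Sᶜ ≠ ⊤ :=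
    ne_top_of_le_ne_top ENNReal.one_ne_top (pr_le_one _ _)
  have h4 := congrArg ENNReal.toReal h3
  rw [ENNReal.toReal_add hS1 hS2, ENNReal.toReal_one] at h4
  have h5 := ENNReal.toReal_le_of_le_ofReal (by positivity) h2
  linarith

/-! ### Trials on almost realizable distributions -/

section Hypothesis

variable {N : ℕ} (E : Prog) (t : ℕ)

open Classical in
/-- The hypothesis with description `z`. -/
def hypOf (N : ℕ) (z : List ℕ) : Cube N → ℤˣ :=
  if h : ∃ h : Cube N → ℤˣ, Describes E t z h then h.choose else fun _ => 1

lemma describes_hypOf {z : List ℕ} (h : ∃ h : Cube N → ℤˣ, Describes E t z h) :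
    Describes E t z (hypOf E t N z) := by
  rw [hypOf, dif_pos h]
  exact h.choose_spec

variable {E t}

lemma Describes.unique {z : List ℕ} {h h' : Cube N → ℤˣ} (hh : Describes E t z h)
    (hh' : Describes E t z h') : h = h' := by
  funext x
  obtain ⟨c, hc⟩ := (run noExamples E (encodeQuery x z) t).support_nonempty
  have h1 := (hh x c hc).2
  have h2 := (hh' x c hc).2
  rw [h1] at h2
  exact bit_injective (by simpa using h2)

variable (E t)

/-- The prediction for an example. -/
def predict (N : ℕ) (z l : List ℕ) : ℕ := bit (hypOf E t N z (cubeOf N l))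

lemma predict_append (N : ℕ) (z : List ℕ) {x : List ℕ} (hx : x.length = N) :
    ∃ u : ℤˣ, ∀ y : ℕ, predict E t N z (x ++ [y]) = bit u := by
  refine ⟨hypOf E t N z (cubeOf N x), fun y => ?_⟩
  have : cubeOf N (x ++ [y]) = cubeOf N x := by
    funext i
    rw [cubeOf, cubeOf, List.getD_append _ _ _ _ (by rw [hx]; exact i.isLt)]
  rw [predict, this]

lemma cubeOf_ofFn (x : Cube N) (l : List ℕ) :
    cubeOf N ((List.ofFn fun i => bit (x i)) ++ l) = x := by
  funext i
  rw [cubeOf, List.getD_append _ _ _ _ (by simp), List.getD_eq_getElem _ _ (by simp)]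
  simp [unitOf_bit]

lemma queryOf_example (x : Cube N) (y : ℤˣ) (z : List ℕ) :
    queryOf N z ((List.ofFn fun i => bit (x i)) ++ [bit y]) = encodeQuery x z := by
  rw [queryOf, encodeQuery, List.take_left' (by simp)]

lemma pr_predict (D : PMF (Cube N × ℤˣ)) (z : List ℕ) :
    (pr (examples D) {l | predict E t N z l ≠ l.getD N 0}).toReal = err D (hypOf E t N z) := by
  rw [examples, pr_map, err]
  congr 2
  ext ⟨x, y⟩
  simp only [Set.mem_preimage, Set.mem_ofPred_eq, predict, cubeOf_ofFn]
  rw [List.getD_append_right _ _ _ _ (by simp), List.length_ofFn, Nat.sub_self]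
  exact not_congr bit_injective.eq_iff

end Hypothesis

section Learner

variable {L E : Prog} {T : Polynomial ℕ} {N : ℕ}

lemma EfficientLearner.run_predict (hL : EfficientLearner L E T) (D : PMF (Cube N × ℤˣ)) :
    ∀ z ∈ (output (examples D) L [N] (T.eval N)).support, ∀ l ∈ (examples D).support,
      ∀ c ∈ (run noExamples E (queryOf N z l) (T.eval N)).support,
        c.todo = [] ∧ c.out = [predict E (T.eval N) N z l] := by
  intro z hz l hl c hc
  rw [examples, PMF.mem_support_map_iff] at hl
  obtain ⟨⟨x, y⟩, -, rfl⟩ := hl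
  rw [queryOf_example] at hc
  have := describes_hypOf E (T.eval N) ((hL N D).2 z hz) x c hc
  rw [predict, cubeOf_ofFn]
  exact this

lemma trialLaw_false_le {D : PMF (Cube N × ℤˣ)} {W : ℕ} (hW : 1 ≤ W) {δ : ℝ} (hδ : 0 ≤ δ)
    (h : ENNReal.ofReal δ ≤ pr (learned L (T.eval N) D)
      {z | ∃ h : Cube N → ℤˣ, Describes E (T.eval N) z h ∧ err D h ≤ 1 / 2 - 1 / W}) :
    trialLaw (examples D) L N (T.eval N) (W ^ 2) (W ^ 3) (predict E (T.eval N) N) false ≤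
      ENNReal.ofReal (1 - δ + Real.exp (-(W / 4))) := by
  set S := {z | ∃ h : Cube N → ℤˣ, Describes E (T.eval N) z h ∧ err D h ≤ 1 / 2 - 1 / W} with hS
  have hδ1 : δ ≤ 1 := by
    have := h.trans (pr_le_one _ _)
    rwa [ENNReal.ofReal_le_one] at this
  have hSc : pr (learned L (T.eval N) D) Sᶜ ≤ ENNReal.ofReal (1 - δ) := by
    have h1 := pr_compl (learned L (T.eval N) D) S
    rw [ENNReal.ofReal_sub _ hδ, ENNReal.ofReal_one]
    refine ENNReal.le_sub_of_add_le_right ENNReal.ofReal_ne_top ?_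
    rw [← h1, add_comm]
    exact add_le_add_left h _
  rw [trialLaw, ← pr_singleton, pr_bind, ENNReal.ofReal_add (by linarith) (Real.exp_pos _).le]
  refine le_trans (pexp_le_pr_add (S := Sᶜ) _ (fun z => pr_le_one _ _) fun z hz => ?_)
    (add_le_add_left hSc _)
  rw [Set.notMem_compl_iff] at hz
  obtain ⟨h, hd, he⟩ := hz
  rw [pr_map]
  refine (pr_mono _ fun τ hτ _ => ?_).trans
    (pr_test_fails_le (examples D) (predict E (T.eval N) N z) N hW ?_)
  · simpa using hτ
  · rw [pr_predict, (describes_hypOf E (T.eval N) ⟨h, hd⟩).unique hd]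
    exact he

end Learner

lemma map_toNat_one (p : PMF Bool) : (p.map fun b => [b.toNat]) [1] = p true := by
  rw [PMF.map_apply, tsum_bool]
  simp

lemma map_toNat_zero (p : PMF Bool) : (p.map fun b => [b.toNat]) [0] = p false := by
  rw [PMF.map_apply, tsum_bool]
  simp

lemma le_trialsLaw_true {p : PMF Bool} {R : ℕ} {x : ℝ} (hx : p false ≤ ENNReal.ofReal x)
    (hx0 : 0 ≤ x) (hR : x ^ R ≤ 1 / 4) : 3 / 4 ≤ trialsLaw p R true := by
  have h4 : trialsLaw p R false + trialsLaw p R true = 1 := by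
    rw [← tsum_bool]
    exact (trialsLaw p R).tsum_coe
  have h5 : trialsLaw p R false ≤ ENNReal.ofReal (1 / 4) := by
    rw [trialsLaw_false]
    calc p false ^ R ≤ ENNReal.ofReal x ^ R := by gcongr
      _ = ENNReal.ofReal (x ^ R) := (ENNReal.ofReal_pow hx0 R).symm
      _ ≤ _ := ENNReal.ofReal_le_ofReal hR
  have ht : trialsLaw p R true ≠ ⊤ := PMF.apply_ne_top _ _
  have hf : trialsLaw p R false ≠ ⊤ := PMF.apply_ne_top _ _
  have h5' := ENNReal.toReal_le_of_le_ofReal (by norm_num) h5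
  lift trialsLaw p R true to NNReal using ht with a
  lift trialsLaw p R false to NNReal using hf with b
  have h4' : (b : ℝ) + a = 1 := by exact_mod_cast h4
  rw [ENNReal.coe_toReal] at h5'
  rw [ENNReal.div_le_iff (by simp) (by simp)]
  have : (3 : ℝ) ≤ a * 4 := by linarith
  exact_mod_cast this

/-! ### The reduction -/

lemma exists_eval_eq_mainTime : ∃ P : Polynomial ℕ, ∀ x, P.eval x = mainTime x := by
  open Polynomial in
  let S : Polynomial ℕ := X * (X * ((X * ((X * (4 + 3) + 3) + 3) + 3) + 2 + 3) + 9 + X * 18 +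
    X * 4 + X * 12 + 28) + 10
  let U : Polynomial ℕ := X * (S + 6) + X * (S + X * 9 + 26) + 20
  refine ⟨X * (U + 3) + X * (X * (X * 6 + 12) + 12) + 8 * (X * (X * 4 + 10)) + X * 7 + 90,
    fun x => ?_⟩
  simp only [S, U, mainTime, trialTime, sampleTime, eval_add, eval_mul, eval_X, eval_ofNat]

lemma exists_eval_le_pow (T : Polynomial ℕ) : ∃ C, ∀ᶠ N : ℕ in atTop, T.eval N ≤ N ^ C := by
  refine ⟨T.natDegree + 1, ?_⟩
  filter_upwards [eventually_ge_atTop (T.eval 1), eventually_ge_atTop 1] with N h1 h2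
  rw [Polynomial.eval_eq_sum_range] at h1 ⊢
  simp only [one_pow, mul_one] at h1
  calc ∑ i ∈ Finset.range (T.natDegree + 1), T.coeff i * N ^ i
      ≤ ∑ i ∈ Finset.range (T.natDegree + 1), T.coeff i * N ^ T.natDegree := by
        refine Finset.sum_le_sum fun i hi => ?_
        have : i ≤ T.natDegree := by
          rw [Finset.mem_range] at hi
          omega
        gcongr
    _ ≤ N * N ^ T.natDegree := by
        rw [← Finset.sum_mul]
        gcongr
    _ = _ := by ring

/-- The dimension of the examples. -/
def cubeDim (cA a cB b n : ℕ) : ℕ := cB * Nat.size n ^ b * (n + n + 1) ^ (cA * Nat.size n ^ a)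

lemma size_pos {n : ℕ} (hn : 1 ≤ n) : 1 ≤ Nat.size n := Nat.size_pos.2 hn

lemma le_cubeDim {cA a cB b n : ℕ} (hA : 1 ≤ cA) (hB : 1 ≤ cB) (hn : 1 ≤ n) :
    n + n + 1 ≤ cubeDim cA a cB b n ∧ cB * Nat.size n ^ b ≤ cubeDim cA a cB b n ∧
      cA * Nat.size n ^ a ≤ cubeDim cA a cB b n := by
  have hs := size_pos hn
  have hd : 1 ≤ cA * Nat.size n ^ a := Nat.mul_pos hA (by positivity)
  have hq : 1 ≤ cB * Nat.size n ^ b := Nat.mul_pos hB (by positivity)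
  have h1 : (n + n + 1) ^ 1 ≤ (n + n + 1) ^ (cA * Nat.size n ^ a) :=
    Nat.pow_le_pow_right (by omega) hd
  have h2 : cA * Nat.size n ^ a < (n + n + 1) ^ (cA * Nat.size n ^ a) :=
    Nat.lt_pow_self (by omega)
  unfold cubeDim
  refine ⟨?_, Nat.le_mul_of_pos_right _ (by positivity), ?_⟩ <;> nlinarith

lemma tendsto_cubeDim {cA a cB b : ℕ} (hA : 1 ≤ cA) (hB : 1 ≤ cB) :
    Tendsto (cubeDim cA a cB b) atTop atTop := by
  refine tendsto_atTop_mono' _ ?_ tendsto_id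
  filter_upwards [eventually_ge_atTop 1] with n hn
  have := (le_cubeDim (a := a) (b := b) hA hB hn).1
  simp only [id]
  omega

/-- If there is a learner with non-trivial performance, then random `K`-XOR is easy, as soon as the
number of constraints exceeds some power of the dimension of the examples. -/
theorem cspEasy_of_learner {η' : ℕ → ℝ} (hL : ExistsNontrivialLearner η') :
    ∃ C₀ : ℕ, ∀ {K m t : ℕ → ℕ} {η η₁ : ℝ} {cA a cB b : ℕ}, 0 < η → η < η₁ → η₁ ≤ 1 / 2 →
      1 ≤ cA → 1 ≤ cB →
      (∀ᶠ n in atTop, cubeDim cA a cB b n ^ C₀ ≤ m n) →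
      (∀ᶠ n in atTop, 1 ≤ K n ∧ K n ≤ n) →
      (∀ᶠ n in atTop, 1 ≤ t n ∧ 12 * K n * t n ≤ (cA * Nat.size n ^ a - 1) ^ 2) →
      (∀ᶠ n in atTop, n ^ (2 * t n + 1) * 2 ^ K n * K n ^ (4 * t n) ≤ m n) →
      (∀ᶠ n in atTop, 6 * ((cB * Nat.size n ^ b : ℕ) : ℝ) / 2 ^ t n +
        (1 / 2 + 2 * η₁ * (1 - η₁)) ^ (cB * Nat.size n ^ b) ≤ η' (cubeDim cA a cB b n)) →
      CSPEasy K m fun _ => η := by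
  obtain ⟨L, E, T, hLE, c, hc, δ', hδ', hperf⟩ := hL
  obtain ⟨δ, hδ0, hδ1, hδ⟩ : ∃ δ : ℝ, 0 < δ ∧ δ ≤ 1 ∧ ENNReal.ofReal δ ≤ δ' := by
    have hne : min δ' 1 ≠ ⊤ := ne_top_of_le_ne_top ENNReal.one_ne_top (min_le_right _ _)
    refine ⟨(min δ' 1).toReal, ENNReal.toReal_pos (lt_min hδ' one_pos).ne' hne, ?_, ?_⟩
    · rw [← ENNReal.toReal_one]
      exact ENNReal.toReal_mono ENNReal.one_ne_top (min_le_right _ _)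
    · rw [ENNReal.ofReal_toReal hne]
      exact min_le_left _ _
  obtain ⟨R, hR⟩ := exists_pow_lt_of_lt_one (show (0 : ℝ) < 1 / 4 by norm_num)
    (show 1 - δ / 2 < 1 by linarith)
  obtain ⟨C, hC⟩ := exists_eval_le_pow T
  set κ := ⌈c⌉₊ with hκ
  have hκ1 : 1 ≤ κ := Nat.ceil_pos.2 hc
  refine ⟨(C + κ * 3 + 2) * 2 + 1, ?_⟩
  intro K m t η η₁ cA a cB b hη hη₁ hη₁' hA hB hm hK ht hcorr herr
  set N : ℕ → ℕ := cubeDim cA a cB b with hN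
  set q : ℕ → ℕ := fun n => cB * Nat.size n ^ b with hq
  set d : ℕ → ℕ := fun n => cA * Nat.size n ^ a with hd
  set W : ℕ → ℕ := fun n => N n ^ κ with hW
  have hNtop : Tendsto N atTop atTop := tendsto_cubeDim hA hB
  have hNW : ∀ᶠ n in atTop, N n ≤ W n := by
    filter_upwards [hNtop.eventually_ge_atTop 1] with n hn
    exact Nat.le_self_pow (by omega) _
  have hbig : ∀ᶠ n in atTop, ((T.eval (N n) + W n ^ 3) * q n) ^ 2 * N n ≤ m n := by
    filter_upwards [hm, hNtop.eventually hC,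
      hNtop.eventually_ge_atTop 2, eventually_ge_atTop 1] with n h1 h2 h3 h4
    refine le_trans ?_ h1
    have h5 : q n ≤ N n := (le_cubeDim hA hB h4).2.1
    have h6 : T.eval (N n) + W n ^ 3 ≤ N n ^ (C + κ * 3 + 1) := by
      calc T.eval (N n) + W n ^ 3 ≤ N n ^ C + N n ^ (κ * 3) := by
            rw [hW, pow_mul]
            gcongr
        _ ≤ N n ^ (C + κ * 3) + N n ^ (C + κ * 3) := by
            gcongr <;> omega
        _ = N n ^ (C + κ * 3) * 2 := by ring
        _ ≤ N n ^ (C + κ * 3 + 1) := by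
            rw [pow_succ]
            gcongr
    calc ((T.eval (N n) + W n ^ 3) * q n) ^ 2 * N n
        ≤ (N n ^ (C + κ * 3 + 1) * N n) ^ 2 * N n := by gcongr
      _ = _ := by
        rw [← pow_succ, ← pow_mul, ← pow_succ]
  have hNm : ∀ᶠ n in atTop, N n ≤ m n := by
    filter_upwards [hm] with n hn
    exact (Nat.le_self_pow (by omega) _).trans hn
  have hmtop : Tendsto m atTop atTop := tendsto_atTop_mono' _ hNm hNtop
  have hWtop : Tendsto W atTop atTop := tendsto_atTop_mono' _ hNW hNtop
  have hηm : ∀ᶠ n in atTop, η * (1 + (m n : ℝ) / 2 ^ m n) ≤ η₁ := by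
    have h1 : Tendsto (fun k : ℕ => η * (1 + (k : ℝ) ^ 1 / 2 ^ k)) atTop (𝓝 (η * (1 + 0))) :=
      ((tendsto_pow_const_div_const_pow_of_one_lt 1 one_lt_two).const_add 1).const_mul η
    have h2 := (h1.comp hmtop).eventually_le_const (show η * (1 + 0) < η₁ by simpa using hη₁)
    filter_upwards [h2] with n hn
    simpa using hn
  have hexp : ∀ᶠ n in atTop, Real.exp (-((W n : ℝ) / 4)) ≤ δ / 2 := by
    have h1 : Tendsto (fun k : ℕ => Real.exp (-((k : ℝ) / 4))) atTop (𝓝 0) :=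
      Real.tendsto_exp_neg_atTop_nhds_zero.comp
        (tendsto_natCast_atTop_atTop.atTop_div_const (by norm_num))
    exact (h1.comp hWtop).eventually_le_const (by linarith)
  obtain ⟨n₀, hn₀⟩ := eventually_atTop.1 ((((((((hbig.and hηm).and hexp).and hK).and ht).and
    hcorr).and herr).and (hNtop.eventually hperf)).and ((hmtop.eventually_ge_atTop
      (a + b + κ + R + 2)).and ((eventually_ge_atTop 1).and hNW)))
  obtain ⟨P, hP⟩ := exists_eval_eq_mainTime
  have hfin : ∀ n ≥ n₀, ∀ [NeZero (m n)], ∀ J : KFormula n (K n) (m n),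
      Final (initial (mainProg L E n₀ cA a cB b κ R) (encodeFormula J)) (P.eval (n + K n + m n))
        (if corr J ≤ (m n + n * 2 ^ K n) * m n then (trialsLaw (trialLaw (exampleLaw J (d n) (q n))
          L (N n) (T.eval (N n)) (W n ^ 2) (W n ^ 3) (predict E (T.eval (N n)) (N n))) R).map
            fun b => [b.toNat] else PMF.pure [1]) := by
    intro n hn _ J
    obtain ⟨⟨⟨⟨⟨⟨⟨⟨h1, -⟩, -⟩, h2⟩, -⟩, -⟩, -⟩, -⟩, h3, h4, h5⟩ := hn₀ n hn
    obtain ⟨k1, k2, k3⟩ : n + n + 1 ≤ N n ∧ q n ≤ N n ∧ d n ≤ N n :=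
      le_cubeDim (a := a) (b := b) hA hB h4
    have hq1 : 1 ≤ q n := Nat.mul_pos hB (pow_pos (size_pos h4) _)
    have hN1 : 1 ≤ N n := by omega
    have h6 : T.eval (N n) + W n ^ 3 ≤ m n := by
      refine le_trans ?_ h1
      calc T.eval (N n) + W n ^ 3 ≤ (T.eval (N n) + W n ^ 3) * q n := Nat.le_mul_of_pos_right _ hq1
        _ ≤ ((T.eval (N n) + W n ^ 3) * q n) ^ 2 := Nat.le_self_pow (by simp) _
        _ ≤ _ := Nat.le_mul_of_pos_right _ hN1
    have h7 : W n ≤ W n ^ 3 := Nat.le_self_pow (by simp) _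
    have hEx := examples_exampleDist J (d n) (q n)
    rw [hP]
    refine final_mainProg (d := d n) (q := q n) (N := N n) (tL := T.eval (N n))
      (tE := T.eval (N n)) (W := W n) ⟨by omega, by omega, by omega, by omega, by omega, rfl,
        by omega, hq1, by omega, by omega, by omega⟩ ?_ ?_ hn rfl rfl rfl (by omega) (by omega)
        (by omega) (by omega) (by omega) (by omega)
    · rw [← hEx]
      exact (hLE (N n) (exampleDist J (d n) (q n))).1
    · rw [← hEx]
      exact hLE.run_predict (exampleDist J (d n) (q n))
  have hm0 : ∀ n ≥ n₀, NeZero (m n) := fun n hn => ⟨by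
    have := (hn₀ n hn).2.1
    omega⟩
  refine ⟨mainProg L E n₀ cA a cB b κ R, P + Polynomial.C 2, ?_, ?_, ?_⟩
  · intro n J
    rw [HaltsWithin, run_eq_stepsFrom, Polynomial.eval_add, Polynomial.eval_C]
    rcases lt_or_ge n n₀ with hn | hn
    · exact (final_mainProg_small J hn _ (by omega)).1
    · have := hm0 n hn
      exact (hfin n hn J _ (by omega)).1
  · intro n J hJ
    rw [output, run_eq_stepsFrom, Polynomial.eval_add, Polynomial.eval_C]
    rcases lt_or_ge n n₀ with hn | hn
    · rw [(final_mainProg_small J hn _ (by omega)).2]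
      simp [ENNReal.div_le_iff]
      norm_num
    · have := hm0 n hn
      rw [(hfin n hn J _ (by omega)).2]
      split_ifs with hcJ
      · obtain ⟨⟨⟨⟨⟨⟨⟨⟨-, h1⟩, h2⟩, h3⟩, h4⟩, h5⟩, h6⟩, h7⟩, h8, h9, h10⟩ := hn₀ n hn
        have hd1 : 1 ≤ d n := Nat.mul_pos hA (pow_pos (size_pos h9) _)
        obtain ⟨D, hD⟩ := Nat.exists_eq_add_of_le' hd1
        have hN1 : 1 ≤ N n := by
          have : n + n + 1 ≤ N n := (le_cubeDim (a := a) (b := b) hA hB h9).1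
          omega
        have hreal : AlmostRealizable (η' (N n)) (exampleDist J (d n) (q n)) := by
          have := errHalf_exampleDist_le (q := q n) (hη.trans hη₁) hη₁' h3.1 h4.1 h1 hcJ h5
            (D := D) (by rw [show D = d n - 1 by omega]; exact h4.2) hJ
          rw [← hD] at this
          exact this.trans h6
        rw [map_toNat_one]
        refine le_trialsLaw_true (x := 1 - δ / 2) ?_ (by linarith) hR.le
        have h11 := hδ.trans (h7 _ hreal)
        rw [← examples_exampleDist J (d n) (q n)]
        refine (trialLaw_false_le (δ := δ) (hN1.trans h10) hδ0.le
          (h11.trans (pr_mono _ ?_))).trans (ENNReal.ofReal_le_ofReal (by linarith))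
        rintro z ⟨h, hh, he⟩ -
        refine ⟨h, hh, he.trans ?_⟩
        have hN1' : (1 : ℝ) ≤ N n := by exact_mod_cast hN1
        have h12 : ((N n : ℕ) : ℝ) ^ c ≤ W n := by
          rw [hW]
          push_cast
          rw [← Real.rpow_natCast]
          exact Real.rpow_le_rpow_of_exponent_le hN1' (Nat.le_ceil c)
        have h13 : (0 : ℝ) < ((N n : ℕ) : ℝ) ^ c := by positivity
        have := one_div_le_one_div_of_le h13 h12
        linarith
      · simp [ENNReal.div_le_iff]
        norm_num
  · have hlim : Tendsto (fun n : ℕ => 1 - (1 / (n : ℝ) + 4 * R * (2 / (n : ℝ) +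
        Real.exp (-((W n : ℝ) / 2))))) atTop (𝓝 (1 - (0 + 4 * R * (0 + 0)))) := by
      have h1 : Tendsto (fun k : ℕ => Real.exp (-((k : ℝ) / 2))) atTop (𝓝 0) :=
        Real.tendsto_exp_neg_atTop_nhds_zero.comp
          (tendsto_natCast_atTop_atTop.atTop_div_const (by norm_num))
      exact ((tendsto_const_div_atTop_nhds_zero_nat 1).add
        (((tendsto_const_div_atTop_nhds_zero_nat 2).add (h1.comp hWtop)).const_mul _)).const_sub 1
    rw [show (1 : ℝ) - (0 + 4 * R * (0 + 0)) = 1 by ring] at hlim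
    have hne : ∀ᶠ n in atTop, Nonempty (KTuple n (K n)) := by
      filter_upwards [hK] with n hn
      exact ⟨((Fin.castLEEmb hn.2), fun _ => 1)⟩
    refine tendsto_of_tendsto_of_tendsto_of_le_of_le' hlim tendsto_const_nhds ?_ ?_
    · filter_upwards [hne, eventually_ge_atTop n₀] with n hn1 hn
      have := hm0 n hn
      obtain ⟨⟨⟨⟨⟨⟨⟨⟨h1, -⟩, -⟩, -⟩, -⟩, -⟩, -⟩, -⟩, h3, h4, h5⟩ := hn₀ n hn
      have k1 : n + n + 1 ≤ N n := (le_cubeDim (a := a) (b := b) hA hB h4).1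
      rw [ncard_div_card]
      refine le_trans ?_ (le_pr_random (d := d n) (q := q n) (N := N n) (W := W n) (R := R)
        (tL := T.eval (N n)) h4 rfl (by omega) L (ev := predict E (T.eval (N n)) (N n))
        (fun z x hx => predict_append E _ _ z hx) _ ?_)
      · have hn' : (0 : ℝ) < n := by exact_mod_cast h4
        have hm' : (0 : ℝ) < m n := by exact_mod_cast Nat.pos_of_ne_zero (NeZero.ne (m n))
        have h6 : (((T.eval (N n) + W n ^ 3 : ℕ) : ℝ) * q n) ^ 2 * (2 / m n) ≤ 2 / n := by
          rw [mul_div_assoc', div_le_div_iff₀ hm' hn']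
          have h7 : (((T.eval (N n) + W n ^ 3 : ℕ) : ℝ) * q n) ^ 2 * N n ≤ m n := by
            exact_mod_cast h1
          have h8 : (n : ℝ) ≤ N n := by
            have : n ≤ N n := by omega
            exact_mod_cast this
          have h9 := mul_le_mul_of_nonneg_left h8
            (sq_nonneg (((T.eval (N n) + W n ^ 3 : ℕ) : ℝ) * q n))
          linarith
        gcongr
      · intro J hcJ hJ
        rw [Set.mem_ofPred_eq, output, run_eq_stepsFrom, Polynomial.eval_add, Polynomial.eval_C,
          (hfin n hn J _ (by omega)).2, if_pos hcJ, map_toNat_zero]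
        exact hJ
    · filter_upwards [hne] with n hn
      rw [ncard_div_card, ← ENNReal.toReal_one]
      exact ENNReal.toReal_mono ENNReal.one_ne_top (pr_le_one _ _)

/-! ### Choice of the parameters -/

lemma exists_between_half {η : ℝ} (h0 : 0 < η) (h : η < 1 / 2) :
    ∃ η₁, η < η₁ ∧ η₁ ≤ 1 / 2 ∧ 0 < 1 / 2 + 2 * η₁ * (1 - η₁) ∧
      1 / 2 + 2 * η₁ * (1 - η₁) < 1 := by
  refine ⟨(2 * η + 1) / 4, by linarith, by linarith, by nlinarith, by nlinarith⟩

/-- For constant accuracy, a constant number of literals suffices. -/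
theorem not_learner_const (h : XorAssumption) (ε : ℝ) (hε : 0 < ε) :
    ¬ ExistsNontrivialLearner fun _ => ε := by
  intro hL
  obtain ⟨c, hc, η, hη, hη', hhard⟩ := h
  obtain ⟨C, hC⟩ := cspEasy_of_learner hL
  obtain ⟨η₁, h1, h2, hρ0, hρ1⟩ := exists_between_half hη hη'
  set ρ := 1 / 2 + 2 * η₁ * (1 - η₁) with hρ
  obtain ⟨q, hq⟩ : ∃ q : ℕ, ρ ^ (q + 1) < ε / 2 := by
    obtain ⟨q, hq⟩ := exists_pow_lt_of_lt_one (half_pos hε) hρ1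
    exact ⟨q, lt_of_le_of_lt (pow_le_pow_of_le_one hρ0.le hρ1.le (Nat.le_succ q)) hq⟩
  obtain ⟨t, ht1, ht⟩ : ∃ t : ℕ, 1 ≤ t ∧ 6 * ((q + 1 : ℕ) : ℝ) / 2 ^ t ≤ ε / 2 := by
    have hlim : Tendsto (fun t : ℕ => 6 * ((q + 1 : ℕ) : ℝ) / 2 ^ t) atTop (𝓝 0) :=
      (tendsto_pow_atTop_atTop_of_one_lt one_lt_two).const_div_atTop _
    exact ((eventually_ge_atTop 1).and (hlim.eventually_le_const (half_pos hε))).exists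
  set A : ℝ := (2 * √(12 * t) + 7) * C + 2 * t + 2 with hA
  obtain ⟨K, hK1, hKA⟩ : ∃ K : ℕ, 1 ≤ K ∧ A ≤ c * Real.logb 2 K := by
    have hlim : Tendsto (fun K : ℕ => c * Real.logb 2 K) atTop atTop :=
      ((Real.tendsto_logb_atTop one_lt_two).comp tendsto_natCast_atTop_atTop).const_mul_atTop hc
    exact ((eventually_ge_atTop 1).and (hlim.eventually_ge_atTop A)).exists
  set D := Nat.sqrt (12 * K * t) + 1 with hD
  set e := (2 * (D + 1) + 1) * C + 2 * t + 2 with he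
  have heA : (e : ℝ) ≤ c * Real.logb 2 K * √(K : ℝ) := by
    have hsK : 1 ≤ √(K : ℝ) := Real.one_le_sqrt.2 (by exact_mod_cast hK1)
    have hDle : (D : ℝ) ≤ √(12 * t) * √(K : ℝ) + 1 := by
      rw [← Real.sqrt_mul (by positivity), hD]
      push_cast
      have := Real.nat_sqrt_le_real_sqrt (a := 12 * K * t)
      push_cast at this
      rw [show (12 : ℝ) * t * K = 12 * K * t by ring]
      linarith
    have h3 : (e : ℝ) ≤ A * √(K : ℝ) := by
      rw [he, hA]
      push_cast
      have h4 : (2 * ((D : ℝ) + 1) + 1) ≤ (2 * √(12 * t) + 7) * √(K : ℝ) := by nlinarith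
      have h5 := mul_le_mul_of_nonneg_right h4 (Nat.cast_nonneg (α := ℝ) C)
      have h6 : (2 * t + 2 : ℝ) * 1 ≤ (2 * t + 2) * √(K : ℝ) := by gcongr
      nlinarith
    exact h3.trans (by gcongr)
  have hpow : ∀ n : ℕ, 1 ≤ n → n ^ e ≤ ⌊(n : ℝ) ^ (c * Real.logb 2 K * √(K : ℝ))⌋₊ := by
    intro n hn
    refine Nat.le_floor ?_
    push_cast
    rw [← Real.rpow_natCast]
    exact Real.rpow_le_rpow_of_exponent_le (by exact_mod_cast hn) heA
  refine hhard K hK1 (hC (t := fun _ => t) (cA := D + 1) (a := 0) (cB := q + 1) (b := 0) hη h1 h2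
    (by omega) (by omega) ?_ ?_ ?_ ?_ ?_)
  · filter_upwards [eventually_ge_atTop (q + 1), eventually_ge_atTop 3] with n hn hn3
    refine le_trans ?_ (hpow n (by omega))
    calc cubeDim (D + 1) 0 (q + 1) 0 n ^ C = ((q + 1) * (n + n + 1) ^ (D + 1)) ^ C := by
          simp [cubeDim]
      _ ≤ (n * (n ^ 2) ^ (D + 1)) ^ C := by
          gcongr
          nlinarith
      _ = n ^ ((2 * (D + 1) + 1) * C) := by
          rw [← pow_mul, ← pow_succ', ← pow_mul]
      _ ≤ n ^ e := Nat.pow_le_pow_right (by omega) (by omega)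
  · filter_upwards [eventually_ge_atTop K] with n hn using ⟨hK1, hn⟩
  · refine Eventually.of_forall fun n => ⟨ht1, ?_⟩
    rw [pow_zero, mul_one, Nat.add_sub_cancel, sq]
    exact (Nat.lt_succ_sqrt _).le
  · filter_upwards [eventually_ge_atTop (2 ^ K * K ^ (4 * t)), eventually_ge_atTop 1] with n hn hn1
    refine le_trans ?_ (hpow n hn1)
    calc n ^ (2 * t + 1) * 2 ^ K * K ^ (4 * t) = n ^ (2 * t + 1) * (2 ^ K * K ^ (4 * t)) := by ring
      _ ≤ n ^ (2 * t + 1) * n := by gcongr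
      _ = n ^ (2 * t + 2) := by ring
      _ ≤ n ^ e := Nat.pow_le_pow_right hn1 (by omega)
  · refine Eventually.of_forall fun n => ?_
    simp only [pow_zero, mul_one]
    linarith

lemma tendsto_size : Tendsto Nat.size atTop atTop := by
  refine tendsto_atTop.2 fun k => ?_
  filter_upwards [eventually_ge_atTop (2 ^ k)] with n hn
  exact (Nat.lt_size.2 hn).le

lemma logb_lt_size (n : ℕ) : Real.logb 2 n ≤ Nat.size n := by
  rcases Nat.eq_zero_or_pos n with rfl | hn
  · simp
  rw [Real.logb_le_iff_le_rpow one_lt_two (by exact_mod_cast hn), Real.rpow_natCast]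
  exact_mod_cast (Nat.lt_size_self n).le

lemma size_le_logb {n : ℕ} (hn : 1 ≤ n) : (Nat.size n : ℝ) - 1 ≤ Real.logb 2 n := by
  obtain ⟨k, hk⟩ := Nat.exists_eq_add_of_le' (size_pos hn)
  have h := Nat.lt_size.1 (show k < Nat.size n by omega)
  rw [Real.le_logb_iff_rpow_le one_lt_two (by exact_mod_cast hn), hk]
  push_cast
  rw [add_sub_cancel_right, Real.rpow_natCast]
  exact_mod_cast h

lemma eventually_error_le {ρ : ℝ} (h0 : 0 < ρ) (h1 : ρ < 1) : ∃ θ : ℝ, 0 < θ ∧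
    ∀ᶠ x : ℕ in atTop, 6 * (x : ℝ) / 2 ^ x + ρ ^ x ≤ (2 : ℝ) ^ (-(θ * x)) := by
  obtain ⟨r, hr, hr1⟩ := exists_between (max_lt h1 (show (1 / 2 : ℝ) < 1 by norm_num))
  have hρr : ρ < r := (le_max_left _ _).trans_lt hr
  have h2r : 1 / 2 < r := (le_max_right _ _).trans_lt hr
  have hr0 : 0 < r := h0.trans hρr
  refine ⟨-Real.logb 2 r, by linarith [Real.logb_neg one_lt_two hr0 hr1], ?_⟩
  have hlim : Tendsto (fun x : ℕ => 6 * ((x : ℝ) * (1 / 2 / r) ^ x) + (ρ / r) ^ x) atTop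
      (𝓝 (6 * 0 + 0)) :=
    ((tendsto_self_mul_const_pow_of_lt_one (by positivity) ((div_lt_one hr0).2 h2r)).const_mul
      6).add (tendsto_pow_atTop_nhds_zero_of_lt_one (by positivity) ((div_lt_one hr0).2 hρr))
  filter_upwards [hlim.eventually_le_const (show (6 : ℝ) * 0 + 0 < 1 by norm_num)] with x hx
  have h3 : (2 : ℝ) ^ (-(-Real.logb 2 r * x)) = r ^ x := by
    rw [neg_mul, neg_neg, Real.rpow_mul (by norm_num), Real.rpow_logb (by norm_num) (by norm_num)
      hr0, Real.rpow_natCast]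
  rw [h3]
  calc 6 * (x : ℝ) / 2 ^ x + ρ ^ x = (6 * ((x : ℝ) * (1 / 2 / r) ^ x) + (ρ / r) ^ x) * r ^ x := by
        rw [div_pow, div_pow, div_pow, one_pow]
        field_simp
    _ ≤ 1 * r ^ x := by gcongr
    _ = r ^ x := one_mul _

/-- For almost constant accuracy, a polylogarithmic number of literals suffices. -/
theorem not_learner_polylog (h : StrongXorAssumption) (ν : ℝ) (hν : 0 < ν) :
    ¬ ExistsNontrivialLearner fun n => (2 : ℝ) ^ (-(Real.logb 2 (n : ℝ) ^ (1 - ν))) := by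
  intro hL
  obtain ⟨c, hc, η, hη, hη', hhard⟩ := h
  obtain ⟨C, hC⟩ := cspEasy_of_learner hL
  obtain ⟨η₁, h1, h2, hρ0, hρ1⟩ := exists_between_half hη hη'
  obtain ⟨θ, hθ, herr⟩ := eventually_error_le hρ0 hρ1
  set μ := min ν 1 with hμ
  have hμ0 : 0 < μ := lt_min hν one_pos
  have hμ1 : μ ≤ 1 := min_le_right _ _
  set r := ⌈3 / μ⌉₊ with hr
  have hrμ : 3 ≤ (r + 3 : ℝ) * μ := by
    have := (div_le_iff₀ hμ0).1 (Nat.le_ceil (3 / μ))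
    nlinarith
  set K := polylog (r + 3) with hK
  set N : ℕ → ℕ := cubeDim 5 (r + 2) 1 (r + 1) with hN
  have hsize : ∀ᶠ n in atTop, 1 ≤ n ∧ 1 ≤ Nat.size n := by
    filter_upwards [eventually_ge_atTop 1] with n hn using ⟨hn, size_pos hn⟩
  have hKle : ∀ᶠ n in atTop, K n ≤ Nat.size n ^ (r + 3) := by
    filter_upwards [hsize] with n hn
    refine Nat.ceil_le.2 ?_
    push_cast
    exact pow_le_pow_left₀ (Real.logb_nonneg one_lt_two (by exact_mod_cast hn.1))
      (logb_lt_size n) _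
  have hKn : ∀ᶠ n in atTop, 1 ≤ K n ∧ K n ≤ n := by
    have hlim : Tendsto (fun k : ℕ => (k : ℝ) ^ (r + 3) / 2 ^ k) atTop (𝓝 0) :=
      tendsto_pow_const_div_const_pow_of_one_lt (r + 3) one_lt_two
    filter_upwards [hKle, eventually_ge_atTop 2, hsize, (hlim.comp tendsto_size).eventually_le_const
      (show (0 : ℝ) < 1 / 2 by norm_num)] with n h3 h4 h5 h6
    constructor
    · refine Nat.ceil_pos.2 (pow_pos (Real.logb_pos one_lt_two ?_) _)
      exact_mod_cast h4
    · refine h3.trans ?_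
      obtain ⟨k, hk⟩ := Nat.exists_eq_add_of_le' h5.2
      have h7 := Nat.lt_size.1 (show k < Nat.size n by omega)
      refine le_trans ?_ h7
      simp only [Function.comp_apply] at h6
      rw [div_le_div_iff₀ (by positivity) (by norm_num), hk, pow_succ 2] at h6
      rw [hk]
      have h8 : ((k + 1 : ℕ) : ℝ) ^ (r + 3) ≤ 2 ^ k := by linarith
      exact_mod_cast h8
  have hNle : ∀ᶠ n in atTop, N n ≤ 2 ^ (16 * Nat.size n ^ (r + 3)) := by
    filter_upwards [hsize] with n hn
    set ℓ := Nat.size n with hℓ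
    have h3 : n + n + 1 ≤ 2 ^ (ℓ + 1) := by
      have h0 := Nat.lt_size_self n
      rw [← hℓ] at h0
      rw [pow_succ]
      omega
    calc N n = 1 * ℓ ^ (r + 1) * (n + n + 1) ^ (5 * ℓ ^ (r + 2)) := rfl
      _ ≤ 1 * 2 ^ (ℓ ^ (r + 1)) * (2 ^ (ℓ + 1)) ^ (5 * ℓ ^ (r + 2)) := by
          exact Nat.mul_le_mul (Nat.mul_le_mul le_rfl Nat.lt_two_pow_self.le)
            (Nat.pow_le_pow_left h3 _)
      _ = 2 ^ (ℓ ^ (r + 1) + (ℓ + 1) * (5 * ℓ ^ (r + 2))) := by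
          rw [one_mul, ← pow_mul, ← pow_add]
      _ ≤ _ := by
          refine Nat.pow_le_pow_right (by norm_num) ?_
          have h4 : ℓ ^ (r + 1) ≤ ℓ ^ (r + 3) := Nat.pow_le_pow_right hn.2 (by omega)
          have h5 : ℓ ^ (r + 2) ≤ ℓ ^ (r + 3) := Nat.pow_le_pow_right hn.2 (by omega)
          have h6 : (ℓ + 1) * (5 * ℓ ^ (r + 2)) = 5 * ℓ ^ (r + 3) + 5 * ℓ ^ (r + 2) := by ring
          omega
  have hm : ∀ A : ℕ, ∀ᶠ n : ℕ in atTop, 2 ^ (A * Nat.size n ^ (r + 3)) ≤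
      ⌊(n : ℝ) ^ (c * (K n : ℝ))⌋₊ := by
    intro A
    filter_upwards [hsize, tendsto_size.eventually_ge_atTop 2, tendsto_size.eventually_ge_atTop
      ⌈A * 2 ^ (r + 4) / c⌉₊] with n hn h3 h4
    set ℓ := Nat.size n with hℓ
    refine Nat.le_floor ?_
    have hn0 : (0 : ℝ) < n := by exact_mod_cast hn.1
    have h3' : (2 : ℝ) ≤ ℓ := by exact_mod_cast h3
    have h5 : (ℓ : ℝ) / 2 ≤ Real.logb 2 n := by
      have := size_le_logb hn.1
      rw [← hℓ] at this
      linarith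
    have h5' : 0 ≤ Real.logb 2 n := by linarith
    have h6 : Real.logb 2 n ^ (r + 3) ≤ K n := Nat.le_ceil _
    have h7 : A * 2 ^ (r + 4) ≤ (ℓ : ℝ) * c := (div_le_iff₀ hc).1 (Nat.ceil_le.1 h4)
    have h8 : (A : ℝ) * (ℓ : ℝ) ^ (r + 3) ≤ Real.logb 2 n * (c * K n) := by
      calc (A : ℝ) * (ℓ : ℝ) ^ (r + 3) = A * 2 ^ (r + 4) * (ℓ : ℝ) ^ (r + 3) / 2 ^ (r + 4) := by
            field_simp
        _ ≤ ℓ * c * (ℓ : ℝ) ^ (r + 3) / 2 ^ (r + 4) := by gcongr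
        _ = ℓ / 2 * (c * ((ℓ : ℝ) / 2) ^ (r + 3)) := by
            rw [div_pow]
            field_simp
            ring
        _ ≤ Real.logb 2 n * (c * Real.logb 2 n ^ (r + 3)) := by gcongr
        _ ≤ _ := by gcongr
    push_cast
    calc (2 : ℝ) ^ (A * ℓ ^ (r + 3)) = (2 : ℝ) ^ ((A : ℝ) * (ℓ : ℝ) ^ (r + 3)) := by
          rw [← Real.rpow_natCast]
          push_cast
          rfl
      _ ≤ (2 : ℝ) ^ (Real.logb 2 n * (c * K n)) :=
          Real.rpow_le_rpow_of_exponent_le one_le_two h8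
      _ = (n : ℝ) ^ (c * (K n : ℝ)) := by
          rw [Real.rpow_mul (by norm_num), Real.rpow_logb (by norm_num) (by norm_num) hn0]
  refine hhard (r + 3) (by omega) (hC (t := fun n => Nat.size n ^ (r + 1)) (cA := 5) (a := r + 2)
    (cB := 1) (b := r + 1) hη h1 h2 (by omega) (by omega) ?_ hKn ?_ ?_ ?_)
  · filter_upwards [hNle, hm (16 * C)] with n h3 h4
    refine le_trans ?_ h4
    calc N n ^ C ≤ (2 ^ (16 * Nat.size n ^ (r + 3))) ^ C := by gcongr
      _ = _ := by
        rw [← pow_mul]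
        congr 1
        ring
  · filter_upwards [hsize, hKle] with n hn h3
    set ℓ := Nat.size n with hℓ
    refine ⟨Nat.one_le_pow _ _ hn.2, ?_⟩
    have h4 : 1 ≤ ℓ ^ (r + 2) := Nat.one_le_pow _ _ hn.2
    calc 12 * polylog (r + 3) n * ℓ ^ (r + 1) ≤ 12 * ℓ ^ (r + 3) * ℓ ^ (r + 1) := by gcongr
      _ = 12 * (ℓ ^ (r + 2)) ^ 2 := by ring
      _ ≤ (4 * ℓ ^ (r + 2)) ^ 2 := by nlinarith
      _ ≤ _ := by
        gcongr
        omega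
  · filter_upwards [hsize, hKle, hKn, hm 8] with n hn h3 h4 h5
    refine le_trans ?_ h5
    set ℓ := Nat.size n with hℓ
    have h6 : n ≤ 2 ^ ℓ := (Nat.lt_size_self n).le
    have h7 : K n ≤ 2 ^ ℓ := h4.2.trans h6
    calc n ^ (2 * ℓ ^ (r + 1) + 1) * 2 ^ K n * K n ^ (4 * ℓ ^ (r + 1))
        ≤ (2 ^ ℓ) ^ (2 * ℓ ^ (r + 1) + 1) * 2 ^ (ℓ ^ (r + 3)) * (2 ^ ℓ) ^ (4 * ℓ ^ (r + 1)) := by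
          gcongr
          norm_num
      _ = 2 ^ (ℓ * (2 * ℓ ^ (r + 1) + 1) + ℓ ^ (r + 3) + ℓ * (4 * ℓ ^ (r + 1))) := by
          rw [← pow_mul, ← pow_mul, ← pow_add, ← pow_add]
      _ ≤ _ := by
          refine Nat.pow_le_pow_right (by norm_num) ?_
          have h8 : ℓ * ℓ ^ (r + 1) ≤ ℓ ^ (r + 3) := by
            rw [← pow_succ']
            exact Nat.pow_le_pow_right hn.2 (by omega)
          have h9 : ℓ ≤ ℓ ^ (r + 3) := Nat.le_self_pow (by omega) _
          nlinarith
  · have hlim : Tendsto (fun n => Nat.size n ^ (r + 1)) atTop atTop :=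
      (tendsto_pow_atTop (by omega)).comp tendsto_size
    have hNtop : Tendsto N atTop atTop := tendsto_cubeDim (by omega) (by omega)
    filter_upwards [hsize, hNle, hlim.eventually herr, hNtop.eventually_ge_atTop 2,
      tendsto_size.eventually_ge_atTop ⌈16 / θ⌉₊] with n hn h3 h4 h5 h6
    set ℓ := Nat.size n with hℓ
    rw [one_mul]
    refine h4.trans (Real.rpow_le_rpow_of_exponent_le one_le_two (neg_le_neg ?_))
    have hN0 : (0 : ℝ) < N n := by
      have : 0 < N n := by omega
      exact_mod_cast this
    have hℓ1 : (1 : ℝ) ≤ ℓ := by exact_mod_cast hn.2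
    have h7 : 1 ≤ Real.logb 2 (N n) := by
      rw [Real.le_logb_iff_rpow_le one_lt_two hN0, Real.rpow_one]
      exact_mod_cast h5
    have h8 : Real.logb 2 (N n) ≤ 16 * (ℓ : ℝ) ^ (r + 3) := by
      rw [Real.logb_le_iff_le_rpow one_lt_two hN0]
      have : ((N n : ℕ) : ℝ) ≤ 2 ^ (16 * ℓ ^ (r + 3)) := by exact_mod_cast h3
      rw [← Real.rpow_natCast] at this
      push_cast at this
      exact this
    calc Real.logb 2 (N n) ^ (1 - ν) ≤ Real.logb 2 (N n) ^ (1 - μ) :=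
          Real.rpow_le_rpow_of_exponent_le h7 (by linarith [min_le_left ν 1])
      _ ≤ (16 * (ℓ : ℝ) ^ (r + 3)) ^ (1 - μ) :=
          Real.rpow_le_rpow (by linarith) h8 (by linarith)
      _ = 16 ^ (1 - μ) * (ℓ : ℝ) ^ ((r + 3 : ℝ) * (1 - μ)) := by
          rw [Real.mul_rpow (by norm_num) (by positivity), ← Real.rpow_natCast,
            ← Real.rpow_mul (by positivity)]
          push_cast
          rfl
      _ ≤ 16 ^ (1 : ℝ) * (ℓ : ℝ) ^ (r : ℝ) := by
          gcongr
          · norm_num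
          · linarith
          · linarith
      _ = 16 * (ℓ : ℝ) ^ r := by rw [Real.rpow_one, Real.rpow_natCast]
      _ ≤ (θ * ℓ) * (ℓ : ℝ) ^ r := by
          gcongr
          rw [mul_comm]
          exact (div_le_iff₀ hθ).1 (Nat.ceil_le.1 h6)
      _ = θ * ((ℓ ^ (r + 1) : ℕ) : ℝ) := by
          push_cast
          ring

end HalfspaceHardness

end

theorem theorem1 :
    (HalfspaceHardness.XorAssumption →
      ∀ η : ℝ, 0 < η → ¬ HalfspaceHardness.ExistsNontrivialLearner (fun _ => η)) ∧
    (HalfspaceHardness.StrongXorAssumption →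
      ∀ ν : ℝ, 0 < ν → ¬ HalfspaceHardness.ExistsNontrivialLearner
        (fun n => (2 : ℝ) ^ (-(Real.logb 2 (n : ℝ) ^ (1 - ν))))) := by
  exact ⟨HalfspaceHardness.not_learner_const, HalfspaceHardness.not_learner_polylog⟩
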